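/- Let $p\in(0,3/4]$, $q\in(0,1]$, $\rho\in(0,1]$. Let $X_1,X_2,\dots$ be the steps of the elephant random walk with memory parameter $p$ and first-step parameter $q$: $\mathbf P(X_1=1)=q$, $\mathbf P(X_1=-1)=1-q$, and for every $n\ge 1$, $X_{n+1}=\alpha_{n+1}X_{\beta_{n+1}}$, where $\mathbf P(\alpha_{n+1}=1)=p$, $\mathbf P(\alpha_{n+1}=-1)=1-p$, $\beta_{n+1}$ is uniformly distributed on $\{1,\dots,n\}$, and $\alpha_{n+1}$, $\beta_{n+1}$ and $(X_1,\dots,X_n)$ are mutually independent. Let $(Z_i)_{i\ge 1}$ be positive i.i.d. random variables, independent of $(X_i)_{i\ge1}$, with $\mathbf E Z_1=1$, $\operatorname{Var}(Z_1)=\sigma^2\ge 0$ and $M(\rho)=\mathbf E Z_1^{2+\rho}<\infty$. Put $S_n=\sum_{i=1}^n X_iZ_i$ (the elephant random walk with random step sizes), $$a_n=\frac{\Gamma(n)\Gamma(2p)}{\Gamma(n+2p-1)}\quad(\text{so } a_1=1),\qquad v_n=\sum_{i=1}^n a_i^2 ,$$ and for a real random variable $W$ let $\mathbf K(W)=\sup_{u\in\mathbf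 R}|\mathbf P(W\le u)-\Phi(u)|$, where $\Phi$ is the standard normal distribution function. Then there is a constant $C>0$, depending only on $p$, $q$, $\rho$, $\sigma^2$ and $M(\rho)$, such that for every $n\ge 1$, $$\mathbf K\!\left(\frac{a_nS_n-(2q-1)}{\sqrt{v_n+n a_n^2\sigma^2}}\right)\le C\left(\frac1{n^{\rho/2}}+\frac1{v_n}\right).$$ -/

import Mathlib

open MeasureTheory ProbabilityTheory

noncomputable section

/-- The real random variable `ξ` has the Rademacher distribution with parameter `r`:
it takes the value `1` with probability `r` and the value `-1` with probability `1 - r`. -/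
structure IsRademacher {Ω : Type*} [MeasurableSpace Ω] (μ : Measure Ω) (ξ : Ω → ℝ) (r : ℝ) :
    Prop where
  measurable : Measurable ξ
  prob_one : μ.real {ω | ξ ω = 1} = r
  prob_neg_one : μ.real {ω | ξ ω = -1} = 1 - r

/-- `β` is uniformly distributed over the integers `{1, …, n}`. -/
structure IsUniformUpTo {Ω : Type*} [MeasurableSpace Ω] (μ : Measure Ω) (β : Ω → ℕ) (n : ℕ) :
    Prop where
  measurable : Measurable β
  prob_eq : ∀ k ∈ Finset.Icc 1 n, μ.real {ω | β ω = k} = 1 / (n : ℝ)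

/-- `X 1, X 2, …` are the steps of the elephant random walk with memory parameter `p` and first
step parameter `q`: at time `n + 1` the elephant picks a uniformly distributed past time
`β (n + 1)` in `{1, …, n}` and repeats (`α (n + 1) = 1`, with probability `p`) or reverses
(`α (n + 1) = -1`, with probability `1 - p`) the step made at that time. The choices `α (n + 1)`,
`β (n + 1)` and the past `(X 1, …, X n)` are mutually independent (the first is independent of
the other two together, and these two are independent of each other).
The values at index `0` (and `α 1`, `β 1`) play no role. -/
structure IsElephantWalk {Ω : Type*} [MeasurableSpace Ω] (μ : Measure Ω) (p q : ℝ)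
    (α : ℕ → Ω → ℝ) (β : ℕ → Ω → ℕ) (X : ℕ → Ω → ℝ) : Prop where
  measurable : ∀ n, 1 ≤ n → Measurable (X n)
  first_step : IsRademacher μ (X 1) q
  rademacher : ∀ n, 1 ≤ n → IsRademacher μ (α (n + 1)) p
  uniform : ∀ n, 1 ≤ n → IsUniformUpTo μ (β (n + 1)) n
  step : ∀ n, 1 ≤ n → ∀ᵐ ω ∂μ, X (n + 1) ω = α (n + 1) ω * X (β (n + 1) ω) ω
  indep_sign : ∀ n, 1 ≤ n →
    IndepFun (α (n + 1)) (fun ω => (β (n + 1) ω, fun i : Fin n => X (i.val + 1) ω)) μ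
  indep_time : ∀ n, 1 ≤ n →
    IndepFun (β (n + 1)) (fun ω => fun i : Fin n => X (i.val + 1) ω) μ

/-- `Z 1, Z 2, …` are positive i.i.d. random variables with mean `1` and variance `σ ^ 2`.
(Finiteness of the mean and of the variance is expressed by `MemLp (Z 1) 2 μ`.) -/
structure IsStepSizes {Ω : Type*} [MeasurableSpace Ω] (μ : Measure Ω) (σ : ℝ)
    (Z : ℕ → Ω → ℝ) : Prop where
  measurable : ∀ n, 1 ≤ n → Measurable (Z n)
  pos : ∀ n, 1 ≤ n → ∀ᵐ ω ∂μ, 0 < Z n ω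
  indep : iIndepFun (fun i : ℕ => Z (i + 1)) μ
  identDistrib : ∀ n, 1 ≤ n → IdentDistrib (Z n) (Z 1) μ μ
  memLp_two : MemLp (Z 1) 2 μ
  mean_eq : ∫ ω, Z 1 ω ∂μ = 1
  variance_eq : variance (Z 1) μ = σ ^ 2

/-- The position `S n = Y 1 + ⋯ + Y n` of the walk with random step sizes, with steps
`Y i = X i * Z i` (so that `Y i = α i * X (β i) * Z i` almost surely for `i ≥ 2`). -/
def walkPosition {Ω : Type*} (X Z : ℕ → Ω → ℝ) (n : ℕ) (ω : Ω) : ℝ :=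
  ∑ i ∈ Finset.Icc 1 n, X i ω * Z i ω

/-- `a_n = Γ(n) Γ(2p) / Γ(n + 2p - 1)`, for `n ≥ 1`; in particular `a_1 = 1`. -/
def erwA (p : ℝ) (n : ℕ) : ℝ :=
  Real.Gamma n * Real.Gamma (2 * p) / Real.Gamma (n + 2 * p - 1)

/-- `v_n = a_1 ^ 2 + ⋯ + a_n ^ 2`. -/
def erwV (p : ℝ) (n : ℕ) : ℝ :=
  ∑ i ∈ Finset.Icc 1 n, erwA p i ^ 2

/-- The Kolmogorov distance between the law of the real random variable `W` and the standard
normal distribution. -/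
def kolmogorovDist {Ω : Type*} [MeasurableSpace Ω] (μ : Measure Ω) (W : Ω → ℝ) : ℝ :=
  ⨆ u : ℝ, |μ.real {ω | W ω ≤ u} - cdf (gaussianReal 0 1) u|

end

/-! Write `T_n = X_1 + ⋯ + X_n` and `M_n = a_n T_n - (2q - 1)`. Then `a_n S_n - (2q - 1) = M_n + a_n
∑ X_i (Z_i - 1)` (`walkPosition_eq`). Given the signs, the second sum consists of independent
centered terms of variance `σ²`. A Berry-Esseen bound that is uniform in the signs
(`exists_signed_berry_esseen`) replaces it by a normal variable at cost `n^(-ρ/2)`. What remains is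
the law of `M_n` convolved with a normal law of variance `n a_n² σ²`. Convolution does not increase
the Kolmogorov distance, so a bound of order `1/√n + 1/v_n` between `M_n` and the normal law of
variance `v_n` (`exists_walk_berry_esseen`) finishes the proof.

Both Berry-Esseen bounds come from Lindeberg's replacement method. Steps are exchanged one at a time
for normal ones, and `E Φ((u - M_k)/s_k)` is followed, where `s_k²` is the variance still to come
plus a small `κ²`. Normal smoothings compose by adding variances (`gaussSmooth_smoothCdf`), so these
quantities telescope. The final smoothing by `κ` is removed at cost `κ` divided by the standard
deviation (`exists_cdfGap_le_of_gaussSmooth_le`).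

For a step of the walk, `T_k` is a Markov chain: the next step is `±1` with conditional mean `D =
(2p - 1) T_k / k`. Removing this tilt costs `|D| (a/s)³ + D² (a/s)²` (`HasSmoothBound.tilted_step`),
where `E D²` is at most `v_k / (k a_k)²`. The symmetric step `±a` left over has no third moment, so
it differs from a normal step only at order `(a/s)⁴` (`exists_symm_step_bound`). Hence the rate
`1/√n + 1/v_n`.

The crude one-step errors are too large for the last steps, where `s_k` is small. There the law of
the current position is split into its normal approximation, which is smooth at the large scale
`√(s² + w²)`, and a gap. The smoothing bounds are linear in the supremum of the smoothed function
(`exists_gaussSmooth_bound`), so the gap contributes an error multiplied by the bound already known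
for smaller times. Strong induction closes once `κ` is a large enough multiple of the last step's
standard deviation, which makes the sum of these contributions at most half of the claimed bound. At
`p = 3/4` the weights `a_k²` decay like `1/k` while `v_n` grows more slowly than any power of `n`;
the crude bounds with `κ² = 1/v_n` then suffice, without induction. -/

/-! ### Gaussian smoothing of bounded functions -/

/-- The kernel `P(z) exp (-z ^ 2 / 2)`. -/
noncomputable def gaussKernel (P : Polynomial ℝ) (z : ℝ) : ℝ :=
  P.eval z * Real.exp (-z ^ 2 / 2)

/-- Polynomial multiples of `exp (-z²/2)` are closed under differentiation, so this single rule can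
be iterated to reach the fourth derivative. -/
theorem hasDerivAt_gaussKernel (P : Polynomial ℝ) (z : ℝ) :
    HasDerivAt (gaussKernel P) (gaussKernel (P.derivative - Polynomial.X * P) z) z := by
  have h1 := P.hasDerivAt z
  have h2 : HasDerivAt (fun z : ℝ => Real.exp (-z ^ 2 / 2)) (Real.exp (-z ^ 2 / 2) * (-z)) z := by
    have h3 : HasDerivAt (fun z : ℝ => -z ^ 2 / 2) (-z) z := by
      have := ((hasDerivAt_pow 2 z).neg).div_const 2
      convert! this using 1
      simp
      ring
    exact h3.exp
  convert! h1.mul h2 using 1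
  simp [gaussKernel]
  ring

theorem continuous_gaussKernel (P : Polynomial ℝ) : Continuous (gaussKernel P) :=
  continuous_iff_continuousAt.2 fun z => (hasDerivAt_gaussKernel P z).continuousAt

theorem exists_abs_eval_le_exp (P : Polynomial ℝ) :
    ∃ C : ℝ, 0 ≤ C ∧ ∀ z : ℝ, |P.eval z| ≤ C * Real.exp |z| := by
  induction P using Polynomial.induction_on' with
  | add P Q hP hQ =>
    obtain ⟨C, hC, h⟩ := hP
    obtain ⟨C', hC', h'⟩ := hQ
    refine ⟨C + C', by positivity, fun z => ?_⟩
    rw [Polynomial.eval_add]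
    linarith [abs_add_le (P.eval z) (Q.eval z), h z, h' z]
  | monomial n a =>
    refine ⟨|a| * n.factorial, by positivity, fun z => ?_⟩
    rw [Polynomial.eval_monomial, abs_mul, abs_pow, mul_assoc]
    gcongr
    have := Real.pow_div_factorial_le_exp |z| (abs_nonneg z) n
    rw [div_le_iff₀ (by positivity)] at this
    linarith

/-- The weight `(1 + z²)⁻¹` is integrable and changes only by a constant factor under translations
by less than `1`, which is what dominated differentiation needs. -/
theorem exists_abs_gaussKernel_le (P : Polynomial ℝ) :
    ∃ C : ℝ, 0 ≤ C ∧ ∀ z : ℝ, |gaussKernel P z| ≤ C * (1 + z ^ 2)⁻¹ := by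
  obtain ⟨C, hC, h⟩ := exists_abs_eval_le_exp (P * (1 + Polynomial.X ^ 2))
  refine ⟨C * Real.exp (1 / 2), by positivity, fun z => ?_⟩
  have h1 := h z
  have hz : 0 < 1 + z ^ 2 := by positivity
  rw [← div_eq_mul_inv, le_div_iff₀ hz]
  simp only [Polynomial.eval_mul, Polynomial.eval_add, Polynomial.eval_one, Polynomial.eval_pow,
    Polynomial.eval_X, abs_mul, abs_of_pos hz] at h1
  rw [gaussKernel, abs_mul, Real.abs_exp]
  have h2 : Real.exp |z| * Real.exp (-z ^ 2 / 2) ≤ Real.exp (1 / 2) := by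
    rw [← Real.exp_add]
    apply Real.exp_le_exp.2
    nlinarith [sq_nonneg (|z| - 1), sq_abs z]
  calc _ = |P.eval z| * (1 + z ^ 2) * Real.exp (-z ^ 2 / 2) := by ring
    _ ≤ C * Real.exp |z| * Real.exp (-z ^ 2 / 2) := by gcongr
    _ = C * (Real.exp |z| * Real.exp (-z ^ 2 / 2)) := by ring
    _ ≤ _ := by gcongr

theorem integrable_gaussKernel (P : Polynomial ℝ) : Integrable (gaussKernel P) := by
  obtain ⟨C, hC, h⟩ := exists_abs_gaussKernel_le P
  exact (integrable_inv_one_add_sq.const_mul C).mono'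
    (continuous_gaussKernel P).aestronglyMeasurable (Filter.Eventually.of_forall h)

/-- The convolution of `G` with the kernel `P(z) exp (-z ^ 2 / 2)`. -/
noncomputable def kernelConv (P : Polynomial ℝ) (G : ℝ → ℝ) (x : ℝ) : ℝ :=
  ∫ y, G y * gaussKernel P (x - y)

theorem abs_kernelConv_le (P : Polynomial ℝ) {G : ℝ → ℝ} {K : ℝ} (hG : ∀ x, |G x| ≤ K) (x : ℝ) :
    |kernelConv P G x| ≤ K * ∫ z, |gaussKernel P z| := by
  have h1 : ∫ z, |gaussKernel P z| = ∫ y, |gaussKernel P (x - y)| :=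
    (integral_sub_left_eq_self (fun z => |gaussKernel P z|) volume x).symm
  rw [h1, ← integral_const_mul, ← Real.norm_eq_abs]
  refine norm_integral_le_of_norm_le ?_ (Filter.Eventually.of_forall fun y => ?_)
  · exact (((integrable_gaussKernel P).comp_sub_left x).abs).const_mul K
  · rw [norm_mul]
    exact mul_le_mul_of_nonneg_right (hG y) (abs_nonneg _)

/-- The derivative falls on the kernel, so `G` may be discontinuous, as distribution functions are.
-/
theorem hasDerivAt_kernelConv (P : Polynomial ℝ) {G : ℝ → ℝ} (hGm : Measurable G) {K : ℝ}
    (hG : ∀ x, |G x| ≤ K) (x : ℝ) :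
    HasDerivAt (kernelConv P G) (kernelConv (P.derivative - Polynomial.X * P) G x) x := by
  have hK : 0 ≤ K := (abs_nonneg _).trans (hG 0)
  obtain ⟨C, hC, h⟩ := exists_abs_gaussKernel_le (P.derivative - Polynomial.X * P)
  have hmeas : ∀ (Q : Polynomial ℝ) (t : ℝ),
      AEStronglyMeasurable (fun y => G y * gaussKernel Q (t - y)) := fun Q t =>
    (hGm.mul ((continuous_gaussKernel Q).measurable.comp (measurable_const.sub measurable_id))).aestronglyMeasurable
  have hb : Integrable (fun y : ℝ => (K * C * 3) * (1 + (x - y) ^ 2)⁻¹) :=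
    ((integrable_inv_one_add_sq).comp_sub_left x).const_mul _
  refine (hasDerivAt_integral_of_dominated_loc_of_deriv_le (s := Metric.ball x 1)
    (F := fun t y => G y * gaussKernel P (t - y))
    (F' := fun t y => G y * gaussKernel (P.derivative - Polynomial.X * P) (t - y))
    (Metric.ball_mem_nhds x one_pos) (Filter.Eventually.of_forall fun t => hmeas P t) ?_
    (hmeas _ x) (bound := fun y => (K * C * 3) * (1 + (x - y) ^ 2)⁻¹)
    (Filter.Eventually.of_forall fun y t ht => ?_) hb
    (Filter.Eventually.of_forall fun y t _ => ?_)).2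
  · refine (((integrable_gaussKernel P).comp_sub_left x).abs.const_mul K).mono' (hmeas P x)
      (Filter.Eventually.of_forall fun y => ?_)
    rw [norm_mul]
    exact mul_le_mul_of_nonneg_right (hG y) (abs_nonneg _)
  · rw [norm_mul]
    have h1 := h (t - y)
    -- The factor `3` comes from `(x - y)² ≤ 2 (t - y)² + 2 (x - t)²` and `|x - t| < 1`.
    have h2 : (1 + (t - y) ^ 2)⁻¹ ≤ 3 * (1 + (x - y) ^ 2)⁻¹ := by
      rw [inv_eq_one_div, inv_eq_one_div, ← mul_div_assoc, div_le_div_iff₀ (by positivity)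
        (by positivity)]
      have : |t - x| < 1 := by simpa [Real.dist_eq] using ht
      have := abs_lt.1 this
      nlinarith [sq_nonneg (t - y - (x - t)), sq_nonneg (2 * (t - y) + (t - x))]
    calc _ ≤ K * (C * (1 + (t - y) ^ 2)⁻¹) := by
          gcongr
          · exact hG y
          · exact h1
      _ ≤ K * (C * (3 * (1 + (x - y) ^ 2)⁻¹)) := by gcongr
      _ = _ := by ring
  · have := (hasDerivAt_gaussKernel P (t - y)).comp t ((hasDerivAt_id t).sub_const y)
    simpa using this.const_mul (G y)

/-- The standard normal distribution on the real line. -/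
noncomputable abbrev stdNormal : Measure ℝ := gaussianReal 0 1

/-- The average of `z ↦ G (x - s z)` under the standard normal distribution. -/
noncomputable def gaussSmooth (s : ℝ) (G : ℝ → ℝ) (x : ℝ) : ℝ :=
  ∫ z, G (x - s * z) ∂stdNormal

/-- Rescaling leaves `x` only in the argument `x / s`, so each derivative costs exactly one factor
`1 / s`. -/
theorem gaussSmooth_eq_kernelConv {s : ℝ} (hs : 0 < s) (G : ℝ → ℝ) (x : ℝ) :
    gaussSmooth s G x = kernelConv 1 (fun y => (√(2 * Real.pi))⁻¹ * G (s * y)) (x / s) := by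
  rw [gaussSmooth, kernelConv, stdNormal, integral_gaussianReal_eq_integral_smul one_ne_zero,
    ← integral_sub_left_eq_self _ volume (x / s)]
  congr 1
  ext z
  have : s * (x / s - z) = x - s * z := by field_simp
  simp [gaussianPDFReal, gaussKernel, this]
  ring_nf

/-- A function with bounds on its first four derivatives, at scale `s`. -/
structure HasSmoothBound (R R₁ R₂ R₃ R₄ : ℝ → ℝ) (L s : ℝ) : Prop where
  deriv₁ : ∀ x, HasDerivAt R (R₁ x) x
  deriv₂ : ∀ x, HasDerivAt R₁ (R₂ x) x
  deriv₃ : ∀ x, HasDerivAt R₂ (R₃ x) x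
  deriv₄ : ∀ x, HasDerivAt R₃ (R₄ x) x
  bound₁ : ∀ x, |R₁ x| ≤ L / s
  bound₂ : ∀ x, |R₂ x| ≤ L / s ^ 2
  bound₃ : ∀ x, |R₃ x| ≤ L / s ^ 3
  bound₄ : ∀ x, |R₄ x| ≤ L / s ^ 4

theorem hasDerivAt_kernelConv_div (P Q : Polynomial ℝ) (hQ : P.derivative - Polynomial.X * P = Q)
    {G : ℝ → ℝ} (hGm : Measurable G) {K : ℝ} (hG : ∀ x, |G x| ≤ K) {s : ℝ} (hs : 0 < s) (j : ℕ)
    (x : ℝ) :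
    HasDerivAt (fun x => kernelConv P G (x / s) / s ^ j) (kernelConv Q G (x / s) / s ^ (j + 1))
      x := by
  subst hQ
  have h1 := (hasDerivAt_kernelConv P hGm hG (x / s)).comp x ((hasDerivAt_id x).div_const s)
  have h2 := h1.div_const (s ^ j)
  refine h2.congr_deriv ?_
  rw [pow_succ]
  field_simp

/-- The constant is universal and the bound is linear in `K`. Applied to a small gap between
distribution functions it yields small derivatives, and the induction arguments rest on this. -/
theorem exists_gaussSmooth_bound : ∃ c : ℝ, 1 ≤ c ∧ ∀ (G : ℝ → ℝ) (K s : ℝ), Measurable G →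
    (∀ x, |G x| ≤ K) → 0 < s →
    ∃ R₁ R₂ R₃ R₄, HasSmoothBound (gaussSmooth s G) R₁ R₂ R₃ R₄ (c * K) s := by
  obtain ⟨P₁, h₁⟩ : ∃ P : Polynomial ℝ,
    Polynomial.derivative 1 - Polynomial.X * 1 = P := ⟨_, rfl⟩
  obtain ⟨P₂, h₂⟩ : ∃ P : Polynomial ℝ,
    Polynomial.derivative P₁ - Polynomial.X * P₁ = P := ⟨_, rfl⟩
  obtain ⟨P₃, h₃⟩ : ∃ P : Polynomial ℝ,
    Polynomial.derivative P₂ - Polynomial.X * P₂ = P := ⟨_, rfl⟩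
  obtain ⟨P₄, h₄⟩ : ∃ P : Polynomial ℝ,
    Polynomial.derivative P₃ - Polynomial.X * P₃ = P := ⟨_, rfl⟩
  obtain ⟨k, hk⟩ : ∃ k : ℝ, k = (√(2 * Real.pi))⁻¹ := ⟨_, rfl⟩
  have hk0 : 0 ≤ k := by rw [hk]; positivity
  obtain ⟨S, hS⟩ : ∃ S : ℝ, S = (∫ z, |gaussKernel P₁ z|) + (∫ z, |gaussKernel P₂ z|) +
    (∫ z, |gaussKernel P₃ z|) + ∫ z, |gaussKernel P₄ z| := ⟨_, rfl⟩
  have hI0 : ∀ P, 0 ≤ ∫ z, |gaussKernel P z| := fun P => integral_nonneg fun z => abs_nonneg _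
  have g1 := hI0 P₁
  have g2 := hI0 P₂
  have g3 := hI0 P₃
  have g4 := hI0 P₄
  have hS0 : 0 ≤ S := by linarith
  refine ⟨1 + k * S, by nlinarith, fun G K s hGm hG hs => ?_⟩
  have hK : 0 ≤ K := (abs_nonneg _).trans (hG 0)
  obtain ⟨G', hG'⟩ : ∃ G' : ℝ → ℝ, G' = fun y => k * G (s * y) := ⟨_, rfl⟩
  have hGm' : Measurable G' := by
    rw [hG']
    exact (hGm.comp (measurable_const.mul measurable_id)).const_mul _
  have hb' : ∀ x, |G' x| ≤ k * K := fun x => by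
    rw [hG', abs_mul, abs_of_nonneg hk0]
    exact mul_le_mul_of_nonneg_left (hG _) hk0
  have hR : gaussSmooth s G = fun x => kernelConv 1 G' (x / s) := by
    funext x
    rw [hG', hk]
    exact gaussSmooth_eq_kernelConv hs G x
  have hbd : ∀ (P : Polynomial ℝ) (j : ℕ) (x : ℝ), ∫ z, |gaussKernel P z| ≤ S →
      |kernelConv P G' (x / s) / s ^ j| ≤ (1 + k * S) * K / s ^ j := fun P j x hP => by
    rw [abs_div, abs_of_pos (pow_pos hs j)]
    gcongr
    refine (abs_kernelConv_le P hb' (x / s)).trans ?_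
    have h3 : k * K * (∫ z, |gaussKernel P z|) ≤ k * K * S := by gcongr
    nlinarith
  refine ⟨fun x => kernelConv P₁ G' (x / s) / s ^ 1, fun x => kernelConv P₂ G' (x / s) / s ^ 2,
    fun x => kernelConv P₃ G' (x / s) / s ^ 3, fun x => kernelConv P₄ G' (x / s) / s ^ 4,
    fun x => ?_, hasDerivAt_kernelConv_div P₁ P₂ h₂ hGm' hb' hs 1,
    hasDerivAt_kernelConv_div P₂ P₃ h₃ hGm' hb' hs 2,
    hasDerivAt_kernelConv_div P₃ P₄ h₄ hGm' hb' hs 3, fun x => ?_,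
    fun x => hbd _ _ _ (by linarith), fun x => hbd _ _ _ (by linarith),
    fun x => hbd _ _ _ (by linarith)⟩
  · rw [hR]
    have := hasDerivAt_kernelConv_div 1 P₁ h₁ hGm' hb' hs 0 x
    simpa using this
  · have := hbd P₁ 1 x (by linarith)
    simpa using this

/-! ### Taylor estimates -/

/-- The mean value inequality on `[-|t|, |t|]`. Applied repeatedly, from the highest derivative
down, it gives Taylor bounds without factorials, whose exact constants are irrelevant here. -/
theorem abs_sub_le_of_deriv_le_pow {f f' : ℝ → ℝ} (hf : ∀ x, HasDerivAt f (f' x) x) {C : ℝ}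
    {n : ℕ} (h : ∀ x, |f' x| ≤ C * |x| ^ n) (t : ℝ) : |f t - f 0| ≤ C * |t| ^ (n + 1) := by
  have hC : 0 ≤ C := by simpa using (abs_nonneg _).trans (h 1)
  have h1 := (convex_Icc (-|t|) |t|).norm_image_sub_le_of_norm_hasDerivWithin_le
    (f := f) (f' := f') (C := C * |t| ^ n) (fun x _ => (hf x).hasDerivWithinAt)
    (fun x hx => (h x).trans (by
      exact mul_le_mul_of_nonneg_left (pow_le_pow_left₀ (abs_nonneg x) (abs_le.2 hx) n) hC)) (x := 0) (y := t) (by simp) ⟨neg_abs_le t, le_abs_self t⟩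
  simp only [Real.norm_eq_abs, sub_zero] at h1
  rw [pow_succ, ← mul_assoc]
  exact h1

namespace HasSmoothBound

variable {R R₁ R₂ R₃ R₄ : ℝ → ℝ} {L s : ℝ}

theorem shift (h : HasSmoothBound R R₁ R₂ R₃ R₄ L s) (x : ℝ) :
    HasSmoothBound (fun t => R (x + t)) (fun t => R₁ (x + t)) (fun t => R₂ (x + t))
      (fun t => R₃ (x + t)) (fun t => R₄ (x + t)) L s :=
  ⟨fun t => (h.deriv₁ (x + t)).comp_const_add x t, fun t => (h.deriv₂ (x + t)).comp_const_add x t,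
    fun t => (h.deriv₃ (x + t)).comp_const_add x t, fun t => (h.deriv₄ (x + t)).comp_const_add x t,
    fun _ => h.bound₁ _, fun _ => h.bound₂ _, fun _ => h.bound₃ _, fun _ => h.bound₄ _⟩

theorem lipschitz (h : HasSmoothBound R R₁ R₂ R₃ R₄ L s) (x t : ℝ) :
    |R (x + t) - R x| ≤ L / s * |t| := by
  have h' := h.shift x
  have := abs_sub_le_of_deriv_le_pow (n := 0) (C := L / s) h'.deriv₁
    (fun y => by simpa using h'.bound₁ y) t
  simpa using this

theorem taylor_one (h : HasSmoothBound R R₁ R₂ R₃ R₄ L s) (x t : ℝ) :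
    |R (x + t) - R x - t * R₁ x| ≤ L / s ^ 2 * |t| ^ 2 := by
  have h' := h.shift x
  have h1 := abs_sub_le_of_deriv_le_pow (n := 0) (C := L / s ^ 2) h'.deriv₂
    (fun y => by simpa using h'.bound₂ y)
  have h0 := abs_sub_le_of_deriv_le_pow (f := fun t => R (x + t) - t * R₁ x)
    (f' := fun t => R₁ (x + t) - R₁ x) (n := 1) (C := L / s ^ 2)
    (fun t => ((h'.deriv₁ t).sub ((hasDerivAt_id t).mul_const (R₁ x))).congr_deriv (by simp))
    (fun t => by simpa using h1 t) t
  convert! h0 using 2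
  simp
  ring

theorem taylor_two (h : HasSmoothBound R R₁ R₂ R₃ R₄ L s) (x t : ℝ) :
    |R (x + t) - R x - t * R₁ x - t ^ 2 / 2 * R₂ x| ≤ L / s ^ 3 * |t| ^ 3 := by
  have h' := h.shift x
  have h2 := abs_sub_le_of_deriv_le_pow (n := 0) (C := L / s ^ 3) h'.deriv₃
    (fun y => by simpa using h'.bound₃ y)
  have h1 := abs_sub_le_of_deriv_le_pow (f := fun t => R₁ (x + t) - t * R₂ x)
    (f' := fun t => R₂ (x + t) - R₂ x) (n := 1) (C := L / s ^ 3)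
    (fun t => ((h'.deriv₂ t).sub ((hasDerivAt_id t).mul_const (R₂ x))).congr_deriv (by simp))
    (fun t => by simpa using h2 t)
  have h0 := abs_sub_le_of_deriv_le_pow (f := fun t => R (x + t) - t * R₁ x - t ^ 2 / 2 * R₂ x)
    (f' := fun t => R₁ (x + t) - R₁ x - t * R₂ x) (n := 2) (C := L / s ^ 3)
    (fun t => by
      have := ((h'.deriv₁ t).sub ((hasDerivAt_id t).mul_const (R₁ x))).sub
        (((hasDerivAt_pow 2 t).div_const 2).mul_const (R₂ x))
      refine this.congr_deriv ?_
      simp)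
    (fun t => by
      refine le_trans (le_of_eq ?_) (h1 t)
      congr 1
      simp
      ring) t
  convert! h0 using 2
  simp
  ring

theorem taylor_three (h : HasSmoothBound R R₁ R₂ R₃ R₄ L s) (x t : ℝ) :
    |R (x + t) - R x - t * R₁ x - t ^ 2 / 2 * R₂ x - t ^ 3 / 6 * R₃ x|
      ≤ L / s ^ 4 * |t| ^ 4 := by
  have h' := h.shift x
  have h3 := abs_sub_le_of_deriv_le_pow (n := 0) (C := L / s ^ 4) h'.deriv₄
    (fun y => by simpa using h'.bound₄ y)
  have h2 := abs_sub_le_of_deriv_le_pow (f := fun t => R₂ (x + t) - t * R₃ x)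
    (f' := fun t => R₃ (x + t) - R₃ x) (n := 1) (C := L / s ^ 4)
    (fun t => ((h'.deriv₃ t).sub ((hasDerivAt_id t).mul_const (R₃ x))).congr_deriv (by simp))
    (fun t => by simpa using h3 t)
  have h1 := abs_sub_le_of_deriv_le_pow (f := fun t => R₁ (x + t) - t * R₂ x - t ^ 2 / 2 * R₃ x)
    (f' := fun t => R₂ (x + t) - R₂ x - t * R₃ x) (n := 2) (C := L / s ^ 4)
    (fun t => by
      have := ((h'.deriv₂ t).sub ((hasDerivAt_id t).mul_const (R₂ x))).sub
        (((hasDerivAt_pow 2 t).div_const 2).mul_const (R₃ x))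
      refine this.congr_deriv ?_
      simp)
    (fun t => by
      refine le_trans (le_of_eq ?_) (h2 t)
      congr 1
      simp
      ring)
  have h0 := abs_sub_le_of_deriv_le_pow
    (f := fun t => R (x + t) - t * R₁ x - t ^ 2 / 2 * R₂ x - t ^ 3 / 6 * R₃ x)
    (f' := fun t => R₁ (x + t) - R₁ x - t * R₂ x - t ^ 2 / 2 * R₃ x) (n := 3) (C := L / s ^ 4)
    (fun t => by
      have := (((h'.deriv₁ t).sub ((hasDerivAt_id t).mul_const (R₁ x))).sub
        (((hasDerivAt_pow 2 t).div_const 2).mul_const (R₂ x))).sub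
        (((hasDerivAt_pow 3 t).div_const 6).mul_const (R₃ x))
      refine this.congr_deriv ?_
      simp only [Nat.cast_ofNat, one_mul, Nat.add_one_sub_one, pow_one]
      ring)
    (fun t => by
      refine le_trans (le_of_eq ?_) (h1 t)
      congr 1
      simp
      ring) t
  convert! h0 using 2
  simp
  ring

theorem const_nonneg (h : HasSmoothBound R R₁ R₂ R₃ R₄ L s) (hs : 0 < s) : 0 ≤ L := by
  have := (abs_nonneg _).trans (h.bound₁ 0)
  rw [le_div_iff₀ hs] at this
  simpa using this

/-- Averaging the third-order expansions at `t` and `-t` cancels the odd terms; this gains the extra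
order that leads to fourth powers of the step. -/
theorem symm_difference (h : HasSmoothBound R R₁ R₂ R₃ R₄ L s) (x t : ℝ) :
    |(R (x - t) + R (x + t)) / 2 - R x - t ^ 2 / 2 * R₂ x| ≤ L / s ^ 4 * |t| ^ 4 := by
  have h1 := h.taylor_three x t
  have h2 := h.taylor_three x (-t)
  rw [abs_neg] at h2
  rw [abs_le] at *
  rw [sub_eq_add_neg x t]
  constructor <;> nlinarith

/-- Interpolation: the third-order remainder is the better one for `|t| ≤ s`, the second-order
remainder for `|t| ≥ s`, and `(|t|/s)^(2 + ρ)` dominates the appropriate power in each range. -/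
theorem taylor_rpow (h : HasSmoothBound R R₁ R₂ R₃ R₄ L s) (hs : 0 < s) {ρ : ℝ} (hρ : 0 < ρ)
    (hρ' : ρ ≤ 1) (x t : ℝ) :
    |R (x + t) - R x - t * R₁ x - t ^ 2 / 2 * R₂ x| ≤ 2 * L / s ^ (2 + ρ) * |t| ^ (2 + ρ) := by
  have hL := h.const_nonneg hs
  rw [div_mul_eq_mul_div (2 * L), mul_div_assoc (2 * L), ← Real.div_rpow (abs_nonneg t) hs.le]
  have hy : 0 ≤ |t| / s := by positivity
  rcases le_total (|t| / s) 1 with h1 | h1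
  · calc _ ≤ L / s ^ 3 * |t| ^ 3 := h.taylor_two x t
      _ = L * (|t| / s) ^ (3 : ℝ) := by
        rw [show (3 : ℝ) = (3 : ℕ) by norm_num, Real.rpow_natCast]
        field_simp
      _ ≤ L * (|t| / s) ^ (2 + ρ) := by
        gcongr L * ?_
        rcases hy.eq_or_lt with h0 | h0
        · rw [← h0, Real.zero_rpow (by norm_num), Real.zero_rpow (by linarith)]
        · exact Real.rpow_le_rpow_of_exponent_ge h0 h1 (by linarith)
      _ ≤ _ := by
        gcongr
        linarith
  · have h2 := h.taylor_one x t
    have h3 : |t ^ 2 / 2 * R₂ x| ≤ L / s ^ 2 * |t| ^ 2 := by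
      rw [abs_mul, abs_div, abs_pow, abs_two]
      have := h.bound₂ x
      nlinarith [mul_le_mul_of_nonneg_left this (sq_nonneg |t|), abs_nonneg (R₂ x), sq_nonneg |t|,
        mul_nonneg (sq_nonneg |t|) (abs_nonneg (R₂ x))]
    calc _ ≤ |R (x + t) - R x - t * R₁ x| + |t ^ 2 / 2 * R₂ x| := abs_sub _ _
      _ ≤ 2 * (L / s ^ 2 * |t| ^ 2) := by linarith
      _ = 2 * L * (|t| / s) ^ (2 : ℝ) := by
        rw [show (2 : ℝ) = (2 : ℕ) by norm_num, Real.rpow_natCast]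
        push_cast
        field_simp
      _ ≤ _ := by
        gcongr
        linarith

/-- Tilting a symmetric step `± a` by `m` and recentering it changes the average of `R` only by
terms of third order and of order `m ^ 2`. -/
theorem tilted_step (h : HasSmoothBound R R₁ R₂ R₃ R₄ L s) (hs : 0 < s) (x : ℝ) {a m : ℝ}
    (ha : 0 ≤ a) (hm : |m| ≤ 1) :
    |(1 + m) / 2 * R (x - a * (1 - m)) + (1 - m) / 2 * R (x + a * (1 + m))
        - (R (x - a) + R (x + a)) / 2| ≤ 8 * L * (|m| * (a / s) ^ 3 + m ^ 2 * (a / s) ^ 2) := by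
  have hL := h.const_nonneg hs
  obtain ⟨hm1, hm2⟩ := abs_le.1 hm
  have e1 := h.taylor_one (x - a) (a * m)
  have e2 := h.taylor_one (x + a) (a * m)
  -- the trapezoidal rule
  have t1 := h.taylor_two x a
  have t2 := h.taylor_two x (-a)
  have h₁ : ∀ t, |R₁ (x + t) - R₁ x - t * R₂ x| ≤ L / s ^ 3 * |t| ^ 2 := fun t => by
    have h' := h.shift x
    have h2 := abs_sub_le_of_deriv_le_pow (n := 0) (C := L / s ^ 3) h'.deriv₃
      (fun y => by simpa using h'.bound₃ y)
    have h1 := abs_sub_le_of_deriv_le_pow (f := fun t => R₁ (x + t) - t * R₂ x)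
      (f' := fun t => R₂ (x + t) - R₂ x) (n := 1) (C := L / s ^ 3)
      (fun t => ((h'.deriv₂ t).sub ((hasDerivAt_id t).mul_const (R₂ x))).congr_deriv (by simp))
      (fun t => by simpa using h2 t) t
    convert! h1 using 2
    simp
    ring
  have d1 := h₁ a
  have d2 := h₁ (-a)
  have l1 : |R₁ (x + a) - R₁ (x - a)| ≤ L / s ^ 2 * (2 * a) := by
    have := abs_sub_le_of_deriv_le_pow (n := 0) (C := L / s ^ 2) (h.shift (x - a)).deriv₂
      (fun y => by simpa using (h.shift (x - a)).bound₂ y) (2 * a)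
    simp only [zero_add, pow_one, add_zero, abs_of_nonneg (show (0 : ℝ) ≤ 2 * a by positivity)]
      at this
    convert! this using 3
    ring_nf
  rw [abs_neg] at t2 d2
  rw [abs_of_nonneg ha] at t1 t2 d1 d2
  rw [← sub_eq_add_neg] at t2 d2
  rw [abs_mul, mul_pow, abs_of_nonneg ha, sq_abs] at e1 e2
  rw [show x - a * (1 - m) = x - a + a * m by ring, show x + a * (1 + m) = x + a + a * m by ring]
  have trap : |R (x + a) - R (x - a) - a * (R₁ (x + a) + R₁ (x - a))|
      ≤ 4 * (L / s ^ 3 * a ^ 3) := by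
    rw [abs_le] at t1 t2 d1 d2 ⊢
    have := mul_le_mul_of_nonneg_left d1.1 ha
    have := mul_le_mul_of_nonneg_left d1.2 ha
    have := mul_le_mul_of_nonneg_left d2.1 ha
    have := mul_le_mul_of_nonneg_left d2.2 ha
    constructor <;> nlinarith
  -- After expanding at `x ± a`, the terms linear in `m` assemble into the error of the trapezoidal
  -- rule for `R₁` on `[x - a, x + a]`, which is of third order in `a`. Everything else carries
  -- `m²`.
  have key : (1 + m) / 2 * R (x - a + a * m) + (1 - m) / 2 * R (x + a + a * m)
        - (R (x - a) + R (x + a)) / 2 =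
      (1 + m) / 2 * (R (x - a + a * m) - R (x - a) - a * m * R₁ (x - a)) +
      (1 - m) / 2 * (R (x + a + a * m) - R (x + a) - a * m * R₁ (x + a)) -
      m / 2 * (R (x + a) - R (x - a) - a * (R₁ (x + a) + R₁ (x - a))) -
      a * m ^ 2 / 2 * (R₁ (x + a) - R₁ (x - a)) := by ring
  rw [key]
  have b1 : |(1 + m) / 2 * (R (x - a + a * m) - R (x - a) - a * m * R₁ (x - a))|
      ≤ 1 * (L / s ^ 2 * (a ^ 2 * m ^ 2)) := by
    rw [abs_mul]
    gcongr
    rw [abs_le]; constructor <;> linarith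
  have b2 : |(1 - m) / 2 * (R (x + a + a * m) - R (x + a) - a * m * R₁ (x + a))|
      ≤ 1 * (L / s ^ 2 * (a ^ 2 * m ^ 2)) := by
    rw [abs_mul]
    gcongr
    rw [abs_le]; constructor <;> linarith
  have b3 : |m / 2 * (R (x + a) - R (x - a) - a * (R₁ (x + a) + R₁ (x - a)))|
      ≤ |m| / 2 * (4 * (L / s ^ 3 * a ^ 3)) := by
    rw [abs_mul, abs_div, abs_two]
    gcongr
  have b4 : |a * m ^ 2 / 2 * (R₁ (x + a) - R₁ (x - a))|
      ≤ a * m ^ 2 / 2 * (L / s ^ 2 * (2 * a)) := by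
    rw [abs_mul, abs_of_nonneg (show 0 ≤ a * m ^ 2 / 2 by positivity)]
    gcongr
  have p1 : 0 ≤ L * (|m| * (a / s) ^ 3) := by positivity
  have p2 : 0 ≤ L * (m ^ 2 * (a / s) ^ 2) := by positivity
  have q1 : L / s ^ 3 * a ^ 3 * |m| = L * (|m| * (a / s) ^ 3) := by field_simp
  have q2 : L / s ^ 2 * (a ^ 2 * m ^ 2) = L * (m ^ 2 * (a / s) ^ 2) := by field_simp
  refine (abs_sub _ _).trans ?_
  refine (add_le_add_left ((abs_sub _ _).trans (add_le_add_left (abs_add_le _ _) _)) _).trans ?_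
  nlinarith

end HasSmoothBound

/-! ### Smoothed distribution functions -/

/-- The distribution function of the standard normal distribution. -/
noncomputable abbrev stdCdf (x : ℝ) : ℝ := cdf stdNormal x

/-- The indicator function of `[0, ∞)`. -/
noncomputable def unitStep (x : ℝ) : ℝ := (Set.Ici (0 : ℝ)).indicator 1 x

theorem measurable_unitStep : Measurable unitStep :=
  measurable_one.indicator measurableSet_Ici

theorem abs_unitStep_le (x : ℝ) : |unitStep x| ≤ 1 := by
  unfold unitStep Set.indicator
  split_ifs <;> simp

theorem measurable_stdCdf : Measurable stdCdf := (monotone_cdf stdNormal).measurable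

theorem measurable_cdf (m : Measure ℝ) : Measurable (fun x => cdf m x) := (monotone_cdf m).measurable

theorem abs_cdf_le (m : Measure ℝ) (x : ℝ) : |cdf m x| ≤ 1 := by
  rw [abs_of_nonneg (cdf_nonneg m x)]
  exact cdf_le_one m x

theorem integral_unitStep_sub (m : Measure ℝ) [IsProbabilityMeasure m] (x : ℝ) :
    ∫ y, unitStep (x - y) ∂m = cdf m x := by
  rw [cdf_eq_real, ← integral_indicator_one measurableSet_Iic]
  congr 1
  ext y
  simp [unitStep, Set.indicator]

theorem gaussSmooth_unitStep {w : ℝ} (hw : 0 < w) (x : ℝ) :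
    gaussSmooth w unitStep x = stdCdf (x / w) := by
  rw [stdCdf, ← integral_unitStep_sub, gaussSmooth]
  congr 1
  ext z
  simp only [unitStep, Set.indicator, Set.mem_Ici, sub_nonneg]
  congr 1
  rw [le_div_iff₀ hw, mul_comm]

/-- The distribution function of `m`, smoothed by an independent normal variable of standard
deviation `s`. -/
noncomputable def smoothCdf (s : ℝ) (m : Measure ℝ) (x : ℝ) : ℝ :=
  ∫ y, stdCdf ((x - y) / s) ∂m

theorem integrable_of_abs_le {α : Type*} [MeasurableSpace α] {m : Measure α} [IsFiniteMeasure m]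
    {f : α → ℝ} (hf : Measurable f) {K : ℝ} (h : ∀ x, |f x| ≤ K) : Integrable f m :=
  Integrable.of_bound hf.aestronglyMeasurable K (Filter.Eventually.of_forall h)

/-- Fubini: both sides are the distribution function of the sum of a variable of law `m` and an
independent normal one, conditioned on either summand. -/
theorem smoothCdf_eq_gaussSmooth {s : ℝ} (hs : 0 < s) (m : Measure ℝ) [IsProbabilityMeasure m]
    (x : ℝ) : smoothCdf s m x = gaussSmooth s (fun u => cdf m u) x := by
  have h1 : ∀ y, stdCdf ((x - y) / s) = ∫ z, unitStep (x - y - s * z) ∂stdNormal := fun y =>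
    (gaussSmooth_unitStep hs (x - y)).symm
  have h2 : ∀ z, cdf m (x - s * z) = ∫ y, unitStep (x - y - s * z) ∂m := fun z => by
    rw [← integral_unitStep_sub]
    congr 1
    ext y
    congr 1
    ring
  simp only [smoothCdf, gaussSmooth, h1, h2]
  refine integral_integral_swap (integrable_of_abs_le (K := 1) ?_ fun p => abs_unitStep_le _)
  exact measurable_unitStep.comp (by fun_prop)

theorem cdf_gaussianReal_zero {w : ℝ} (hw : 0 < w) (v : NNReal) (hv : (v : ℝ) = w ^ 2) (x : ℝ) :
    cdf (gaussianReal 0 v) x = stdCdf (x / w) := by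
  have h : gaussianReal 0 v = stdNormal.map (fun z => w * z) := by
    rw [stdNormal, gaussianReal_map_const_mul]
    congr 1
    · simp
    · ext
      simp [hv]
  rw [← gaussSmooth_unitStep hw, ← integral_unitStep_sub, h, gaussSmooth,
    integral_map (by fun_prop)]
  exact (measurable_unitStep.comp (by fun_prop)).aestronglyMeasurable

/-- Stability of the normal family under convolution, read off on distribution functions. -/
theorem gaussSmooth_stdCdf {s : ℝ} (hs : 0 < s) (a x : ℝ) :
    gaussSmooth a (fun u => stdCdf (u / s)) x = stdCdf (x / √(s ^ 2 + a ^ 2)) := by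
  have hw : 0 < √(s ^ 2 + a ^ 2) := by positivity
  have hv : ∀ b : ℝ, ∃ v : NNReal, (v : ℝ) = b ^ 2 ∧
      stdNormal.map (fun z => b * z) = gaussianReal 0 v := fun b => by
    refine ⟨_, ?_, by rw [stdNormal, gaussianReal_map_const_mul, mul_zero]⟩
    simp
  obtain ⟨v₁, hv₁, h1⟩ := hv s
  obtain ⟨v₂, hv₂, h2⟩ := hv a
  rw [← cdf_gaussianReal_zero hw (v₁ + v₂)
    (by rw [Real.sq_sqrt (by positivity), NNReal.coe_add, hv₁, hv₂]) x]
  have h3 := gaussianReal_conv_gaussianReal (m₁ := 0) (m₂ := 0) (v₁ := v₁) (v₂ := v₂)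
  rw [add_zero] at h3
  have hint : Integrable (fun p : ℝ × ℝ => unitStep (x - (p.1 + p.2)))
      ((gaussianReal 0 v₁).prod (gaussianReal 0 v₂)) :=
    integrable_of_abs_le (K := 1) (measurable_unitStep.comp (by fun_prop)) fun p => abs_unitStep_le _
  rw [← integral_unitStep_sub, ← h3, Measure.conv, integral_map (by fun_prop)
    (f := fun y => unitStep (x - y))
    (measurable_unitStep.comp (measurable_id.const_sub x)).aestronglyMeasurable, integral_prod_symm _ hint,
    ← h1, ← h2, gaussSmooth]
  have hm : Measurable fun y => ∫ z, unitStep (x - (z + y)) ∂(stdNormal.map (fun z => s * z)) :=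
    (StronglyMeasurable.integral_prod_left (f := fun z y : ℝ => unitStep (x - (z + y)))
      (measurable_unitStep.comp (g := unitStep) (f := fun p : ℝ × ℝ => x - (p.1 + p.2))
        (by fun_prop)).stronglyMeasurable).measurable
  rw [integral_map (by fun_prop) hm.aestronglyMeasurable]
  congr 1
  ext z
  rw [integral_map (by fun_prop) (f := fun y => unitStep (x - (y + a * z)))
    (measurable_unitStep.comp (g := unitStep) (f := fun y => x - (y + a * z))
      (by fun_prop)).aestronglyMeasurable, ← gaussSmooth_unitStep hs, gaussSmooth]
  congr 1
  ext y
  congr 1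
  ring

/-- Adding a normal step of deviation `a` is the same as raising the smoothing variance by `a²`.
This identity makes the replacement argument telescope. -/
theorem gaussSmooth_smoothCdf {s : ℝ} (hs : 0 < s) (a : ℝ) (m : Measure ℝ)
    [IsProbabilityMeasure m] (x : ℝ) :
    gaussSmooth a (smoothCdf s m) x = smoothCdf (√(s ^ 2 + a ^ 2)) m x := by
  simp only [gaussSmooth, smoothCdf]
  rw [integral_integral_swap]
  · congr 1
    ext y
    rw [← gaussSmooth_stdCdf hs a (x - y), gaussSmooth]
    congr 1
    ext z
    ring_nf
  · refine integrable_of_abs_le (K := 1) ?_ fun p => abs_cdf_le _ _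
    exact measurable_stdCdf.comp (by fun_prop)

theorem gaussSmooth_add (s : ℝ) {G G' : ℝ → ℝ} (hG : Measurable G) (hG' : Measurable G')
    {K K' : ℝ} (h : ∀ x, |G x| ≤ K) (h' : ∀ x, |G' x| ≤ K') (x : ℝ) :
    gaussSmooth s (fun u => G u + G' u) x = gaussSmooth s G x + gaussSmooth s G' x :=
  integral_add (integrable_of_abs_le (hG.comp (by fun_prop)) fun _ => h _)
    (integrable_of_abs_le (hG'.comp (by fun_prop)) fun _ => h' _)

theorem abs_gaussSmooth_le (s : ℝ) {G : ℝ → ℝ} {K : ℝ} (h : ∀ x, |G x| ≤ K) (x : ℝ) :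
    |gaussSmooth s G x| ≤ K := by
  have := norm_integral_le_of_norm_le_const (μ := stdNormal) (f := fun z => G (x - s * z))
    (Filter.Eventually.of_forall fun z => h (x - s * z))
  simpa [gaussSmooth] using this

theorem measurable_gaussSmooth {s : ℝ} (hs : 0 < s) {G : ℝ → ℝ} (hG : Measurable G) {K : ℝ}
    (h : ∀ x, |G x| ≤ K) : Measurable (gaussSmooth s G) := by
  obtain ⟨c, -, hc⟩ := exists_gaussSmooth_bound
  obtain ⟨R₁, R₂, R₃, R₄, hR⟩ := hc G K s hG h hs
  exact (continuous_iff_continuousAt.2 fun x => (hR.deriv₁ x).continuousAt).measurable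

/-- The deviation of the distribution function of `m` from the normal distribution with standard
deviation `w`. -/
noncomputable def cdfGap (m : Measure ℝ) (w u : ℝ) : ℝ := cdf m u - stdCdf (u / w)

theorem measurable_cdfGap (m : Measure ℝ) (w : ℝ) : Measurable (cdfGap m w) :=
  (measurable_cdf m).sub (measurable_stdCdf.comp (by fun_prop))

theorem abs_cdfGap_le_one (m : Measure ℝ) (w u : ℝ) : |cdfGap m w u| ≤ 1 := by
  have h1 := cdf_nonneg m u
  have h2 := cdf_le_one m u
  have h3 := cdf_nonneg stdNormal (u / w)
  have h4 := cdf_le_one stdNormal (u / w)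
  unfold cdfGap stdCdf
  rw [abs_le]
  constructor <;> linarith

/-- The splitting behind every improved one-step bound: the normal part is smooth at the larger
scale `√(s² + w²)`, while the other part is smooth only at scale `s` but inherits the size of the
gap. -/
theorem smoothCdf_eq_add_cdfGap {s : ℝ} (hs : 0 < s) {w : ℝ} (hw : 0 < w) (m : Measure ℝ)
    [IsProbabilityMeasure m] (x : ℝ) :
    smoothCdf s m x = stdCdf (x / √(s ^ 2 + w ^ 2)) + gaussSmooth s (cdfGap m w) x := by
  rw [smoothCdf_eq_gaussSmooth hs, add_comm (s ^ 2), ← gaussSmooth_stdCdf hw s,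
    ← gaussSmooth_add s (G := fun u => stdCdf (u / w))
      (measurable_stdCdf.comp (measurable_id.div_const w)) (measurable_cdfGap m w)
      (fun x => abs_cdf_le _ _) (abs_cdfGap_le_one m w)]
  congr 1
  ext u
  simp [cdfGap]

/-- `Φ` is itself the unit-scale smoothing of the unit step, so its Lipschitz constant is an
instance of the general derivative bounds. -/
theorem exists_stdCdf_lipschitz : ∃ c : ℝ, 1 ≤ c ∧ ∀ x t : ℝ, 0 ≤ t →
    stdCdf (x + t) ≤ stdCdf x + c * t := by
  obtain ⟨c, hc1, hc⟩ := exists_gaussSmooth_bound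
  obtain ⟨R₁, R₂, R₃, R₄, hR⟩ := hc unitStep 1 1 measurable_unitStep abs_unitStep_le one_pos
  refine ⟨c, hc1, fun x t ht => ?_⟩
  have h := (le_abs_self _).trans (hR.lipschitz x t)
  simp only [gaussSmooth_unitStep one_pos, div_one, mul_one, abs_of_nonneg ht] at h
  linarith

theorem integrable_sq_stdNormal : Integrable (fun z : ℝ => z ^ 2) stdNormal := by
  have := (memLp_id_gaussianReal' (μ := 0) (v := 1) 2 (by simp)).integrable_sq
  simpa using this

theorem integral_sq_stdNormal : ∫ z, z ^ 2 ∂stdNormal = 1 := by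
  have h := variance_fun_id_gaussianReal (μ := 0) (v := 1)
  rw [variance_of_integral_eq_zero (by fun_prop) (by simp)] at h
  simpa using h

/-- Smoothing does not hide the deviation of a distribution function from a Lipschitz one. -/
theorem exists_cdfGap_le_of_gaussSmooth_le : ∃ c : ℝ, 1 ≤ c ∧ ∀ (m : Measure ℝ) (w κ δ : ℝ),
    0 < w → 0 < κ → (∀ x, |gaussSmooth κ (cdfGap m w) x| ≤ δ) →
    ∀ u, |cdfGap m w u| ≤ c * (δ + κ / w) := by
  obtain ⟨c, hc1, hc⟩ := exists_stdCdf_lipschitz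
  refine ⟨8 * c, by linarith, fun m w κ δ hw hκ h => ?_⟩
  set D := cdfGap m w with hD
  -- A distribution function increases and the normal one is Lipschitz, so `D` cannot fall quickly
  -- to the right.
  have hmono : ∀ u t, 0 ≤ t → D u - c * t / w ≤ D (u + t) := fun u t ht => by
    have h1 := monotone_cdf m (show u ≤ u + t by linarith)
    have h2 := hc (u / w) (t / w) (by positivity)
    rw [← add_div, ← mul_div_assoc] at h2
    simp only [hD, cdfGap]
    linarith
  have hbdd : BddAbove (Set.range fun u => |D u|) :=
    ⟨1, by rintro _ ⟨u, rfl⟩; exact abs_cdfGap_le_one m w u⟩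
  set K := ⨆ u, |D u| with hK
  have hDK : ∀ u, |D u| ≤ K := le_ciSup hbdd
  have hK0 : 0 ≤ K := (abs_nonneg _).trans (hDK 0)
  have hDm : Measurable D := measurable_cdfGap m w
  have hint : ∀ x, Integrable (fun z => D (x - κ * z)) stdNormal := fun x =>
    integrable_of_abs_le (hDm.comp (by fun_prop)) fun z => hDK _
  have hq : ∀ b : ℝ, Integrable (fun z : ℝ => b - K / 2 * z ^ 2) stdNormal := fun b =>
    (integrable_const b).sub (integrable_sq_stdNormal.const_mul _)
  have hqi : ∀ b : ℝ, ∫ z, (b - K / 2 * z ^ 2) ∂stdNormal = b - K / 2 := fun b => by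
    rw [integral_sub (integrable_const b) (integrable_sq_stdNormal.const_mul _),
      integral_const_mul, integral_sq_stdNormal]
    simp
  -- The smoothed gap is evaluated at `u ± 2κ`, so that for `|z| ≤ 2` the sampled points lie on the
  -- favourable side of `u`, within `4κ`. For `|z| > 2` the trivial loss `2K` is at most `K z² / 2`.
  -- Since `E z² = 1`, only `K / 2` is lost in all, and it can be absorbed.
  have main : ∀ u, |D u| ≤ δ + 4 * c * κ / w + K / 2 := fun u => by
    have hcw : 0 ≤ c * κ / w := by positivity
    have e4 : 4 * c * κ / w = 4 * (c * κ / w) := by ring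
    rcases le_total 0 (D u) with h0 | h0
    · rw [abs_of_nonneg h0]
      have h1 := (le_abs_self _).trans (h (u + 2 * κ))
      have h2 : D u - 4 * c * κ / w - K / 2 ≤ gaussSmooth κ D (u + 2 * κ) := by
        rw [← hqi, gaussSmooth]
        refine integral_mono (hq _) (hint _) fun z => ?_
        simp only
        rcases le_or_gt |z| 2 with hz | hz
        · obtain ⟨hz1, hz2⟩ := abs_le.1 hz
          have h3 := hmono u (κ * (2 - z)) (mul_nonneg hκ.le (by linarith))
          rw [show u + κ * (2 - z) = u + 2 * κ - κ * z by ring] at h3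
          have h4 : c * (κ * (2 - z)) / w ≤ 4 * c * κ / w := by
            refine div_le_div_of_nonneg_right ?_ hw.le
            nlinarith [mul_pos (show 0 < c by linarith) hκ]
          have : 0 ≤ K / 2 * z ^ 2 := by positivity
          linarith
        · have h3 := (abs_le.1 (hDK (u + 2 * κ - κ * z))).1
          have h4 := (abs_le.1 (hDK u)).2
          have : 4 ≤ z ^ 2 := by nlinarith [sq_abs z]
          nlinarith
      linarith
    · rw [abs_of_nonpos h0]
      have h1 := (neg_abs_le _).trans' (neg_le_neg (h (u - 2 * κ)))
      have h2 : gaussSmooth κ D (u - 2 * κ) ≤ -(-D u - 4 * c * κ / w - K / 2) := by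
        rw [← hqi, gaussSmooth, ← integral_neg]
        refine integral_mono (hint _) (hq _).neg fun z => ?_
        simp only
        rcases le_or_gt |z| 2 with hz | hz
        · obtain ⟨hz1, hz2⟩ := abs_le.1 hz
          have h3 := hmono (u - 2 * κ - κ * z) (κ * (2 + z)) (mul_nonneg hκ.le (by linarith))
          rw [show u - 2 * κ - κ * z + κ * (2 + z) = u by ring] at h3
          have h4 : c * (κ * (2 + z)) / w ≤ 4 * c * κ / w := by
            refine div_le_div_of_nonneg_right ?_ hw.le
            nlinarith [mul_pos (show 0 < c by linarith) hκ]
          have : 0 ≤ K / 2 * z ^ 2 := by positivity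
          linarith
        · have h3 := (abs_le.1 (hDK (u - 2 * κ - κ * z))).2
          have h4 := (abs_le.1 (hDK u)).1
          have : 4 ≤ z ^ 2 := by nlinarith [sq_abs z]
          nlinarith
      linarith
  have hKle : K ≤ δ + 4 * c * κ / w + K / 2 := ciSup_le main
  intro u
  have h5 : 0 ≤ δ := (abs_nonneg _).trans (h 0)
  calc |D u| ≤ K := hDK u
    _ ≤ 2 * δ + 8 * c * κ / w := by
      have : 8 * c * κ / w = 2 * (4 * c * κ / w) := by ring
      linarith
    _ ≤ 8 * c * (δ + κ / w) := by
      rw [mul_add, mul_div_assoc]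
      nlinarith

/-! ### One-step comparisons with the normal distribution -/

theorem HasSmoothBound.measurable {R R₁ R₂ R₃ R₄ : ℝ → ℝ} {L s : ℝ}
    (h : HasSmoothBound R R₁ R₂ R₃ R₄ L s) : Measurable R :=
  (continuous_iff_continuousAt.2 fun x => (h.deriv₁ x).continuousAt).measurable

theorem integral_sub_quadratic {Ω : Type*} [MeasurableSpace Ω] {μ : Measure Ω}
    [IsProbabilityMeasure μ] {ξ : Ω → ℝ} (hξ : Measurable ξ) (h2 : Integrable (fun ω => ξ ω ^ 2) μ)
    (h1 : ∫ ω, ξ ω ∂μ = 0) {R : ℝ → ℝ} (hR : Measurable R) {K : ℝ} (hK : ∀ x, |R x| ≤ K)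
    (u a b c : ℝ) :
    Integrable (fun ω => R (u - ξ ω) - a - (-ξ ω) * b - (-ξ ω) ^ 2 / 2 * c) μ ∧
    ∫ ω, (R (u - ξ ω) - a - (-ξ ω) * b - (-ξ ω) ^ 2 / 2 * c) ∂μ =
      (∫ ω, R (u - ξ ω) ∂μ) - a - (∫ ω, ξ ω ^ 2 ∂μ) / 2 * c := by
  have i1 : Integrable (fun ω => R (u - ξ ω)) μ :=
    integrable_of_abs_le (hR.comp (by fun_prop)) fun ω => hK _
  have i2 : Integrable ξ μ :=
    ((memLp_two_iff_integrable_sq hξ.aestronglyMeasurable).2 h2).integrable (by norm_num)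
  have i3 : Integrable (fun ω => (-ξ ω) * b) μ := i2.neg.mul_const b
  have i4 : Integrable (fun ω => (-ξ ω) ^ 2 / 2 * c) μ := by
    simpa using (h2.div_const 2).mul_const c
  have i5 : Integrable (fun ω => R (u - ξ ω) - a) μ := i1.sub (integrable_const a)
  have i6 : Integrable (fun ω => R (u - ξ ω) - a - (-ξ ω) * b) μ := i5.sub i3
  refine ⟨i6.sub i4, ?_⟩
  rw [integral_sub i6 i4, integral_sub i5 i3, integral_sub i1 (integrable_const a)]
  simp only [integral_const, probReal_univ, one_smul, neg_mul, even_two, Even.neg_pow]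
  rw [integral_neg, integral_mul_const, integral_mul_const, integral_div, h1]
  ring

theorem integral_taylor_rpow {Ω : Type*} [MeasurableSpace Ω] {μ : Measure Ω}
    [IsProbabilityMeasure μ] {ξ : Ω → ℝ} (hξ : Measurable ξ) (h2 : Integrable (fun ω => ξ ω ^ 2) μ)
    (h1 : ∫ ω, ξ ω ∂μ = 0) {ρ : ℝ} (hρ : 0 < ρ) (hρ' : ρ ≤ 1)
    (hi : Integrable (fun ω => |ξ ω| ^ (2 + ρ)) μ)
    {R R₁ R₂ R₃ R₄ : ℝ → ℝ} {L s : ℝ} (h : HasSmoothBound R R₁ R₂ R₃ R₄ L s) (hs : 0 < s)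
    {K : ℝ} (hK : ∀ x, |R x| ≤ K) (u : ℝ) :
    |(∫ ω, R (u - ξ ω) ∂μ) - R u - (∫ ω, ξ ω ^ 2 ∂μ) / 2 * R₂ u|
      ≤ 2 * L / s ^ (2 + ρ) * ∫ ω, |ξ ω| ^ (2 + ρ) ∂μ := by
  rw [← (integral_sub_quadratic hξ h2 h1 h.measurable hK u (R u) (R₁ u) (R₂ u)).2,
    ← integral_const_mul, ← Real.norm_eq_abs]
  refine norm_integral_le_of_norm_le (hi.const_mul _) (Filter.Eventually.of_forall fun ω => ?_)
  have := h.taylor_rpow hs hρ hρ' u (-ξ ω)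
  rwa [abs_neg, ← sub_eq_add_neg] at this

theorem integral_taylor_one {Ω : Type*} [MeasurableSpace Ω] {μ : Measure Ω}
    [IsProbabilityMeasure μ] {ξ : Ω → ℝ} (hξ : Measurable ξ) (h2 : Integrable (fun ω => ξ ω ^ 2) μ)
    (h1 : ∫ ω, ξ ω ∂μ = 0) {R R₁ R₂ R₃ R₄ : ℝ → ℝ} {L s : ℝ}
    (h : HasSmoothBound R R₁ R₂ R₃ R₄ L s) {K : ℝ} (hK : ∀ x, |R x| ≤ K) (u : ℝ) :
    |(∫ ω, R (u - ξ ω) ∂μ) - R u| ≤ L / s ^ 2 * ∫ ω, ξ ω ^ 2 ∂μ := by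
  have h3 := integral_sub_quadratic hξ h2 h1 h.measurable hK u (R u) (R₁ u) 0
  rw [mul_zero, sub_zero] at h3
  rw [← h3.2, ← integral_const_mul, ← Real.norm_eq_abs]
  refine norm_integral_le_of_norm_le (h2.const_mul _) (Filter.Eventually.of_forall fun ω => ?_)
  have := h.taylor_one u (-ξ ω)
  rw [abs_neg, ← sub_eq_add_neg, sq_abs] at this
  simpa using this

theorem integrable_abs_rpow_stdNormal (a : ℝ) {r : ℝ} (hr : 0 < r) :
    Integrable (fun z : ℝ => |a * z| ^ r) stdNormal := by
  have h := (memLp_id_gaussianReal' (μ := 0) (v := 1) (ENNReal.ofReal r) (by simp)).integrable_norm_rpow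
    (by simpa using hr) (by simp)
  rw [ENNReal.toReal_ofReal hr.le] at h
  have h2 := h.const_mul (|a| ^ r)
  refine h2.congr (Filter.Eventually.of_forall fun z => ?_)
  simp only [abs_mul, id, Real.norm_eq_abs]
  rw [Real.mul_rpow (abs_nonneg _) (abs_nonneg _)]

theorem integrable_sq_const_mul_stdNormal (a : ℝ) :
    Integrable (fun z : ℝ => (a * z) ^ 2) stdNormal := by
  simpa [mul_pow] using integrable_sq_stdNormal.const_mul (a ^ 2)

theorem integral_sq_const_mul_stdNormal (a : ℝ) : ∫ z, (a * z) ^ 2 ∂stdNormal = a ^ 2 := by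
  simp only [mul_pow]
  rw [integral_const_mul, integral_sq_stdNormal, mul_one]

theorem integral_const_mul_stdNormal (a : ℝ) : ∫ z, a * z ∂stdNormal = 0 := by
  rw [integral_const_mul, integral_id_gaussianReal, mul_zero]

/-- Replacing a centered variable by a normal one with the same variance in a smoothed function. -/
theorem exists_rpow_step_bound {ρ : ℝ} (hρ : 0 < ρ) (hρ' : ρ ≤ 1) : ∃ c : ℝ, 1 ≤ c ∧
    ∀ {Ω : Type*} [MeasurableSpace Ω] (μ : Measure Ω) [IsProbabilityMeasure μ] (ξ : Ω → ℝ)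
      (G : ℝ → ℝ) (K s a u : ℝ), Measurable ξ → Integrable (fun ω => ξ ω ^ 2) μ →
      ∫ ω, ξ ω ∂μ = 0 → ∫ ω, ξ ω ^ 2 ∂μ = a ^ 2 → Integrable (fun ω => |ξ ω| ^ (2 + ρ)) μ →
      Measurable G → (∀ x, |G x| ≤ K) → 0 < s → 0 ≤ a →
      |(∫ ω, gaussSmooth s G (u - ξ ω) ∂μ) - gaussSmooth a (gaussSmooth s G) u|
        ≤ c * K * ((∫ ω, |ξ ω| ^ (2 + ρ) ∂μ) + a ^ (2 + ρ)) / s ^ (2 + ρ) := by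
  obtain ⟨c, hc1, hc⟩ := exists_gaussSmooth_bound
  set g := ∫ z : ℝ, |z| ^ (2 + ρ) ∂stdNormal with hg
  have hg0 : 0 ≤ g := integral_nonneg fun z => by positivity
  refine ⟨2 * c * (1 + g), by nlinarith, fun {Ω} _ μ _ ξ G K s a u hξ h2 h1 hv hi hG hK hs ha => ?_⟩
  have hK0 : 0 ≤ K := (abs_nonneg _).trans (hK 0)
  obtain ⟨R₁, R₂, R₃, R₄, hR⟩ := hc G K s hG hK hs
  have e1 := integral_taylor_rpow hξ h2 h1 hρ hρ' hi hR hs (abs_gaussSmooth_le s hK) u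
  have e2 := integral_taylor_rpow (μ := stdNormal) (ξ := fun z => a * z) (by fun_prop)
    (integrable_sq_const_mul_stdNormal a) (integral_const_mul_stdNormal a) hρ hρ'
    (integrable_abs_rpow_stdNormal a (by linarith)) hR hs (abs_gaussSmooth_le s hK) u
  rw [integral_sq_const_mul_stdNormal] at e2
  rw [hv] at e1
  have e3 : ∫ z, |a * z| ^ (2 + ρ) ∂stdNormal = a ^ (2 + ρ) * g := by
    rw [hg, ← integral_const_mul]
    congr 1
    ext z
    rw [abs_mul, Real.mul_rpow (abs_nonneg _) (abs_nonneg _), abs_of_nonneg ha]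
  rw [e3] at e2
  change |gaussSmooth a (gaussSmooth s G) u - _ - _| ≤ _ at e2
  set X := ∫ ω, |ξ ω| ^ (2 + ρ) ∂μ
  have hX : 0 ≤ X := integral_nonneg fun z => by positivity
  have hsp : 0 < s ^ (2 + ρ) := by positivity
  have hap : 0 ≤ a ^ (2 + ρ) := by positivity
  have e4 : 2 * (c * K) / s ^ (2 + ρ) * X + 2 * (c * K) / s ^ (2 + ρ) * (a ^ (2 + ρ) * g)
      ≤ 2 * c * (1 + g) * K * (X + a ^ (2 + ρ)) / s ^ (2 + ρ) := by
    rw [← mul_add, div_mul_eq_mul_div]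
    refine div_le_div_of_nonneg_right ?_ hsp.le
    have : X + a ^ (2 + ρ) * g ≤ (1 + g) * (X + a ^ (2 + ρ)) := by
      have := mul_nonneg hg0 hX
      nlinarith
    calc _ ≤ 2 * (c * K) * ((1 + g) * (X + a ^ (2 + ρ))) := by gcongr
      _ = _ := by ring
  refine le_trans ?_ e4
  rw [abs_le] at *
  constructor <;> linarith

/-- No matching of variances is required, at the price of a second-order error. It serves for the
first step of the walk, which is asymmetric in general and occurs only once. -/
theorem exists_sq_step_bound : ∃ c : ℝ, 1 ≤ c ∧
    ∀ {Ω : Type*} [MeasurableSpace Ω] (μ : Measure Ω) [IsProbabilityMeasure μ] (ξ : Ω → ℝ)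
      (s a u : ℝ), Measurable ξ → Integrable (fun ω => ξ ω ^ 2) μ → ∫ ω, ξ ω ∂μ = 0 → 0 < s →
      |(∫ ω, stdCdf ((u - ξ ω) / s) ∂μ) - stdCdf (u / √(s ^ 2 + a ^ 2))|
        ≤ c * ((∫ ω, ξ ω ^ 2 ∂μ) + a ^ 2) / s ^ 2 := by
  obtain ⟨c, hc1, hc⟩ := exists_gaussSmooth_bound
  refine ⟨c, hc1, fun {Ω} _ μ _ ξ s a u hξ h2 h1 hs => ?_⟩
  obtain ⟨R₁, R₂, R₃, R₄, hR⟩ := hc unitStep 1 s measurable_unitStep abs_unitStep_le hs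
  rw [mul_one] at hR
  have e1 := integral_taylor_one hξ h2 h1 hR (abs_gaussSmooth_le s abs_unitStep_le) u
  have e2 := integral_taylor_one (μ := stdNormal) (ξ := fun z => a * z) (by fun_prop)
    (integrable_sq_const_mul_stdNormal a) (integral_const_mul_stdNormal a) hR
    (abs_gaussSmooth_le s abs_unitStep_le) u
  rw [integral_sq_const_mul_stdNormal] at e2
  change |gaussSmooth a (gaussSmooth s unitStep) u - _| ≤ _ at e2
  have e3 : gaussSmooth s unitStep = fun u => stdCdf (u / s) := funext (gaussSmooth_unitStep hs)
  rw [e3, gaussSmooth_stdCdf hs] at e2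
  rw [e3] at e1
  have e4 : c * ((∫ ω, ξ ω ^ 2 ∂μ) + a ^ 2) / s ^ 2 =
    c / s ^ 2 * (∫ ω, ξ ω ^ 2 ∂μ) + c / s ^ 2 * a ^ 2 := by ring
  rw [e4]
  rw [abs_le] at *
  constructor <;> linarith

/-- Symmetrizing the normal variable lets the even Taylor estimate be applied pointwise under the
integral. -/
theorem gaussSmooth_eq_symm (a : ℝ) {R : ℝ → ℝ} (hR : Measurable R) {K : ℝ}
    (hK : ∀ x, |R x| ≤ K) (u : ℝ) :
    gaussSmooth a R u = ∫ z, (R (u - a * z) + R (u + a * z)) / 2 ∂stdNormal := by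
  have h1 : ∫ z, R (u + a * z) ∂stdNormal = ∫ z, R (u - a * z) ∂stdNormal := by
    have h : stdNormal.map (fun z => -z) = stdNormal := by
      rw [stdNormal, gaussianReal_map_neg, neg_zero]
    conv_rhs => rw [← h]
    rw [integral_map (by fun_prop) (f := fun z => R (u - a * z))
      (hR.comp (f := fun z => u - a * z) (by fun_prop)).aestronglyMeasurable]
    simp
  have i1 : Integrable (fun z => R (u - a * z)) stdNormal :=
    integrable_of_abs_le (hR.comp (by fun_prop)) fun _ => hK _
  have i2 : Integrable (fun z => R (u + a * z)) stdNormal :=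
    integrable_of_abs_le (hR.comp (by fun_prop)) fun _ => hK _
  rw [integral_div, integral_add i1 i2, h1, gaussSmooth]
  ring

theorem integrable_pow_four_stdNormal : Integrable (fun z : ℝ => z ^ 4) stdNormal := by
  have h := (memLp_id_gaussianReal' (μ := 0) (v := 1) (4 : ℕ) (by simp)).integrable_norm_pow
    (by norm_num)
  refine h.congr (Filter.Eventually.of_forall fun z => ?_)
  simp only [id, Real.norm_eq_abs]
  exact Even.pow_abs (by decide) z

/-- Replacing a symmetric two-valued step by a normal one in a smoothed function. -/
theorem exists_symm_step_bound : ∃ c : ℝ, 1 ≤ c ∧ ∀ (G : ℝ → ℝ) (K s a u : ℝ), Measurable G →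
    (∀ x, |G x| ≤ K) → 0 < s → 0 ≤ a →
    |(gaussSmooth s G (u - a) + gaussSmooth s G (u + a)) / 2 - gaussSmooth a (gaussSmooth s G) u|
      ≤ c * K * (a / s) ^ 4 := by
  obtain ⟨c, hc1, hc⟩ := exists_gaussSmooth_bound
  set g := ∫ z : ℝ, z ^ 4 ∂stdNormal with hg
  have hg0 : 0 ≤ g := integral_nonneg fun z => by positivity
  refine ⟨c * (1 + g), by nlinarith, fun G K s a u hG hK hs ha => ?_⟩
  obtain ⟨R₁, R₂, R₃, R₄, hR⟩ := hc G K s hG hK hs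
  set R := gaussSmooth s G with hRd
  have hRK : ∀ x, |R x| ≤ K := abs_gaussSmooth_le s hK
  have e1 := hR.symm_difference u a
  have e2 : |gaussSmooth a R u - R u - a ^ 2 / 2 * R₂ u| ≤ c * K / s ^ 4 * (a ^ 4 * g) := by
    rw [gaussSmooth_eq_symm a hR.measurable hRK]
    have i1 : Integrable (fun z => (R (u - a * z) + R (u + a * z)) / 2) stdNormal :=
      ((integrable_of_abs_le (hR.measurable.comp (by fun_prop)) fun _ => hRK _).add
      (integrable_of_abs_le (hR.measurable.comp (by fun_prop)) fun _ => hRK _)).div_const 2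
    have i2 : Integrable (fun z => (a * z) ^ 2 / 2 * R₂ u) stdNormal :=
      ((integrable_sq_const_mul_stdNormal a).div_const 2).mul_const _
    have e : ∫ z, ((R (u - a * z) + R (u + a * z)) / 2 - R u - (a * z) ^ 2 / 2 * R₂ u) ∂stdNormal
        = (∫ z, (R (u - a * z) + R (u + a * z)) / 2 ∂stdNormal) - R u - a ^ 2 / 2 * R₂ u := by
      have i3 : Integrable (fun z => (R (u - a * z) + R (u + a * z)) / 2 - R u) stdNormal :=
        i1.sub (integrable_const _)
      rw [integral_sub i3 i2, integral_sub i1 (integrable_const _), integral_mul_const,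
        integral_div 2 (fun z => (a * z) ^ 2), integral_sq_const_mul_stdNormal]
      simp
    rw [← e, hg, ← integral_const_mul, ← integral_const_mul, ← Real.norm_eq_abs]
    refine norm_integral_le_of_norm_le ((integrable_pow_four_stdNormal.const_mul _).const_mul _)
      (Filter.Eventually.of_forall fun z => ?_)
    refine (hR.symm_difference u (a * z)).trans (le_of_eq ?_)
    rw [abs_mul, mul_pow, Even.pow_abs (by decide), Even.pow_abs (by decide)]
  rw [abs_of_nonneg ha] at e1
  have e4 : c * (1 + g) * K * (a / s) ^ 4 = c * K / s ^ 4 * a ^ 4 + c * K / s ^ 4 * (a ^ 4 * g) := by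
    field_simp
  rw [e4]
  rw [abs_le] at *
  constructor <;> linarith

/-! ### A Berry-Esseen bound for independent summands -/

theorem smoothCdf_map {Ω : Type*} [MeasurableSpace Ω] {μ : Measure Ω} {W : Ω → ℝ}
    (hW : Measurable W) (s u : ℝ) :
    smoothCdf s (μ.map W) u = ∫ ω, stdCdf ((u - W ω) / s) ∂μ := by
  rw [smoothCdf, integral_map hW.aemeasurable]
  exact (measurable_stdCdf.comp (f := fun y => (u - y) / s) (by fun_prop)).aestronglyMeasurable

theorem smoothCdf_map_add {Ω : Type*} [MeasurableSpace Ω] {μ : Measure Ω}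
    [IsProbabilityMeasure μ] {W ξ : Ω → ℝ} (hW : Measurable W) (hξ : Measurable ξ)
    (h : IndepFun W ξ μ) (s u : ℝ) :
    smoothCdf s (μ.map fun ω => W ω + ξ ω) u = ∫ ω, smoothCdf s (μ.map W) (u - ξ ω) ∂μ := by
  have hm : Measurable fun p : ℝ × ℝ => stdCdf ((u - (p.1 + p.2)) / s) :=
    measurable_stdCdf.comp (by fun_prop)
  have : IsProbabilityMeasure (μ.map W) := Measure.isProbabilityMeasure_map hW.aemeasurable
  have : IsProbabilityMeasure (μ.map ξ) := Measure.isProbabilityMeasure_map hξ.aemeasurable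
  have hm' : Measurable fun y => smoothCdf s (μ.map W) (u - y) := by
    have := (StronglyMeasurable.integral_prod_left (μ := μ.map W)
      (f := fun x y : ℝ => stdCdf ((u - y - x) / s))
      (measurable_stdCdf.comp (g := stdCdf) (f := fun p : ℝ × ℝ => (u - p.2 - p.1) / s)
        (by fun_prop)).stronglyMeasurable).measurable
    exact this
  rw [smoothCdf_map (W := fun ω => W ω + ξ ω) (hW.add hξ)]
  have e1 : ∫ ω, stdCdf ((u - (W ω + ξ ω)) / s) ∂μ =
      ∫ p, stdCdf ((u - (p.1 + p.2)) / s) ∂(μ.map fun ω => (W ω, ξ ω)) := by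
    rw [integral_map (hW.prodMk hξ).aemeasurable hm.aestronglyMeasurable]
  rw [e1, (indepFun_iff_map_prod_eq_prod_map_map hW.aemeasurable hξ.aemeasurable).1 h,
    integral_prod_symm _ (integrable_of_abs_le hm fun p => abs_cdf_le _ _),
    ← integral_map (f := fun y => smoothCdf s (μ.map W) (u - y)) hξ.aemeasurable
      hm'.aestronglyMeasurable]
  congr 1
  ext y
  rw [smoothCdf]
  congr 1
  ext x
  ring_nf

/-- The first bound uses only that distribution functions are at most `1`. The second splits the law
of `W` into a normal part and a gap, and is the better one when `s` is small but `W` is already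
known to be nearly normal. -/
theorem exists_indep_step_bound {ρ : ℝ} (hρ : 0 < ρ) (hρ' : ρ ≤ 1) : ∃ c : ℝ, 1 ≤ c ∧
    ∀ {Ω : Type*} [MeasurableSpace Ω] (μ : Measure Ω) [IsProbabilityMeasure μ] (W ξ : Ω → ℝ)
      (s a B : ℝ), Measurable W → Measurable ξ → IndepFun W ξ μ →
      Integrable (fun ω => ξ ω ^ 2) μ → ∫ ω, ξ ω ∂μ = 0 → ∫ ω, ξ ω ^ 2 ∂μ = a ^ 2 →
      Integrable (fun ω => |ξ ω| ^ (2 + ρ)) μ → ∫ ω, |ξ ω| ^ (2 + ρ) ∂μ ≤ B → 0 < s → 0 ≤ a →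
      (∀ u, |smoothCdf s (μ.map fun ω => W ω + ξ ω) u - smoothCdf (√(s ^ 2 + a ^ 2)) (μ.map W) u|
        ≤ c * (B + a ^ (2 + ρ)) / s ^ (2 + ρ)) ∧
      ∀ (w K : ℝ), 0 < w → (∀ u, |cdfGap (μ.map W) w u| ≤ K) → ∀ u,
        |smoothCdf s (μ.map fun ω => W ω + ξ ω) u - smoothCdf (√(s ^ 2 + a ^ 2)) (μ.map W) u|
        ≤ c * (B + a ^ (2 + ρ)) / √(s ^ 2 + w ^ 2) ^ (2 + ρ) +
          c * K * (B + a ^ (2 + ρ)) / s ^ (2 + ρ) := by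
  obtain ⟨c, hc1, hc⟩ := exists_rpow_step_bound hρ hρ'
  refine ⟨c, hc1, fun {Ω} _ μ _ W ξ s a B hW hξ hi h2 h1 hv hint hB hs ha => ?_⟩
  have : IsProbabilityMeasure (μ.map W) := Measure.isProbabilityMeasure_map hW.aemeasurable
  have key : ∀ (G : ℝ → ℝ) (K s' u : ℝ), Measurable G → (∀ x, |G x| ≤ K) → 0 < s' →
      |(∫ ω, gaussSmooth s' G (u - ξ ω) ∂μ) - gaussSmooth a (gaussSmooth s' G) u|
        ≤ c * K * (B + a ^ (2 + ρ)) / s' ^ (2 + ρ) := fun G K s' u hG hK hs' => by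
    refine (hc μ ξ G K s' a u hξ h2 h1 hv hint hG hK hs' ha).trans ?_
    have : 0 ≤ K := (abs_nonneg _).trans (hK 0)
    gcongr
  have hR : smoothCdf s (μ.map W) = gaussSmooth s (fun u => cdf (μ.map W) u) :=
    funext fun u => smoothCdf_eq_gaussSmooth hs _ u
  refine ⟨fun u => ?_, fun w K hw hK u => ?_⟩
  · rw [smoothCdf_map_add hW hξ hi, ← gaussSmooth_smoothCdf hs, hR]
    simpa using key _ 1 s u (measurable_cdf (μ.map W)) (abs_cdf_le _) hs
  · have hw' : 0 < √(s ^ 2 + w ^ 2) := by positivity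
    rw [smoothCdf_map_add hW hξ hi, ← gaussSmooth_smoothCdf hs]
    have hsplit : smoothCdf s (μ.map W) = fun u => gaussSmooth (√(s ^ 2 + w ^ 2)) unitStep u +
        gaussSmooth s (cdfGap (μ.map W) w) u := funext fun u => by
      rw [smoothCdf_eq_add_cdfGap hs hw, gaussSmooth_unitStep hw']
    have m1 := measurable_gaussSmooth hw' measurable_unitStep abs_unitStep_le
    have m2 := measurable_gaussSmooth hs (measurable_cdfGap (μ.map W) w) hK
    have b1 := abs_gaussSmooth_le (√(s ^ 2 + w ^ 2)) abs_unitStep_le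
    have b2 := abs_gaussSmooth_le s hK
    have k1 := key unitStep 1 _ u measurable_unitStep abs_unitStep_le hw'
    have k2 := key (cdfGap (μ.map W) w) K s u (measurable_cdfGap _ _) hK hs
    have i1 : Integrable (fun ω => gaussSmooth (√(s ^ 2 + w ^ 2)) unitStep (u - ξ ω)) μ :=
      integrable_of_abs_le (m1.comp (measurable_const.sub hξ)) fun _ => b1 _
    have i2 : Integrable (fun ω => gaussSmooth s (cdfGap (μ.map W) w) (u - ξ ω)) μ :=
      integrable_of_abs_le (m2.comp (measurable_const.sub hξ)) fun _ => b2 _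
    rw [hsplit, gaussSmooth_add a m1 m2 b1 b2, integral_add i1 i2]
    rw [mul_one] at k1
    rw [abs_le] at *
    constructor <;> linarith

theorem abs_sub_le_sum_of_steps (f τ : ℕ → ℝ) (n : ℕ)
    (h : ∀ k < n, |f (k + 1) - f k| ≤ τ k) : |f n - f 0| ≤ ∑ k ∈ Finset.range n, τ k := by
  rw [← Finset.sum_range_sub]
  exact (Finset.abs_sum_le_sum_abs _ _).trans
    (Finset.sum_le_sum fun k hk => h k (Finset.mem_range.1 hk))

/-- Extra smoothing by `A` step variances shifts the convergent series of late errors into its tail,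
so their sum can be made as small as the induction requires. -/
theorem exists_tail_sum_rpow_le {r : ℝ} (hr : 1 < r) {ε : ℝ} (hε : 0 < ε) :
    ∃ A : ℕ, 1 ≤ A ∧ ∀ n : ℕ, ∑ j ∈ Finset.range n, ((j : ℝ) + A) ^ (-r) ≤ ε := by
  have hs : Summable fun j : ℕ => (j : ℝ) ^ (-r) := Real.summable_nat_rpow.2 (by linarith)
  have ht := tendsto_sum_nat_add fun j : ℕ => (j : ℝ) ^ (-r)
  obtain ⟨A, hA⟩ := Filter.eventually_atTop.1 (ht.eventually (gt_mem_nhds hε))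
  refine ⟨A + 1, by omega, fun n => ?_⟩
  have h1 : Summable fun j : ℕ => ((j + (A + 1) : ℕ) : ℝ) ^ (-r) :=
    (summable_nat_add_iff (f := fun j : ℕ => (j : ℝ) ^ (-r)) (A + 1)).2 hs
  have h2 := h1.sum_le_tsum (Finset.range n) (fun i _ => by positivity)
  have h3 := hA (A + 1) (by omega)
  push_cast at h2 h3 ⊢
  linarith

theorem dirac_zero_smoothCdf (s u : ℝ) : smoothCdf s (Measure.dirac 0) u = stdCdf (u / s) := by
  simp [smoothCdf]

/-- The Berry-Esseen bound for independent centered variables with a common variance and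
uniformly bounded absolute moments of order `2 + ρ`. -/
theorem exists_berry_esseen {ρ σ : ℝ} (hρ : 0 < ρ) (hρ' : ρ ≤ 1) (hσ : 0 < σ) (B : ℝ) :
    ∃ C : ℝ, 1 ≤ C ∧ ∀ {Ω : Type*} [MeasurableSpace Ω] (μ : Measure Ω) [IsProbabilityMeasure μ]
      (ξ : ℕ → Ω → ℝ), (∀ i, Measurable (ξ i)) → iIndepFun ξ μ →
      (∀ i, Integrable (fun ω => ξ i ω ^ 2) μ) → (∀ i, ∫ ω, ξ i ω ∂μ = 0) →
      (∀ i, ∫ ω, ξ i ω ^ 2 ∂μ = σ ^ 2) → (∀ i, Integrable (fun ω => |ξ i ω| ^ (2 + ρ)) μ) →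
      (∀ i, ∫ ω, |ξ i ω| ^ (2 + ρ) ∂μ ≤ B) →
      ∀ n : ℕ, 1 ≤ n → ∀ u,
        |cdfGap (μ.map fun ω => ∑ i ∈ Finset.range n, ξ i ω) (σ * √n) u| ≤ C * (n : ℝ) ^ (-(ρ / 2)) := by
  obtain ⟨c, hc1, hc⟩ := exists_indep_step_bound hρ hρ'
  obtain ⟨c', hc1', hc'⟩ := exists_cdfGap_le_of_gaussSmooth_le
  set b := c * (|B| + σ ^ (2 + ρ)) / σ ^ (2 + ρ) with hb
  have hσp : 0 < σ ^ (2 + ρ) := by positivity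
  have hb0 : 0 < b := by positivity
  set r := 1 + ρ / 2 with hr
  -- This `ε` makes the terms carrying the induction hypothesis contribute exactly `D / 2` in the
  -- end. It does not involve `D`, so `D` may be chosen afterwards in terms of `A`.
  obtain ⟨A, hA1, hA⟩ := exists_tail_sum_rpow_le (r := r) (by linarith)
    (ε := 1 / (4 * c' * b)) (by positivity)
  set D := 2 * (c' * (5 * b + √A)) with hD
  have hA1' : (1 : ℝ) ≤ A := by exact_mod_cast hA1
  have hsA : 1 ≤ √(A : ℝ) := Real.one_le_sqrt.2 hA1'
  have hD1 : 1 ≤ D := by nlinarith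
  refine ⟨D, hD1, fun {Ω} _ μ _ ξ hξm hind hi2 hmean hvar hir hBr => ?_⟩
  have hW : ∀ k, Measurable fun ω => ∑ i ∈ Finset.range k, ξ i ω := fun k =>
    Finset.measurable_sum _ fun i _ => hξm i
  intro n
  induction n using Nat.strong_induction_on with
  | _ n ih =>
  intro hn
  have hn' : (1 : ℝ) ≤ n := by exact_mod_cast hn
  have hn0 : (0 : ℝ) < n := by linarith
  -- `s k ^ 2` is the variance of the `n - k` summands not yet replaced, plus the smoothing variance
  -- `σ² A`.
  set s : ℕ → ℝ := fun k => σ * √((n : ℝ) - k + A) with hs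
  have hspos : ∀ k ≤ n, 0 < s k := fun k hk => by
    have : (k : ℝ) ≤ n := by exact_mod_cast hk
    have : 0 < (n : ℝ) - k + A := by linarith
    positivity
  have hsq : ∀ k ≤ n, s k ^ 2 = σ ^ 2 * ((n : ℝ) - k + A) := fun k hk => by
    have : (k : ℝ) ≤ n := by exact_mod_cast hk
    rw [hs, mul_pow, Real.sq_sqrt (by linarith)]
  have hpow : ∀ x : ℝ, 0 ≤ x → (σ * √x) ^ (2 + ρ) = σ ^ (2 + ρ) * x ^ r := fun x hx => by
    rw [Real.mul_rpow hσ.le (Real.sqrt_nonneg x), Real.sqrt_eq_rpow, ← Real.rpow_mul hx]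
    congr 2
    rw [hr]; ring
  set τ : ℕ → ℝ := fun k => b * (5 * (n : ℝ) ^ (-r) +
    2 * D * (n : ℝ) ^ (-(ρ / 2)) * (((n - 1 - k : ℕ) : ℝ) + A) ^ (-r)) with hτ
  have hstep : ∀ u, ∀ k < n, |smoothCdf (s (k + 1)) (μ.map fun ω => ∑ i ∈ Finset.range (k + 1), ξ i ω) u
      - smoothCdf (s k) (μ.map fun ω => ∑ i ∈ Finset.range k, ξ i ω) u| ≤ τ k := fun u k hk => by
    have hk' : (k : ℝ) + 1 ≤ n := by exact_mod_cast hk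
    have hindk : IndepFun (fun ω => ∑ i ∈ Finset.range k, ξ i ω) (ξ k) μ := by
      have := hind.indepFun_finsetSum_of_notMem hξm (s := Finset.range k) (i := k) (by simp)
      convert! this using 1
      ext ω
      simp
    have hsk : √(s (k + 1) ^ 2 + σ ^ 2) = s k := by
      rw [hsq (k + 1) hk, ← Real.sqrt_sq (hspos k hk.le).le, hsq k hk.le]
      congr 1
      push_cast
      ring
    obtain ⟨g1, g2⟩ := hc μ _ (ξ k) (s (k + 1)) σ |B| (hW k) (hξm k) hindk (hi2 k) (hmean k)
      (hvar k) (hir k) ((hBr k).trans (le_abs_self B)) (hspos _ hk) hσ.le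
    have hcast : ((n - 1 - k : ℕ) : ℝ) + A = (n : ℝ) - (k + 1 : ℕ) + A := by
      rw [Nat.sub_sub, Nat.cast_sub (by omega)]
      push_cast; ring
    have hx0 : 0 < (n : ℝ) - (k + 1 : ℕ) + A := by push_cast; linarith
    have hsp : s (k + 1) ^ (2 + ρ) = σ ^ (2 + ρ) * ((n : ℝ) - (k + 1 : ℕ) + A) ^ r := hpow _ hx0.le
    simp only [Finset.sum_range_succ]
    rw [← hsk]
    have p1 : 0 ≤ (n : ℝ) ^ (-r) := by positivity
    have p2 : 0 ≤ 2 * D * (n : ℝ) ^ (-(ρ / 2)) * (((n - 1 - k : ℕ) : ℝ) + A) ^ (-r) := by positivity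
    -- In the first half the smoothing variance is of order `n`, so the crude bound is enough; this
    -- also covers `k = 0`, where no induction hypothesis exists. The coefficient `5` in `τ`
    -- dominates the `4` needed here and the `1` needed in the second half.
    rcases lt_or_ge (2 * k) n with hlt | hge
    · refine (g1 u).trans ?_
      rw [hsp, ← div_div, ← hb, div_eq_mul_inv, ← Real.rpow_neg hx0.le]
      refine mul_le_mul_of_nonneg_left ?_ hb0.le
      have hlt' : 2 * (k : ℝ) + 1 ≤ n := by exact_mod_cast hlt
      have h1 : ((n : ℝ) - (k + 1 : ℕ) + A) ^ (-r) ≤ ((n : ℝ) / 2) ^ (-r) :=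
        Real.rpow_le_rpow_of_nonpos (by positivity) (by push_cast; linarith) (by linarith)
      have h2 : ((n : ℝ) / 2) ^ (-r) ≤ 4 * (n : ℝ) ^ (-r) := by
        rw [Real.div_rpow hn0.le (by norm_num), div_eq_mul_inv, ← Real.rpow_neg (by norm_num),
          neg_neg, mul_comm]
        gcongr
        calc (2 : ℝ) ^ r ≤ 2 ^ (2 : ℝ) := by
              apply Real.rpow_le_rpow_of_exponent_le <;> linarith
          _ = 4 := by norm_num
      linarith
    · have hk1 : 1 ≤ k := by omega
      have hk0 : (0 : ℝ) < k := by exact_mod_cast hk1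
      refine (g2 (σ * √k) _ (by positivity) (ih k hk hk1) u).trans ?_
      -- Past variance plus remaining variance does not depend on `k`, so the normal part costs
      -- `n^(-r)` at every late step.
      have hwq : √(s (k + 1) ^ 2 + (σ * √k) ^ 2) = σ * √((n : ℝ) - 1 + A) := by
        rw [hsq _ hk, mul_pow, Real.sq_sqrt hk0.le, ← mul_add, Real.sqrt_mul (by positivity),
          Real.sqrt_sq hσ.le]
        congr 2
        push_cast; ring
      rw [hwq, hpow _ (by linarith), hsp, ← div_div, ← hb]
      simp only [hτ]
      rw [hcast]
      have e1 : c * (D * (k : ℝ) ^ (-(ρ / 2))) * (|B| + σ ^ (2 + ρ)) /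
          (σ ^ (2 + ρ) * ((n : ℝ) - (k + 1 : ℕ) + A) ^ r) =
          b * ((D * (k : ℝ) ^ (-(ρ / 2))) * ((n : ℝ) - (k + 1 : ℕ) + A) ^ (-r)) := by
        rw [hb, Real.rpow_neg hx0.le]
        field_simp
      rw [e1, div_eq_mul_inv, ← Real.rpow_neg (by linarith), ← mul_add]
      refine mul_le_mul_of_nonneg_left ?_ hb0.le
      have h1 : ((n : ℝ) - 1 + A) ^ (-r) ≤ (n : ℝ) ^ (-r) :=
        Real.rpow_le_rpow_of_nonpos hn0 (by linarith) (by linarith)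
      have hge' : (n : ℝ) / 2 ≤ k := by
        have : (n : ℝ) ≤ 2 * k := by exact_mod_cast hge
        linarith
      have h2 : (k : ℝ) ^ (-(ρ / 2)) ≤ 2 * (n : ℝ) ^ (-(ρ / 2)) := by
        refine (Real.rpow_le_rpow_of_nonpos (by positivity) hge' (by linarith)).trans ?_
        rw [Real.div_rpow hn0.le (by norm_num), div_eq_mul_inv, ← Real.rpow_neg (by norm_num),
          neg_neg, mul_comm]
        gcongr
        calc (2 : ℝ) ^ (ρ / 2) ≤ 2 ^ (1 : ℝ) := by
              apply Real.rpow_le_rpow_of_exponent_le <;> linarith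
          _ = 2 := by norm_num
      have h3 : D * (k : ℝ) ^ (-(ρ / 2)) * ((n : ℝ) - (k + 1 : ℕ) + A) ^ (-r) ≤
          2 * D * (n : ℝ) ^ (-(ρ / 2)) * ((n : ℝ) - (k + 1 : ℕ) + A) ^ (-r) := by
        refine mul_le_mul_of_nonneg_right ?_ (Real.rpow_nonneg hx0.le _)
        linarith [mul_le_mul_of_nonneg_left h2 (show 0 ≤ D by linarith)]
      linarith
  have hτsum : ∑ k ∈ Finset.range n, τ k ≤
      (5 * b + D / (2 * c')) * (n : ℝ) ^ (-(ρ / 2)) := by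
    have e1 : ∑ k ∈ Finset.range n, (((n - 1 - k : ℕ) : ℝ) + A) ^ (-r) =
        ∑ j ∈ Finset.range n, ((j : ℝ) + A) ^ (-r) :=
      Finset.sum_range_reflect (fun j : ℕ => ((j : ℝ) + A) ^ (-r)) n
    rw [hτ, ← Finset.mul_sum, Finset.sum_add_distrib, Finset.sum_const, Finset.card_range,
      nsmul_eq_mul, ← Finset.mul_sum, e1]
    have e2 : (n : ℝ) * (5 * (n : ℝ) ^ (-r)) = 5 * (n : ℝ) ^ (-(ρ / 2)) := by
      rw [mul_left_comm]
      congr 1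
      nth_rw 1 [← Real.rpow_one (n : ℝ)]
      rw [← Real.rpow_add hn0]
      congr 1
      rw [hr]; ring
    rw [e2]
    have h1 := mul_le_mul_of_nonneg_left (hA n)
      (show 0 ≤ b * (2 * D * (n : ℝ) ^ (-(ρ / 2))) by positivity)
    have e3 : b * (2 * D * (n : ℝ) ^ (-(ρ / 2))) * (1 / (4 * c' * b)) =
        D / (2 * c') * (n : ℝ) ^ (-(ρ / 2)) := by
      field_simp
      norm_num
    rw [e3] at h1
    nlinarith
  have hκ := hspos n le_rfl
  have hw : 0 < σ * √(n : ℝ) := by positivity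
  have hsn : s n = σ * √A := by simp [hs]
  have hs0 : √(s n ^ 2 + (σ * √(n : ℝ)) ^ 2) = s 0 := by
    rw [← Real.sqrt_sq (hspos 0 (Nat.zero_le n)).le, hsq n le_rfl, hsq 0 (Nat.zero_le n), mul_pow,
      Real.sq_sqrt hn0.le]
    congr 1
    push_cast; ring
  have hδ : ∀ u, |gaussSmooth (s n) (cdfGap (μ.map fun ω => ∑ i ∈ Finset.range n, ξ i ω)
      (σ * √n)) u| ≤ (5 * b + D / (2 * c')) * (n : ℝ) ^ (-(ρ / 2)) := fun u => by
    refine le_trans (le_trans (le_of_eq ?_) (abs_sub_le_sum_of_steps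
      (fun k => smoothCdf (s k) (μ.map fun ω => ∑ i ∈ Finset.range k, ξ i ω) u) τ n
      (hstep u))) hτsum
    have : IsProbabilityMeasure (μ.map fun ω => ∑ i ∈ Finset.range n, ξ i ω) :=
      Measure.isProbabilityMeasure_map (hW n).aemeasurable
    rw [smoothCdf_eq_add_cdfGap hκ hw, hs0]
    simp [dirac_zero_smoothCdf]
  intro u
  refine (hc' _ _ _ _ hw hκ hδ u).trans ?_
  have e1 : s n / (σ * √(n : ℝ)) ≤ √A * (n : ℝ) ^ (-(ρ / 2)) := by
    rw [hsn, mul_div_mul_left _ _ hσ.ne', div_eq_mul_inv]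
    gcongr
    rw [Real.sqrt_eq_rpow, ← Real.rpow_neg hn0.le]
    exact Real.rpow_le_rpow_of_exponent_le hn' (by linarith)
  calc c' * ((5 * b + D / (2 * c')) * (n : ℝ) ^ (-(ρ / 2)) + s n / (σ * √(n : ℝ)))
      ≤ c' * ((5 * b + D / (2 * c')) * (n : ℝ) ^ (-(ρ / 2)) + √A * (n : ℝ) ^ (-(ρ / 2))) := by
        gcongr
    _ = (c' * (5 * b + √A) + D / 2) * (n : ℝ) ^ (-(ρ / 2)) := by field_simp; ring
    _ = D * (n : ℝ) ^ (-(ρ / 2)) := by rw [hD]; ring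

/-! ### The normalizing sequences -/

theorem erwA_one {p : ℝ} (hp : 0 < p) : erwA p 1 = 1 := by
  have : Real.Gamma (2 * p) ≠ 0 := (Real.Gamma_pos_of_pos (by linarith)).ne'
  rw [erwA, Nat.cast_one, Real.Gamma_one, show 1 + 2 * p - 1 = 2 * p by ring, one_mul, div_self this]

theorem erwA_pos {p : ℝ} (hp : 0 < p) {n : ℕ} (hn : 1 ≤ n) : 0 < erwA p n := by
  have hn' : (1 : ℝ) ≤ n := by exact_mod_cast hn
  exact div_pos (mul_pos (Real.Gamma_pos_of_pos (by linarith)) (Real.Gamma_pos_of_pos (by linarith)))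
    (Real.Gamma_pos_of_pos (by linarith))

theorem erwA_succ {p : ℝ} (hp : 0 < p) {n : ℕ} (hn : 1 ≤ n) :
    erwA p (n + 1) * (n + 2 * p - 1) = n * erwA p n := by
  have hn' : (1 : ℝ) ≤ n := by exact_mod_cast hn
  have h1 : 0 < (n : ℝ) + 2 * p - 1 := by linarith
  have h2 := Real.Gamma_add_one h1.ne'
  have h3 := Real.Gamma_add_one (show (n : ℝ) ≠ 0 by linarith)
  have h4 := Real.Gamma_pos_of_pos h1
  rw [erwA, erwA, Nat.cast_add_one, h3, show (n : ℝ) + 1 + 2 * p - 1 = n + 2 * p - 1 + 1 by ring, h2]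
  field_simp

/-- The iterated recursion, in the shape of Euler's product for `Γ(2p)`; the asymptotics of `a_n`
follow from Euler's limit formula. -/
theorem erwA_succ_mul_prod {p : ℝ} (hp : 0 < p) (n : ℕ) :
    erwA p (n + 1) * ∏ j ∈ Finset.range n, (2 * p + j) = n.factorial := by
  induction n with
  | zero => simp [erwA_one hp]
  | succ n ih =>
    have h := erwA_succ hp (show 1 ≤ n + 1 by omega)
    rw [Finset.prod_range_succ, Nat.factorial_succ]
    push_cast at h ⊢
    rw [← ih]
    linear_combination h * ∏ j ∈ Finset.range n, (2 * p + (j : ℝ))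

theorem tendsto_erwA {p : ℝ} (hp : 0 < p) :
    Filter.Tendsto (fun n : ℕ => erwA p (n + 1) * ((n : ℝ) + 1) ^ (2 * p - 1)) Filter.atTop
      (nhds (Real.Gamma (2 * p))) := by
  have h1 := Real.GammaSeq_tendsto_Gamma (2 * p)
  have h2 : Filter.Tendsto (fun n : ℕ => 1 + 1 / (n : ℝ)) Filter.atTop (nhds 1) := by
    simpa using (tendsto_one_div_atTop_nhds_zero_nat (𝕜 := ℝ)).const_add 1
  have h3 : Filter.Tendsto (fun n : ℕ => (1 + 1 / (n : ℝ)) ^ (2 * p - 1)) Filter.atTop (nhds 1) := by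
    simpa using h2.rpow_const (p := 2 * p - 1) (Or.inl one_ne_zero)
  have h4 : Filter.Tendsto (fun n : ℕ => 1 + 2 * p * (1 / (n : ℝ))) Filter.atTop (nhds 1) := by
    simpa using ((tendsto_one_div_atTop_nhds_zero_nat (𝕜 := ℝ)).const_mul (2 * p)).const_add 1
  have h5 := (h1.mul h4).mul h3
  rw [mul_one, mul_one] at h5
  refine h5.congr' ?_
  filter_upwards [Filter.eventually_ge_atTop 1] with n hn
  have hn0 : (0 : ℝ) < n := by exact_mod_cast hn
  have hprod : 0 < ∏ j ∈ Finset.range n, (2 * p + (j : ℝ)) :=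
    Finset.prod_pos fun j _ => by positivity
  have e1 := erwA_succ_mul_prod hp n
  have e2 : Real.GammaSeq (2 * p) n = (n : ℝ) ^ (2 * p) * erwA p (n + 1) / (2 * p + n) := by
    rw [Real.GammaSeq, Finset.prod_range_succ, ← e1]
    field_simp
  have e3 : (1 + 1 / (n : ℝ)) ^ (2 * p - 1) = ((n : ℝ) + 1) ^ (2 * p - 1) / (n : ℝ) ^ (2 * p - 1) := by
    rw [← Real.div_rpow (by positivity) hn0.le]
    congr 1
    field_simp
  have e4 : (n : ℝ) ^ (2 * p) = (n : ℝ) ^ (2 * p - 1) * n := by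
    rw [← Real.rpow_add_one hn0.ne']
    congr 1
    ring
  have hne : (n : ℝ) ^ (2 * p - 1) ≠ 0 := (Real.rpow_pos_of_pos hn0 _).ne'
  rw [e2, e3, e4]
  field_simp
  ring

/-- `a_n ^ 2` is comparable with `n ^ (2 - 4 p)`. -/
theorem exists_erwA_sq_bounds {p : ℝ} (hp : 0 < p) : ∃ L : ℝ, 1 ≤ L ∧ ∀ n : ℕ, 1 ≤ n →
    (n : ℝ) ^ (2 - 4 * p) ≤ L * erwA p n ^ 2 ∧ erwA p n ^ 2 ≤ L * (n : ℝ) ^ (2 - 4 * p) := by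
  have hG : 0 < Real.Gamma (2 * p) := Real.Gamma_pos_of_pos (by linarith)
  have h1 := tendsto_erwA hp
  -- The normalized sequence has a positive limit, so both it and its inverse are bounded; the two
  -- bounds give the two inequalities.
  obtain ⟨U, hU⟩ := h1.bddAbove_range
  obtain ⟨V, hV⟩ := (h1.inv₀ hG.ne').bddAbove_range
  refine ⟨1 + U ^ 2 + V ^ 2, by nlinarith [sq_nonneg U, sq_nonneg V], fun n hn => ?_⟩
  obtain ⟨k, rfl⟩ : ∃ k, n = k + 1 := ⟨n - 1, by omega⟩
  have ha := erwA_pos hp hn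
  have hx : (0 : ℝ) < ((k + 1 : ℕ) : ℝ) := by positivity
  have hy : 0 < ((k + 1 : ℕ) : ℝ) ^ (2 * p - 1) := Real.rpow_pos_of_pos hx _
  have u1 : erwA p (k + 1) * ((k + 1 : ℕ) : ℝ) ^ (2 * p - 1) ≤ U := by
    have := hU ⟨k, rfl⟩
    push_cast
    simpa using this
  have v1 : (erwA p (k + 1) * ((k + 1 : ℕ) : ℝ) ^ (2 * p - 1))⁻¹ ≤ V := by
    have := hV ⟨k, rfl⟩
    push_cast
    simpa using this
  have e1 : ((k + 1 : ℕ) : ℝ) ^ (2 - 4 * p) = ((((k + 1 : ℕ) : ℝ) ^ (2 * p - 1)) ^ 2)⁻¹ := by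
    rw [← Real.rpow_natCast, ← Real.rpow_mul hx.le, ← Real.rpow_neg hx.le]
    congr 1
    push_cast; ring
  rw [e1]
  set a := erwA p (k + 1)
  set y := ((k + 1 : ℕ) : ℝ) ^ (2 * p - 1)
  constructor
  · have h2 : (y ^ 2)⁻¹ = ((a * y)⁻¹) ^ 2 * a ^ 2 := by field_simp
    rw [h2]
    have h3 : 0 < (a * y)⁻¹ := by positivity
    have h4 : ((a * y)⁻¹) ^ 2 ≤ V ^ 2 := by gcongr
    gcongr
    nlinarith [sq_nonneg U]
  · have h2 : a ^ 2 = (a * y) ^ 2 * (y ^ 2)⁻¹ := by field_simp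
    rw [h2]
    have h3 : 0 < a * y := by positivity
    have h4 : (a * y) ^ 2 ≤ U ^ 2 := by gcongr
    gcongr
    nlinarith [sq_nonneg V]

theorem rpow_le_nine_mul_rpow {x y β : ℝ} (hx : 0 < x) (hy : 0 < y) (h1 : x ≤ 3 * y) (h2 : y ≤ 3 * x)
    (hβ : -2 ≤ β) (hβ' : β ≤ 2) : x ^ β ≤ 9 * y ^ β := by
  have e : x ^ β = (x / y) ^ β * y ^ β := by
    rw [Real.div_rpow hx.le hy.le]
    field_simp
  rw [e]
  refine mul_le_mul_of_nonneg_right ?_ (by positivity)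
  have n9 : (9 : ℝ) = 3 ^ (2 : ℝ) := by norm_num
  rcases le_total 0 β with h | h
  · calc (x / y) ^ β ≤ 3 ^ β := by
          apply Real.rpow_le_rpow (by positivity) _ h
          rw [div_le_iff₀ hy]; exact h1
      _ ≤ 3 ^ (2 : ℝ) := Real.rpow_le_rpow_of_exponent_le (by norm_num) hβ'
      _ = 9 := n9.symm
  · calc (x / y) ^ β ≤ (1 / 3) ^ β := by
          apply Real.rpow_le_rpow_of_nonpos (by norm_num) _ h
          rw [div_le_div_iff₀ (by norm_num) hy]; linarith
      _ = 3 ^ (-β) := by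
          rw [one_div, Real.inv_rpow (by norm_num), Real.rpow_neg (by norm_num)]
      _ ≤ 3 ^ (2 : ℝ) := Real.rpow_le_rpow_of_exponent_le (by norm_num) (by linarith)
      _ = 9 := n9.symm

/-- For `γ ≤ 1`, Bernoulli's inequality gives `γ k^(γ - 1) ≤ k^γ - (k - 1)^γ`, which telescopes. For
`γ ≥ 1` every summand is at most the last one. -/
theorem sum_Icc_rpow_le {γ : ℝ} (hγ : 0 < γ) (n : ℕ) :
    ∑ k ∈ Finset.Icc 1 n, (k : ℝ) ^ (γ - 1) ≤ (1 + 1 / γ) * (n : ℝ) ^ γ := by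
  rcases le_total γ 1 with h | h
  · induction n with
    | zero => simp; positivity
    | succ n ih =>
      rw [Finset.sum_Icc_succ_top (by omega)]
      have hx : (0 : ℝ) < ((n + 1 : ℕ) : ℝ) := by positivity
      set x := ((n + 1 : ℕ) : ℝ) with hxd
      have hn : (n : ℝ) = x * (1 + -(1 / x)) := by
        rw [hxd]; push_cast; field_simp; ring
      have hx1 : 1 ≤ x := by rw [hxd]; push_cast; linarith [(Nat.cast_nonneg n : (0 : ℝ) ≤ n)]
      have h1x : 1 / x ≤ 1 := by rw [div_le_one hx]; exact hx1
      have hb := rpow_one_add_le_one_add_mul_self (s := -(1 / x)) (by linarith) hγ.le h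
      have e1 : (n : ℝ) ^ γ ≤ x ^ γ * (1 + γ * -(1 / x)) := by
        rw [hn, Real.mul_rpow hx.le (by linarith)]
        gcongr
      have e2 : x ^ γ = x ^ (γ - 1) * x := by
        rw [← Real.rpow_add_one hx.ne']
        congr 1
        ring
      have e3 : x ^ γ * (1 + γ * -(1 / x)) = x ^ γ - γ * x ^ (γ - 1) := by
        rw [e2]
        field_simp
        ring
      have hp : 0 < x ^ (γ - 1) := by positivity
      have h4 : (1 + 1 / γ) * (n : ℝ) ^ γ ≤ (1 + 1 / γ) * (x ^ γ - γ * x ^ (γ - 1)) := by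
        rw [← e3]
        gcongr
      have h5 : (1 + 1 / γ) * (x ^ γ - γ * x ^ (γ - 1)) =
          (1 + 1 / γ) * x ^ γ - γ * x ^ (γ - 1) - x ^ (γ - 1) := by
        field_simp
        ring
      have : 0 ≤ γ * x ^ (γ - 1) := by positivity
      linarith
  · have h1 : ∀ k ∈ Finset.Icc 1 n, (k : ℝ) ^ (γ - 1) ≤ (n : ℝ) ^ (γ - 1) := fun k hk => by
      have := (Finset.mem_Icc.1 hk).2
      exact Real.rpow_le_rpow (by positivity) (by exact_mod_cast this) (by linarith)
    refine (Finset.sum_le_card_nsmul _ _ _ h1).trans ?_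
    rw [Nat.card_Icc, Nat.add_sub_cancel, nsmul_eq_mul]
    rcases Nat.eq_zero_or_pos n with rfl | hn
    · simp; positivity
    have hn0 : (0 : ℝ) < n := by exact_mod_cast hn
    have e2 : (n : ℝ) ^ γ = n * (n : ℝ) ^ (γ - 1) := by
      rw [mul_comm, ← Real.rpow_add_one hn0.ne']
      congr 1
      ring
    rw [← e2]
    have : 0 ≤ 1 / γ * (n : ℝ) ^ γ := by positivity
    nlinarith

theorem erwV_succ (p : ℝ) (n : ℕ) : erwV p (n + 1) = erwV p n + erwA p (n + 1) ^ 2 := by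
  rw [erwV, erwV, Finset.sum_Icc_succ_top (by omega)]

theorem erwV_mono (p : ℝ) : Monotone (erwV p) :=
  monotone_nat_of_le_succ fun n => by
    rw [erwV_succ]
    nlinarith [sq_nonneg (erwA p (n + 1))]

theorem erwV_one {p : ℝ} (hp : 0 < p) : erwV p 1 = 1 := by
  simp [erwV, erwA_one hp]

theorem one_le_erwV {p : ℝ} (hp : 0 < p) {n : ℕ} (hn : 1 ≤ n) : 1 ≤ erwV p n := by
  rw [← erwV_one hp]
  exact erwV_mono p hn

theorem erwV_sub (p : ℝ) {j n : ℕ} (h : j ≤ n) :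
    erwV p n - erwV p j = ∑ i ∈ Finset.Ioc j n, erwA p i ^ 2 := by
  induction n, h using Nat.le_induction with
  | base => simp
  | succ n hn ih =>
    rw [erwV_succ, Finset.sum_Ioc_succ_top hn, ← ih]
    ring

/-- The rate of convergence `1 / √n + 1 / v_n`. -/
noncomputable def erwRate (p : ℝ) (n : ℕ) : ℝ := 1 / √n + 1 / erwV p n

/-- `v_n / (n a_n) ^ 2` bounds the second moment of the average of the first `n` steps. -/
noncomputable def erwDriftSq (p : ℝ) (n : ℕ) : ℝ := erwV p n / (n * erwA p n) ^ 2

theorem exists_erwA_sq_le {p : ℝ} (hp : 0 < p) (hp' : p ≤ 3 / 4) : ∃ L : ℝ, 1 ≤ L ∧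
    ∀ i j : ℕ, 1 ≤ i → 1 ≤ j → i ≤ 3 * j → j ≤ 3 * i → erwA p i ^ 2 ≤ L * erwA p j ^ 2 := by
  obtain ⟨l, hl, h⟩ := exists_erwA_sq_bounds hp
  refine ⟨9 * l ^ 2, by nlinarith, fun i j hi hj hij hji => ?_⟩
  have hi' : (0 : ℝ) < i := by exact_mod_cast hi
  have hj' : (0 : ℝ) < j := by exact_mod_cast hj
  have h1 := rpow_le_nine_mul_rpow (β := 2 - 4 * p) hi' hj' (by exact_mod_cast hij)
    (by exact_mod_cast hji) (by linarith) (by linarith)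
  calc erwA p i ^ 2 ≤ l * (i : ℝ) ^ (2 - 4 * p) := (h i hi).2
    _ ≤ l * (9 * (l * erwA p j ^ 2)) := by
      gcongr
      exact h1.trans (by gcongr; exact (h j hj).1)
    _ = _ := by ring

/-- On a block of indices within a factor `3` the weights are comparable, so the variance of the
block is at least its length times its last weight, up to a constant. -/
theorem exists_erwV_sub_ge {p : ℝ} (hp : 0 < p) (hp' : p ≤ 3 / 4) : ∃ L : ℝ, 1 ≤ L ∧
    (∀ j n : ℕ, 1 ≤ j → j ≤ n → n ≤ 3 * j →
      ((n : ℝ) - j) * erwA p n ^ 2 ≤ L * (erwV p n - erwV p j)) ∧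
    (∀ j n : ℕ, 1 ≤ j → 2 * j ≤ n → n * erwA p n ^ 2 ≤ L * (erwV p n - erwV p j)) ∧
    ∀ n : ℕ, 1 ≤ n → n * erwA p n ^ 2 ≤ L * erwV p n := by
  obtain ⟨l, hl, h⟩ := exists_erwA_sq_le hp hp'
  have key : ∀ j n : ℕ, 1 ≤ j → j ≤ n → n ≤ 3 * j →
      ((n : ℝ) - j) * erwA p n ^ 2 ≤ l * (erwV p n - erwV p j) := fun j n hj hjn hn => by
    rw [erwV_sub p hjn, Finset.mul_sum]
    have h1 : ∀ i ∈ Finset.Ioc j n, erwA p n ^ 2 ≤ l * erwA p i ^ 2 := fun i hi => by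
      have := Finset.mem_Ioc.1 hi
      exact h n i (by omega) (by omega) (by omega) (by omega)
    have h2 := Finset.card_nsmul_le_sum _ _ _ h1
    rwa [Nat.card_Ioc, nsmul_eq_mul, Nat.cast_sub hjn] at h2
  have key2 : ∀ j n : ℕ, 1 ≤ j → 2 * j ≤ n →
      n * erwA p n ^ 2 ≤ 2 * l * (erwV p n - erwV p j) := fun j n hj hn => by
    -- The upper half of the indices alone already supplies variance of order `n a_n²`.
    have h1 := key (n / 2) n (by omega) (by omega) (by omega)
    have h2 := erwV_mono p (show j ≤ n / 2 by omega)
    have h3 : ((n / 2 : ℕ) : ℝ) ≤ n / 2 := Nat.cast_div_le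
    have h4 : 0 ≤ erwA p n ^ 2 := sq_nonneg _
    have h5 : (n : ℝ) / 2 * erwA p n ^ 2 ≤ ((n : ℝ) - (n / 2 : ℕ)) * erwA p n ^ 2 := by
      gcongr
      linarith
    have h6 : l * (erwV p n - erwV p (n / 2)) ≤ l * (erwV p n - erwV p j) := by gcongr
    linarith
  refine ⟨2 * l, by linarith, fun j n h1 h2 h3 => ?_, key2, fun n hn => ?_⟩
  · have := key j n h1 h2 h3
    have h4 : 0 ≤ erwV p n - erwV p j := sub_nonneg.2 (erwV_mono p h2)
    nlinarith
  · rcases Nat.lt_or_ge n 2 with h2 | h2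
    · obtain rfl : n = 1 := by omega
      rw [erwV_one hp, erwA_one hp]
      norm_num
      linarith
    · refine (key2 1 n le_rfl (by omega)).trans ?_
      have := one_le_erwV hp le_rfl
      gcongr
      linarith

/-- The sum is at most `v_n` times the largest `a_j²`. That maximum is bounded when `p ≥ 1/2`, which
gives the part `1 / v_n` of the rate. When `p ≤ 1/2` it is of order `a_n²`, hence at most of order
`v_n / n`, more than enough for the part `1 / √n`. -/
theorem exists_sum_erwA_pow_four_le {p : ℝ} (hp : 0 < p) (hp' : p ≤ 3 / 4) : ∃ L : ℝ, 1 ≤ L ∧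
    ∀ n : ℕ, 1 ≤ n →
      ∑ j ∈ Finset.Icc 1 n, erwA p j ^ 4 ≤ L * erwV p n ^ 2 * erwRate p n := by
  obtain ⟨l, hl, h⟩ := exists_erwA_sq_bounds hp
  obtain ⟨l', hl', -, -, h'⟩ := exists_erwV_sub_ge hp hp'
  refine ⟨l ^ 2 * l', by nlinarith [mul_le_mul hl hl' zero_le_one (by linarith)], fun n hn => ?_⟩
  have hv := one_le_erwV hp hn
  have hn1 : (1 : ℝ) ≤ n := by exact_mod_cast hn
  have hn0 : (0 : ℝ) < n := by linarith
  have hs : 1 ≤ √(n : ℝ) := Real.one_le_sqrt.2 hn1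
  have key : ∀ b : ℝ, (∀ j ∈ Finset.Icc 1 n, erwA p j ^ 2 ≤ b) →
      ∑ j ∈ Finset.Icc 1 n, erwA p j ^ 4 ≤ b * erwV p n := fun b hb => by
    rw [erwV, Finset.mul_sum]
    refine Finset.sum_le_sum fun j hj => ?_
    have := mul_le_mul_of_nonneg_right (hb j hj) (sq_nonneg (erwA p j))
    calc erwA p j ^ 4 = erwA p j ^ 2 * erwA p j ^ 2 := by ring
      _ ≤ _ := this
  have e : l ^ 2 * l' * erwV p n ^ 2 * erwRate p n =
      l ^ 2 * l' * erwV p n ^ 2 / √n + l ^ 2 * l' * erwV p n := by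
    rw [erwRate]
    field_simp
  rw [e]
  have hll : l ≤ l ^ 2 * l' := by nlinarith [mul_le_mul hl hl' zero_le_one (by linarith)]
  rcases le_total (1 / 2) p with hp2 | hp2
  · refine (key l fun j hj => ?_).trans ?_
    · have hj1 := (Finset.mem_Icc.1 hj).1
      have hj' : (1 : ℝ) ≤ j := by exact_mod_cast hj1
      refine (h j hj1).2.trans ?_
      have := Real.rpow_le_one_of_one_le_of_nonpos hj' (show 2 - 4 * p ≤ 0 by linarith)
      nlinarith
    · have : 0 ≤ l ^ 2 * l' * erwV p n ^ 2 / √n := by positivity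
      nlinarith
  · refine (key (l ^ 2 * l' * erwV p n / √n) fun j hj => ?_).trans ?_
    · obtain ⟨hj1, hj2⟩ := Finset.mem_Icc.1 hj
      have h1 : (j : ℝ) ^ (2 - 4 * p) ≤ (n : ℝ) ^ (2 - 4 * p) :=
        Real.rpow_le_rpow (by positivity) (by exact_mod_cast hj2) (by linarith)
      have h2 : erwA p n ^ 2 ≤ l' * erwV p n / √n := by
        rw [le_div_iff₀ (by linarith)]
        refine le_trans ?_ (h' n hn)
        rw [mul_comm]
        gcongr
        rw [Real.sqrt_le_iff]
        constructor <;> nlinarith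
      calc erwA p j ^ 2 ≤ l * (l * (l' * erwV p n / √n)) := by
            refine (h j hj1).2.trans ?_
            gcongr
            refine h1.trans ((h n hn).1.trans ?_)
            gcongr
        _ = _ := by ring
    · have : 0 ≤ l ^ 2 * l' * erwV p n := by positivity
      have e2 : l ^ 2 * l' * erwV p n / √n * erwV p n = l ^ 2 * l' * erwV p n ^ 2 / √n := by ring
      linarith

/-- For `p < 3/4` the exponent `3 - 4p` is positive, so `v_n` is of order `n^(3 - 4p)`, that is, of
order `n a_n²`. The rest follows from this comparison. -/
theorem exists_subcritical_bounds {p : ℝ} (hp : 0 < p) (hp' : p < 3 / 4) : ∃ L : ℝ, 1 ≤ L ∧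
    (∀ n : ℕ, 1 ≤ n → erwV p n ≤ L * (n * erwA p n ^ 2)) ∧
    (∀ n : ℕ, 1 ≤ n → erwDriftSq p n ≤ L / n) ∧
    ∀ k n : ℕ, 1 ≤ k → k ≤ n → n ≤ 3 * k → erwRate p k ≤ L * erwRate p n := by
  obtain ⟨l, hl, h⟩ := exists_erwA_sq_bounds hp
  have hγ : 0 < 3 - 4 * p := by linarith
  set m := 1 + 1 / (3 - 4 * p) with hm
  have hm1 : 1 ≤ m := by
    have : 0 < 1 / (3 - 4 * p) := by positivity
    linarith
  have e0 : ∀ n : ℕ, 1 ≤ n → (n : ℝ) ^ (3 - 4 * p) = n * (n : ℝ) ^ (2 - 4 * p) := fun n hn => by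
    have hn0 : (n : ℝ) ≠ 0 := by positivity
    rw [mul_comm (n : ℝ), ← Real.rpow_add_one hn0]
    congr 1
    ring
  have hV : ∀ n : ℕ, 1 ≤ n → erwV p n ≤ l * m * (n : ℝ) ^ (3 - 4 * p) := fun n hn => by
    have h1 := sum_Icc_rpow_le hγ n
    rw [erwV]
    calc _ ≤ ∑ i ∈ Finset.Icc 1 n, l * (i : ℝ) ^ (3 - 4 * p - 1) := by
          refine Finset.sum_le_sum fun i hi => ?_
          have := (h i (Finset.mem_Icc.1 hi).1).2
          rwa [show 3 - 4 * p - 1 = 2 - 4 * p by ring]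
      _ ≤ _ := by
          rw [← Finset.mul_sum, mul_assoc]
          gcongr
  have hV1 : ∀ n : ℕ, 1 ≤ n → erwV p n ≤ l ^ 2 * m * (n * erwA p n ^ 2) := fun n hn => by
    refine (hV n hn).trans ?_
    rw [e0 n hn]
    calc l * m * (n * (n : ℝ) ^ (2 - 4 * p)) ≤ l * m * (n * (l * erwA p n ^ 2)) := by
          gcongr
          exact (h n hn).1
      _ = _ := by ring
  obtain ⟨l', hl', -, -, h'⟩ := exists_erwV_sub_ge hp hp'.le
  have hl2 : 1 ≤ l ^ 2 := one_le_pow₀ hl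
  have hlm : 1 ≤ l ^ 2 * m := one_le_mul_of_one_le_of_one_le hl2 hm1
  have hll : 1 ≤ l ^ 2 * l' := one_le_mul_of_one_le_of_one_le hl2 hl'
  have hL : l ^ 2 * m ≤ 27 * (l ^ 2 * m) * (l ^ 2 * l') := by nlinarith
  refine ⟨27 * (l ^ 2 * m) * (l ^ 2 * l'), ?_, fun n hn => ?_, fun n hn => ?_, fun k n hk hkn hnk => ?_⟩
  · linarith
  · refine (hV1 n hn).trans ?_
    exact mul_le_mul_of_nonneg_right hL (by positivity)
  · have hn0 : (0 : ℝ) < n := by exact_mod_cast hn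
    have ha := erwA_pos hp hn
    have h1 : erwDriftSq p n ≤ l ^ 2 * m / n := by
      rw [erwDriftSq, div_le_div_iff₀ (by positivity) hn0]
      have := mul_le_mul_of_nonneg_right (hV1 n hn) hn0.le
      nlinarith
    exact h1.trans (div_le_div_of_nonneg_right hL hn0.le)
  · have hn : 1 ≤ n := hk.trans hkn
    have hk0 : (0 : ℝ) < k := by exact_mod_cast hk
    have hn0 : (0 : ℝ) < n := by exact_mod_cast hn
    have hvk := one_le_erwV hp hk
    have hvn := one_le_erwV hp hn
    have h3 : (n : ℝ) ≤ 3 * k := by exact_mod_cast hnk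
    have b1 : 1 / √(k : ℝ) ≤ 27 * (l ^ 2 * m) * (l ^ 2 * l') * (1 / √(n : ℝ)) := by
      have hs : √(n : ℝ) ≤ 3 * √(k : ℝ) := by
        rw [Real.sqrt_le_iff]
        refine ⟨by positivity, ?_⟩
        rw [mul_pow, Real.sq_sqrt hk0.le]
        linarith
      have : 1 / √(k : ℝ) ≤ 3 * (1 / √(n : ℝ)) := by
        rw [mul_one_div, div_le_div_iff₀ (by positivity) (by positivity)]
        linarith
      refine this.trans ?_
      gcongr
      nlinarith
    have b2 : 1 / erwV p k ≤ 27 * (l ^ 2 * m) * (l ^ 2 * l') * (1 / erwV p n) := by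
      rw [mul_one_div, div_le_div_iff₀ (by linarith) (by linarith), one_mul]
      have g1 : (n : ℝ) ^ (2 - 4 * p) ≤ 9 * (k : ℝ) ^ (2 - 4 * p) :=
        rpow_le_nine_mul_rpow hn0 hk0 h3
          (by have : (k : ℝ) ≤ n := by exact_mod_cast hkn
              linarith) (by linarith) (by linarith)
      calc erwV p n ≤ l * m * (n * (n : ℝ) ^ (2 - 4 * p)) := by
            rw [← e0 n hn]; exact hV n hn
        _ ≤ l * m * ((3 * k) * (9 * (l * erwA p k ^ 2))) := by
            gcongr
            exact g1.trans (by gcongr; exact (h k hk).1)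
        _ = 27 * (l ^ 2 * m) * (k * erwA p k ^ 2) := by ring
        _ ≤ 27 * (l ^ 2 * m) * (l' * erwV p k) := by
            exact mul_le_mul_of_nonneg_left (h' k hk) (by positivity)
        _ ≤ 27 * (l ^ 2 * m) * (l ^ 2 * l') * erwV p k := by
            rw [← mul_assoc]
            gcongr
            nlinarith
    rw [erwRate, erwRate, mul_add]
    exact add_le_add b1 b2

/-- The summands are of order at most `k^(1 - 4p)`. For `p > 1/2` they are summable, and `v_n` times
the rate is at least `1`. For `p ≤ 1/2` one bounds `k^(2 - 4p)` by a multiple of `v_n / n` and `1/k`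
by `k^(-1/2)`, whose sum is at most `3 √n`. -/
theorem exists_sum_drift_le {p : ℝ} (hp : 0 < p) (hp' : p < 3 / 4) : ∃ L : ℝ, 1 ≤ L ∧
    ∀ n : ℕ, 1 ≤ n →
      ∑ k ∈ Finset.Icc 1 n, erwA p (k + 1) ^ 2 * erwDriftSq p k ≤ L * erwV p n * erwRate p n := by
  obtain ⟨l, hl, h⟩ := exists_erwA_sq_bounds hp
  obtain ⟨l', hl', -, -, h'⟩ := exists_erwV_sub_ge hp hp'.le
  obtain ⟨m, hm, -, hm', -⟩ := exists_subcritical_bounds hp hp'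
  obtain ⟨t, ht, ht'⟩ := exists_erwA_sq_le hp hp'.le
  have hterm : ∀ k : ℕ, 1 ≤ k → erwA p (k + 1) ^ 2 * erwDriftSq p k ≤
      t * l * m * ((k : ℝ) ^ (2 - 4 * p) / k) := fun k hk => by
    have hk0 : (0 : ℝ) < k := by exact_mod_cast hk
    have hv := one_le_erwV hp hk
    calc erwA p (k + 1) ^ 2 * erwDriftSq p k ≤ (t * (l * (k : ℝ) ^ (2 - 4 * p))) * (m / k) := by
          have h0 : 0 ≤ erwDriftSq p k := by unfold erwDriftSq; positivity
          gcongr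
          · exact (ht' (k + 1) k (by omega) hk (by omega) (by omega)).trans
              (by gcongr; exact (h k hk).2)
          · exact hm' k hk
      _ = _ := by ring
  rcases le_or_gt p (1 / 2) with hp2 | hp2
  · refine ⟨3 * (t * l * m) * (l * l'), ?_, fun n hn => ?_⟩
    · have h1 : 1 ≤ t * l * m := one_le_mul_of_one_le_of_one_le (one_le_mul_of_one_le_of_one_le ht hl) hm
      have h2 : 1 ≤ l * l' := one_le_mul_of_one_le_of_one_le hl hl'
      nlinarith
    · have hn0 : (0 : ℝ) < n := by exact_mod_cast hn
      have hv := one_le_erwV hp hn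
      have h1 : ∀ k ∈ Finset.Icc 1 n, erwA p (k + 1) ^ 2 * erwDriftSq p k ≤
          t * l * m * (l * (l' * erwV p n / n)) * (k : ℝ) ^ ((1 / 2 : ℝ) - 1) := fun k hk => by
        obtain ⟨hk1, hk2⟩ := Finset.mem_Icc.1 hk
        have hk1' : (1 : ℝ) ≤ k := by exact_mod_cast hk1
        have hk0 : (0 : ℝ) < k := by linarith
        refine (hterm k hk1).trans ?_
        rw [mul_assoc (t * l * m)]
        have g1 : (k : ℝ) ^ (2 - 4 * p) ≤ l * (l' * erwV p n / n) := by
          refine (Real.rpow_le_rpow hk0.le (by exact_mod_cast hk2) (by linarith)).trans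
            ((h n hn).1.trans ?_)
          gcongr
          rw [le_div_iff₀ hn0, mul_comm]
          exact h' n hn
        have g2 : 1 / (k : ℝ) ≤ (k : ℝ) ^ ((1 / 2 : ℝ) - 1) := by
          rw [one_div, ← Real.rpow_neg_one]
          exact Real.rpow_le_rpow_of_exponent_le hk1' (by norm_num)
        rw [div_eq_mul_one_div]
        gcongr
      refine (Finset.sum_le_sum h1).trans ?_
      rw [← Finset.mul_sum]
      have h2 := sum_Icc_rpow_le (γ := 1 / 2) (by norm_num) n
      have e1 : (n : ℝ) ^ (1 / 2 : ℝ) = √n := (Real.sqrt_eq_rpow _).symm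
      rw [e1] at h2
      calc _ ≤ t * l * m * (l * (l' * erwV p n / n)) * ((1 + 1 / (1 / 2)) * √n) := by gcongr
        _ = 3 * (t * l * m) * (l * l') * erwV p n * (1 / √n) := by
            have : √(n : ℝ) * √(n : ℝ) = n := Real.mul_self_sqrt hn0.le
            have hs : 0 < √(n : ℝ) := by positivity
            field_simp
            rw [sq, this]
            ring
        _ ≤ _ := by
            rw [erwRate]
            gcongr
            have : 0 < 1 / erwV p n := by positivity
            linarith
  · have hsum : Summable fun k : ℕ => (k : ℝ) ^ (1 - 4 * p) :=
      Real.summable_nat_rpow.2 (by linarith)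
    set S := ∑' k : ℕ, (k : ℝ) ^ (1 - 4 * p) with hS
    have hS0 : 0 ≤ S := tsum_nonneg fun k => by positivity
    refine ⟨1 + t * l * m * S, by nlinarith [show 0 ≤ t * l * m * S by positivity], fun n hn => ?_⟩
    have hv := one_le_erwV hp hn
    have h1 : ∀ k ∈ Finset.Icc 1 n, erwA p (k + 1) ^ 2 * erwDriftSq p k ≤
        t * l * m * (k : ℝ) ^ (1 - 4 * p) := fun k hk => by
      have hk1 := (Finset.mem_Icc.1 hk).1
      have hk0 : (k : ℝ) ≠ 0 := by positivity
      refine (hterm k hk1).trans (le_of_eq ?_)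
      rw [← Real.rpow_sub_one hk0]
      congr 2
      ring
    refine (Finset.sum_le_sum h1).trans ?_
    rw [← Finset.mul_sum]
    have h2 := hsum.sum_le_tsum (Finset.Icc 1 n) (fun i _ => by positivity)
    have h3 : 1 ≤ erwV p n * erwRate p n := by
      rw [erwRate, mul_add, mul_one_div_cancel (by linarith)]
      have : 0 ≤ erwV p n * (1 / √n) := by positivity
      linarith
    rw [mul_assoc (1 + t * l * m * S)]
    calc t * l * m * ∑ k ∈ Finset.Icc 1 n, (k : ℝ) ^ (1 - 4 * p) ≤ t * l * m * S := by gcongr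
      _ ≤ (1 + t * l * m * S) * 1 := by linarith
      _ ≤ _ := by gcongr

/-- Here `a_n²` is of order `1/n` and `v_n` grows logarithmically. The weaker `v_n = O(n^(1/12))`
suffices; the exponent is chosen so that the cube costs only `n^(1/4)`. -/
theorem exists_critical_bounds : ∃ L : ℝ, 1 ≤ L ∧
    (∀ n : ℕ, 1 ≤ n → erwV (3 / 4) n ^ 3 ≤ L * (n : ℝ) ^ (1 / 4 : ℝ)) ∧
    (∀ n : ℕ, 1 ≤ n → erwA (3 / 4) n ^ 2 ≤ L * (n : ℝ) ^ (-1 : ℝ)) ∧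
    ∀ n : ℕ, 1 ≤ n → erwDriftSq (3 / 4) n ≤ L * (n : ℝ) ^ (-(1 / 2) : ℝ) := by
  have hp : (0 : ℝ) < 3 / 4 := by norm_num
  obtain ⟨l, hl, h⟩ := exists_erwA_sq_bounds hp
  rw [show (2 : ℝ) - 4 * (3 / 4) = -1 by norm_num] at h
  have hV : ∀ n : ℕ, 1 ≤ n → erwV (3 / 4) n ≤ l * 13 * (n : ℝ) ^ (1 / 12 : ℝ) := fun n hn => by
    have h1 := sum_Icc_rpow_le (γ := 1 / 12) (by norm_num) n
    rw [erwV]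
    calc _ ≤ ∑ i ∈ Finset.Icc 1 n, l * (i : ℝ) ^ ((1 / 12 : ℝ) - 1) := by
          refine Finset.sum_le_sum fun i hi => ?_
          have hi1 := (Finset.mem_Icc.1 hi).1
          have hi1' : (1 : ℝ) ≤ i := by exact_mod_cast hi1
          refine (h i hi1).2.trans ?_
          exact mul_le_mul_of_nonneg_left
            (Real.rpow_le_rpow_of_exponent_le hi1' (by norm_num)) (by linarith)
      _ ≤ _ := by
          rw [← Finset.mul_sum, mul_assoc]
          gcongr
          refine h1.trans (le_of_eq ?_)
          norm_num
  have hl3 : 1 ≤ l ^ 2 := by nlinarith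
  refine ⟨2197 * l ^ 3, by nlinarith, fun n hn => ?_, fun n hn => ?_, fun n hn => ?_⟩
  · have hv := one_le_erwV hp hn
    calc erwV (3 / 4) n ^ 3 ≤ (l * 13 * (n : ℝ) ^ (1 / 12 : ℝ)) ^ 3 := by
          gcongr
          exact hV n hn
      _ = 2197 * l ^ 3 * (n : ℝ) ^ (1 / 4 : ℝ) := by
          rw [mul_pow, ← Real.rpow_natCast ((n : ℝ) ^ (1 / 12 : ℝ)) 3,
            ← Real.rpow_mul (by positivity), mul_pow]
          norm_num
          ring_nf
          tauto
  · refine (h n hn).2.trans ?_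
    gcongr
    nlinarith
  · have hn1 : (1 : ℝ) ≤ n := by exact_mod_cast hn
    have hn0 : (0 : ℝ) < n := by linarith
    have ha := erwA_pos hp hn
    have h1 := (h n hn).1
    rw [Real.rpow_neg_one] at h1
    have h2 : 1 / erwA (3 / 4) n ^ 2 ≤ l * n := by
      rw [div_le_iff₀ (by positivity)]
      rw [inv_le_iff_one_le_mul₀ hn0] at h1
      linarith
    have e1 : erwDriftSq (3 / 4) n = erwV (3 / 4) n * (1 / erwA (3 / 4) n ^ 2) * (1 / (n : ℝ) ^ 2) := by
      rw [erwDriftSq]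
      field_simp
    rw [e1]
    calc _ ≤ l * 13 * (n : ℝ) ^ (1 / 12 : ℝ) * (l * n) * (1 / (n : ℝ) ^ 2) := by
          gcongr
          exact hV n hn
      _ = 13 * l ^ 2 * (n : ℝ) ^ ((1 / 12 : ℝ) - 1) := by
          rw [Real.rpow_sub_one hn0.ne']
          field_simp
      _ ≤ 2197 * l ^ 3 * (n : ℝ) ^ (-(1 / 2) : ℝ) := by
          have h3 : 13 * l ^ 2 ≤ 2197 * l ^ 3 := by nlinarith
          exact mul_le_mul h3 (Real.rpow_le_rpow_of_exponent_le hn1 (by norm_num))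
            (by positivity) (by positivity)

/-! ### The elephant random walk as a Markov chain -/

theorem IsRademacher.ae_eq {Ω : Type*} [MeasurableSpace Ω] {μ : Measure Ω}
    [IsProbabilityMeasure μ] {ξ : Ω → ℝ} {r : ℝ} (h : IsRademacher μ ξ r) :
    ∀ᵐ ω ∂μ, ξ ω = 1 ∨ ξ ω = -1 := by
  have m1 : MeasurableSet {ω | ξ ω = 1} := h.measurable (measurableSet_singleton 1)
  have m2 : MeasurableSet {ω | ξ ω = -1} := h.measurable (measurableSet_singleton (-1))
  have hd : Disjoint {ω | ξ ω = 1} {ω | ξ ω = -1} := by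
    rw [Set.disjoint_left]
    intro ω h1 h2
    simp only [Set.mem_ofPred_eq] at h1 h2
    norm_num [h1] at h2
  have h1 := measureReal_union (μ := μ) hd m2
  rw [h.prob_one, h.prob_neg_one, add_sub_cancel] at h1
  have h3 : μ ({ω | ξ ω = 1} ∪ {ω | ξ ω = -1})ᶜ = 0 := by
    rw [prob_compl_eq_zero_iff (m1.union m2)]
    rw [measureReal_def, ENNReal.toReal_eq_one_iff] at h1
    exact h1
  exact h3

theorem IsUniformUpTo.ae_mem {Ω : Type*} [MeasurableSpace Ω] {μ : Measure Ω}
    [IsProbabilityMeasure μ] {β : Ω → ℕ} {n : ℕ} (hn : 1 ≤ n) (h : IsUniformUpTo μ β n) :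
    ∀ᵐ ω ∂μ, ∃ i : Fin n, β ω = i.val + 1 := by
  have m1 : ∀ k : ℕ, MeasurableSet {ω | β ω = k} := fun k => h.measurable (measurableSet_singleton k)
  have h1 := measureReal_biUnion_finset (μ := μ) (s := Finset.Icc 1 n) (f := fun k => {ω | β ω = k})
    (fun i _ j _ hij => by
      change Disjoint {ω | β ω = i} {ω | β ω = j}
      rw [Set.disjoint_left]
      intro ω h1 h2
      exact hij (h1.symm.trans h2)) (fun k _ => m1 k)
  have hn' : (n : ℝ) ≠ 0 := by positivity
  rw [Finset.sum_congr rfl h.prob_eq, Finset.sum_const, Nat.card_Icc, Nat.add_sub_cancel,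
    nsmul_eq_mul, mul_one_div_cancel hn', measureReal_def, ENNReal.toReal_eq_one_iff,
    ← prob_compl_eq_zero_iff (Finset.measurableSet_biUnion _ fun k _ => m1 k)] at h1
  filter_upwards [show ∀ᵐ ω ∂μ, ω ∈ ⋃ k ∈ Finset.Icc 1 n, {ω | β ω = k} from h1] with ω hω
  simp only [Set.mem_iUnion, Finset.mem_Icc] at hω
  obtain ⟨k, ⟨hk1, hk2⟩, hk⟩ := hω
  exact ⟨⟨k - 1, by omega⟩, by simp only [Set.mem_ofPred_eq] at hk; simp; omega⟩

/-- The position of the walk with unit steps. -/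
def unitPosition {Ω : Type*} (X : ℕ → Ω → ℝ) (n : ℕ) (ω : Ω) : ℝ :=
  ∑ i ∈ Finset.range n, X (i + 1) ω

theorem unitPosition_succ {Ω : Type*} (X : ℕ → Ω → ℝ) (n : ℕ) (ω : Ω) :
    unitPosition X (n + 1) ω = unitPosition X n ω + X (n + 1) ω := Finset.sum_range_succ _ _

namespace IsElephantWalk

variable {Ω : Type*} [MeasurableSpace Ω] {μ : Measure Ω} {p q : ℝ}
  {α : ℕ → Ω → ℝ} {β : ℕ → Ω → ℕ} {X : ℕ → Ω → ℝ}

theorem measurable_position (h : IsElephantWalk μ p q α β X) (n : ℕ) : Measurable (unitPosition X n) :=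
  Finset.measurable_sum _ fun i _ => h.measurable (i + 1) (by omega)

variable [IsProbabilityMeasure μ]

theorem ae_eq (h : IsElephantWalk μ p q α β X) (n : ℕ) (hn : 1 ≤ n) :
    ∀ᵐ ω ∂μ, X n ω = 1 ∨ X n ω = -1 := by
  induction n using Nat.strong_induction_on with
  | _ n ih =>
  rcases Nat.lt_or_ge n 2 with h2 | h2
  · obtain rfl : n = 1 := by omega
    exact h.first_step.ae_eq
  · obtain ⟨k, rfl⟩ : ∃ k, n = k + 1 := ⟨n - 1, by omega⟩
    have hk : 1 ≤ k := by omega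
    have hall : ∀ᵐ ω ∂μ, ∀ i : Fin k, X (i.val + 1) ω = 1 ∨ X (i.val + 1) ω = -1 :=
      ae_all_iff.2 fun i => ih _ (by omega) (by omega)
    filter_upwards [hall, h.step k hk, (h.rademacher k hk).ae_eq, (h.uniform k hk).ae_mem hk]
      with ω h1 h2 h3 ⟨i, hi⟩
    rw [h2, hi]
    rcases h1 i with e1 | e1 <;> rcases h3 with e2 | e2 <;> simp [e1, e2]

theorem abs_position_le (h : IsElephantWalk μ p q α β X) (n : ℕ) :
    ∀ᵐ ω ∂μ, |unitPosition X n ω| ≤ n := by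
  filter_upwards [ae_all_iff.2 fun i : ℕ => h.ae_eq (i + 1) (by omega)] with ω hω
  refine (Finset.abs_sum_le_sum_abs _ _).trans ?_
  refine (Finset.sum_le_card_nsmul _ _ 1 fun i _ => ?_).trans (by simp)
  rcases hω i with e | e <;> simp [e]

/-- The expectation is decomposed over the values of the sign and of the chosen time. The indicators
of these values factor out by the two independence assumptions. -/
theorem integral_position_succ_eq_sum (h : IsElephantWalk μ p q α β X) {k : ℕ} (hk : 1 ≤ k)
    {g : ℝ → ℝ} (hg : Measurable g) {K : ℝ} (hK : ∀ x, |g x| ≤ K) :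
    ∫ ω, g (unitPosition X (k + 1) ω) ∂μ = ∑ i : Fin k, (1 / (k : ℝ)) *
      (p * ∫ ω, g (unitPosition X k ω + X (i.val + 1) ω) ∂μ +
        (1 - p) * ∫ ω, g (unitPosition X k ω - X (i.val + 1) ω) ∂μ) := by
  have hαm := (h.rademacher k hk).measurable
  have hβm := (h.uniform k hk).measurable
  have hXm : ∀ i : Fin k, Measurable (X (i.val + 1)) := fun i => h.measurable _ (by omega)
  have hTm := h.measurable_position k
  -- the indicator of a value
  let d : ℝ → ℝ → ℝ := fun e x => if x = e then 1 else 0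
  let dn : ℕ → ℕ → ℝ := fun e x => if x = e then 1 else 0
  have hd : ∀ e, Measurable (d e) := fun e =>
    Measurable.ite (measurableSet_singleton e) measurable_const measurable_const
  have hdn : ∀ e, Measurable (dn e) := fun e => measurable_of_countable _
  have hd1 : ∀ e x, |d e x| ≤ 1 := fun e x => by simp only [d]; split_ifs <;> simp
  have hdn1 : ∀ e x, |dn e x| ≤ 1 := fun e x => by simp only [dn]; split_ifs <;> simp
  have hae : ∀ᵐ ω ∂μ, g (unitPosition X (k + 1) ω) = ∑ i : Fin k,
      (d 1 (α (k + 1) ω) * (dn (i.val + 1) (β (k + 1) ω) * g (unitPosition X k ω + X (i.val + 1) ω)) +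
      d (-1) (α (k + 1) ω) * (dn (i.val + 1) (β (k + 1) ω) *
        g (unitPosition X k ω - X (i.val + 1) ω))) := by
    filter_upwards [h.step k hk, (h.rademacher k hk).ae_eq, (h.uniform k hk).ae_mem hk]
      with ω h2 h3 ⟨i, hi⟩
    rw [Finset.sum_eq_single i]
    · rw [unitPosition_succ, h2, hi]
      rcases h3 with e | e
      · norm_num [d, dn, e]
      · norm_num [d, dn, e]
        ring_nf
    · intro j _ hj
      have : ¬ (i.val = j.val) := fun e => hj (Fin.ext e.symm)
      simp [dn, hi, this]
    · simp
  have hpos : ∀ ω, unitPosition X k ω = ∑ i : Fin k, X (i.val + 1) ω := fun ω => Finset.sum_range _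
  have hprod : ∀ (e r : ℝ) (i : Fin k), μ.real {ω | α (k + 1) ω = e} = r → ∀ G : Ω → ℝ,
      (∃ G' : (Fin k → ℝ) → ℝ, Measurable G' ∧ (∀ x, |G' x| ≤ K) ∧
        G = fun ω => G' (fun i : Fin k => X (i.val + 1) ω)) →
      Integrable (fun ω => d e (α (k + 1) ω) * (dn (i.val + 1) (β (k + 1) ω) * G ω)) μ ∧
      ∫ ω, d e (α (k + 1) ω) * (dn (i.val + 1) (β (k + 1) ω) * G ω) ∂μ =
        r * (1 / k * ∫ ω, G ω ∂μ) := by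
    rintro e r i her _ ⟨G', hG', hGK, rfl⟩
    have mV : Measurable fun ω => fun i : Fin k => X (i.val + 1) ω :=
      measurable_pi_lambda _ fun i => hXm i
    have m1 : Measurable fun ω => d e (α (k + 1) ω) := (hd e).comp hαm
    have m2 : Measurable fun ω => dn (i.val + 1) (β (k + 1) ω) := (hdn _).comp hβm
    have m3 : Measurable fun ω => G' (fun i : Fin k => X (i.val + 1) ω) := hG'.comp mV
    have i1 := (h.indep_sign k hk).comp (hd e)
      (show Measurable fun y : ℕ × (Fin k → ℝ) => dn (i.val + 1) y.1 * G' y.2 from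
        ((hdn _).comp measurable_fst).mul (hG'.comp measurable_snd))
    have i2 := (h.indep_time k hk).comp (hdn (i.val + 1)) hG'
    have e1 := i1.integral_fun_mul_eq_mul_integral m1.aestronglyMeasurable
      (m2.mul m3).aestronglyMeasurable
    have e2 := i2.integral_fun_mul_eq_mul_integral m2.aestronglyMeasurable m3.aestronglyMeasurable
    have e3 : ∫ ω, d e (α (k + 1) ω) ∂μ = r := by
      rw [← her, ← integral_indicator_one
        (show MeasurableSet {ω | α (k + 1) ω = e} from hαm (measurableSet_singleton e))]
      congr 1
    have e4 : ∫ ω, dn (i.val + 1) (β (k + 1) ω) ∂μ = 1 / k := by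
      rw [← (h.uniform k hk).prob_eq (i.val + 1) (Finset.mem_Icc.2 ⟨by omega, by omega⟩),
        ← integral_indicator_one (show MeasurableSet {ω | β (k + 1) ω = i.val + 1} from
          hβm (measurableSet_singleton (i.val + 1)))]
      congr 1
      ext ω
      simp [dn, Set.indicator]
    refine ⟨integrable_of_abs_le (K := 1 * (1 * K)) (m1.mul (m2.mul m3)) fun ω => ?_, ?_⟩
    · rw [abs_mul, abs_mul]
      have := hd1 e (α (k + 1) ω)
      have := hdn1 (i.val + 1) (β (k + 1) ω)
      have := hGK (fun i : Fin k => X (i.val + 1) ω)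
      gcongr
    · simp only [Function.comp_def] at e1 e2
      rw [e1, e2, e3, e4]
  have hplus : ∀ i : Fin k, ∃ G' : (Fin k → ℝ) → ℝ, Measurable G' ∧ (∀ x, |G' x| ≤ K) ∧
      (fun ω => g (unitPosition X k ω + X (i.val + 1) ω)) =
        fun ω => G' (fun i : Fin k => X (i.val + 1) ω) := fun i =>
    ⟨fun x => g (∑ j, x j + x i), hg.comp (by fun_prop), fun x => hK _, by simp only [hpos]⟩
  have hminus : ∀ i : Fin k, ∃ G' : (Fin k → ℝ) → ℝ, Measurable G' ∧ (∀ x, |G' x| ≤ K) ∧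
      (fun ω => g (unitPosition X k ω - X (i.val + 1) ω)) =
        fun ω => G' (fun i : Fin k => X (i.val + 1) ω) := fun i =>
    ⟨fun x => g (∑ j, x j - x i), hg.comp (by fun_prop), fun x => hK _, by simp only [hpos]⟩
  have hP := fun i => hprod 1 p i (h.rademacher k hk).prob_one _ (hplus i)
  have hM := fun i => hprod (-1) (1 - p) i (h.rademacher k hk).prob_neg_one _ (hminus i)
  rw [integral_congr_ae hae, integral_finsetSum]
  · refine Finset.sum_congr rfl fun i _ => ?_
    rw [integral_add (hP i).1 (hM i).1, (hP i).2, (hM i).2]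
    ring
  · exact fun i _ => (hP i).1.add (hM i).1

/-- The one-step transition of the position of the walk. -/
theorem integral_position_succ (h : IsElephantWalk μ p q α β X) {k : ℕ} (hk : 1 ≤ k)
    {g : ℝ → ℝ} (hg : Measurable g) {K : ℝ} (hK : ∀ x, |g x| ≤ K) :
    ∫ ω, g (unitPosition X (k + 1) ω) ∂μ =
      ∫ ω, ((1 + (2 * p - 1) * unitPosition X k ω / k) / 2 * g (unitPosition X k ω + 1) +
        (1 - (2 * p - 1) * unitPosition X k ω / k) / 2 * g (unitPosition X k ω - 1)) ∂μ := by
  have hTm := h.measurable_position k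
  have hXm : ∀ i : Fin k, Measurable (X (i.val + 1)) := fun i => h.measurable _ (by omega)
  have iP : ∀ i : Fin k, Integrable (fun ω => g (unitPosition X k ω + X (i.val + 1) ω)) μ := fun i =>
    integrable_of_abs_le (hg.comp (hTm.add (hXm i))) fun ω => hK _
  have iM : ∀ i : Fin k, Integrable (fun ω => g (unitPosition X k ω - X (i.val + 1) ω)) μ := fun i =>
    integrable_of_abs_le (hg.comp (hTm.sub (hXm i))) fun ω => hK _
  have hk0 : (k : ℝ) ≠ 0 := by positivity
  rw [h.integral_position_succ_eq_sum hk hg hK]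
  simp only [← integral_const_mul]
  have e : ∀ i : Fin k, (∫ ω, p * g (unitPosition X k ω + X (i.val + 1) ω) ∂μ) +
      (∫ ω, (1 - p) * g (unitPosition X k ω - X (i.val + 1) ω) ∂μ) =
      ∫ ω, (p * g (unitPosition X k ω + X (i.val + 1) ω) +
        (1 - p) * g (unitPosition X k ω - X (i.val + 1) ω)) ∂μ := fun i =>
    (integral_add ((iP i).const_mul _) ((iM i).const_mul _)).symm
  simp only [e, ← integral_const_mul]
  have iS : ∀ i : Fin k, Integrable (fun ω => 1 / (k : ℝ) *
      (p * g (unitPosition X k ω + X (i.val + 1) ω) +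
        (1 - p) * g (unitPosition X k ω - X (i.val + 1) ω))) μ := fun i =>
    (((iP i).const_mul p).add ((iM i).const_mul (1 - p))).const_mul (1 / (k : ℝ))
  rw [← integral_finsetSum _ fun i _ => iS i]
  refine integral_congr_ae ?_
  filter_upwards [ae_all_iff.2 fun i : ℕ => h.ae_eq (i + 1) (by omega)] with ω hω
  -- Since each past step is `±1`, this expression is affine in it. The average over `i` therefore
  -- sees the past only through the position, and the chain is Markov.
  have e2 : ∀ i : Fin k, 1 / (k : ℝ) * (p * g (unitPosition X k ω + X (i.val + 1) ω) +
      (1 - p) * g (unitPosition X k ω - X (i.val + 1) ω)) =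
      1 / (k : ℝ) * ((g (unitPosition X k ω + 1) + g (unitPosition X k ω - 1)) / 2) +
      (2 * p - 1) / k * X (i.val + 1) ω *
        ((g (unitPosition X k ω + 1) - g (unitPosition X k ω - 1)) / 2) := fun i => by
    rcases hω i with e | e
    · rw [e]; ring
    · rw [e, sub_neg_eq_add, ← sub_eq_add_neg]; ring
  simp only [e2]
  rw [Finset.sum_add_distrib, ← Finset.sum_mul, ← Finset.sum_mul, ← Finset.mul_sum, Finset.sum_const,
    Finset.card_univ, Fintype.card_fin, nsmul_eq_mul]
  have hpos : ∑ i : Fin k, X (i.val + 1) ω = unitPosition X k ω :=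
    (Finset.sum_range fun j => X (j + 1) ω).symm
  rw [hpos]
  field_simp
  ring

end IsElephantWalk

/-! ### The martingale of the walk: drift, second moments and one-step comparison -/

/-- The martingale `a_n T_n - (2 q - 1)` of the walk with unit steps. -/
noncomputable def walkMartingale {Ω : Type*} (p q : ℝ) (X : ℕ → Ω → ℝ) (n : ℕ) (ω : Ω) : ℝ :=
  erwA p n * unitPosition X n ω - (2 * q - 1)

theorem erwA_eq_succ {p : ℝ} (hp : 0 < p) {n : ℕ} (hn : 1 ≤ n) :
    erwA p n = erwA p (n + 1) * (1 + (2 * p - 1) / n) := by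
  have hn' : (n : ℝ) ≠ 0 := by positivity
  have := erwA_succ hp hn
  field_simp
  linarith

theorem erwDriftSq_pos {p : ℝ} (hp : 0 < p) {n : ℕ} (hn : 1 ≤ n) : 0 < erwDriftSq p n := by
  have hn' : (0 : ℝ) < n := by exact_mod_cast hn
  have h1 := one_le_erwV hp hn
  have h2 := erwA_pos hp hn
  rw [erwDriftSq]
  positivity

namespace IsElephantWalk

variable {Ω : Type*} [MeasurableSpace Ω] {μ : Measure Ω} {p q : ℝ}
  {α : ℕ → Ω → ℝ} {β : ℕ → Ω → ℕ} {X : ℕ → Ω → ℝ}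

theorem measurable_walkMartingale (h : IsElephantWalk μ p q α β X) (n : ℕ) :
    Measurable (walkMartingale p q X n) :=
  ((h.measurable_position n).const_mul _).sub_const _

variable [IsProbabilityMeasure μ]

theorem integrable_position_sq (h : IsElephantWalk μ p q α β X) (n : ℕ) :
    Integrable (fun ω => unitPosition X n ω ^ 2) μ := by
  refine Integrable.of_bound ((h.measurable_position n).pow_const 2).aestronglyMeasurable
    ((n : ℝ) ^ 2) ?_
  filter_upwards [h.abs_position_le n] with ω hω
  rw [Real.norm_eq_abs, abs_pow]
  gcongr

theorem integral_position_sq_succ (h : IsElephantWalk μ p q α β X) {k : ℕ} (hk : 1 ≤ k) :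
    ∫ ω, unitPosition X (k + 1) ω ^ 2 ∂μ =
      1 + (1 + 2 * (2 * p - 1) / k) * ∫ ω, unitPosition X k ω ^ 2 ∂μ := by
  have hk0 : (k : ℝ) ≠ 0 := by positivity
  -- The transition formula needs a bounded function. The truncation is invisible, because `|T_k| +
  -- 1` and `|T_{k+1}|` are almost surely at most `k + 1`.
  set g : ℝ → ℝ := fun x => min (x ^ 2) (((k : ℝ) + 1) ^ 2) with hg
  have hgm : Measurable g := (measurable_id.pow_const 2).min measurable_const
  have hgK : ∀ x, |g x| ≤ ((k : ℝ) + 1) ^ 2 := fun x => by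
    rw [abs_of_nonneg (le_min (sq_nonneg x) (sq_nonneg _))]
    exact min_le_right _ _
  have hgv : ∀ x, |x| ≤ (k : ℝ) + 1 → g x = x ^ 2 := fun x hx => by
    refine min_eq_left ?_
    rw [← sq_abs]
    gcongr
  have e1 : ∫ ω, unitPosition X (k + 1) ω ^ 2 ∂μ = ∫ ω, g (unitPosition X (k + 1) ω) ∂μ := by
    refine integral_congr_ae ?_
    filter_upwards [h.abs_position_le (k + 1)] with ω hω
    rw [hgv]
    exact_mod_cast hω
  rw [e1, h.integral_position_succ hk hgm hgK]
  have e2 : ∫ ω, ((1 + (2 * p - 1) * unitPosition X k ω / k) / 2 * g (unitPosition X k ω + 1) +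
        (1 - (2 * p - 1) * unitPosition X k ω / k) / 2 * g (unitPosition X k ω - 1)) ∂μ =
      ∫ ω, (1 + (1 + 2 * (2 * p - 1) / k) * unitPosition X k ω ^ 2) ∂μ := by
    refine integral_congr_ae ?_
    filter_upwards [h.abs_position_le k] with ω hω
    have := abs_le.1 hω
    rw [hgv _ (abs_le.2 ⟨by linarith, by linarith⟩), hgv _ (abs_le.2 ⟨by linarith, by linarith⟩)]
    field_simp
    ring
  rw [e2, integral_add (integrable_const _) ((h.integrable_position_sq k).const_mul _),
    integral_const_mul]
  simp

/-- With `x = (2p - 1)/k`, one step multiplies the second moment by `1 + 2x` and adds `1`, while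
`a_k² = a_{k+1}² (1 + x)²`. Since `1 + 2x ≤ (1 + x)²`, the normalized moment grows by at most
`a_{k+1}²`. -/
theorem sq_mul_integral_position_sq_le (h : IsElephantWalk μ p q α β X) (hp : 0 < p) {k : ℕ}
    (hk : 1 ≤ k) : erwA p k ^ 2 * ∫ ω, unitPosition X k ω ^ 2 ∂μ ≤ erwV p k := by
  induction k, hk using Nat.le_induction with
  | base =>
    have : ∫ ω, unitPosition X 1 ω ^ 2 ∂μ = ∫ _ω, (1 : ℝ) ∂μ := by
      refine integral_congr_ae ?_
      filter_upwards [h.ae_eq 1 le_rfl] with ω hω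
      rcases hω with e | e <;> simp [unitPosition, e]
    rw [this, erwA_one hp, erwV_one hp]
    simp
  | succ k hk ih =>
    rw [h.integral_position_sq_succ hk, erwV_succ]
    rw [erwA_eq_succ hp hk] at ih
    set e := ∫ ω, unitPosition X k ω ^ 2 ∂μ
    have he : 0 ≤ e := integral_nonneg fun ω => sq_nonneg _
    have h2 : erwA p (k + 1) ^ 2 * ((1 + 2 * (2 * p - 1) / k) * e) ≤
        (erwA p (k + 1) * (1 + (2 * p - 1) / k)) ^ 2 * e := by
      have : (erwA p (k + 1) * (1 + (2 * p - 1) / k)) ^ 2 * e =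
          erwA p (k + 1) ^ 2 * ((1 + 2 * (2 * p - 1) / k) * e) +
            erwA p (k + 1) ^ 2 * ((2 * p - 1) / k) ^ 2 * e := by ring
      rw [this]
      have : 0 ≤ erwA p (k + 1) ^ 2 * ((2 * p - 1) / k) ^ 2 * e := by positivity
      linarith
    linarith

theorem integral_drift_sq_le (h : IsElephantWalk μ p q α β X) (hp : 0 < p) (hp' : p ≤ 1) {k : ℕ}
    (hk : 1 ≤ k) :
    ∫ ω, ((2 * p - 1) * unitPosition X k ω / k) ^ 2 ∂μ ≤ erwDriftSq p k := by
  have hk0 : (0 : ℝ) < k := by exact_mod_cast hk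
  have ha := erwA_pos hp hk
  have e1 : ∀ ω, ((2 * p - 1) * unitPosition X k ω / k) ^ 2 =
      ((2 * p - 1) / k) ^ 2 * unitPosition X k ω ^ 2 := fun ω => by ring
  simp only [e1]
  rw [integral_const_mul, erwDriftSq, le_div_iff₀ (by positivity)]
  have h1 := h.sq_mul_integral_position_sq_le hp hk
  have h0 : 0 ≤ ∫ ω, unitPosition X k ω ^ 2 ∂μ := integral_nonneg fun ω => sq_nonneg _
  have h2 : (2 * p - 1) ^ 2 ≤ 1 := by nlinarith
  calc ((2 * p - 1) / k) ^ 2 * (∫ ω, unitPosition X k ω ^ 2 ∂μ) * (k * erwA p k) ^ 2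
      = (2 * p - 1) ^ 2 * (erwA p k ^ 2 * ∫ ω, unitPosition X k ω ^ 2 ∂μ) := by
        field_simp
    _ ≤ 1 * (erwA p k ^ 2 * ∫ ω, unitPosition X k ω ^ 2 ∂μ) := by gcongr
    _ ≤ _ := by linarith

theorem abs_drift_le (h : IsElephantWalk μ p q α β X) (hp : 0 < p) (hp' : p ≤ 1) {k : ℕ}
    (hk : 1 ≤ k) : ∀ᵐ ω ∂μ, |(2 * p - 1) * unitPosition X k ω / k| ≤ 1 := by
  have hk0 : (0 : ℝ) < k := by exact_mod_cast hk
  filter_upwards [h.abs_position_le k] with ω hω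
  rw [abs_div, abs_mul, abs_of_pos hk0, div_le_one hk0]
  have : |2 * p - 1| ≤ 1 := abs_le.2 ⟨by linarith, by linarith⟩
  calc |2 * p - 1| * |unitPosition X k ω| ≤ 1 * k := by gcongr
    _ = k := one_mul _

theorem integrable_drift_sq (h : IsElephantWalk μ p q α β X) (k : ℕ) :
    Integrable (fun ω => ((2 * p - 1) * unitPosition X k ω / k) ^ 2) μ := by
  have := (h.integrable_position_sq k).const_mul (((2 * p - 1) / k) ^ 2)
  refine this.congr (Filter.Eventually.of_forall fun ω => ?_)
  simp only
  ring

theorem integrable_abs_drift (h : IsElephantWalk μ p q α β X) (k : ℕ) :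
    Integrable (fun ω => |(2 * p - 1) * unitPosition X k ω / k|) μ := by
  have hm : Measurable fun ω => (2 * p - 1) * unitPosition X k ω / k :=
    ((h.measurable_position k).const_mul _).div_const _
  exact (((memLp_two_iff_integrable_sq hm.aestronglyMeasurable).2
    (h.integrable_drift_sq k)).integrable (by norm_num)).abs

/-- Cauchy-Schwarz in the form `|x| ≤ r/2 + x²/(2r)`, with `r` the square root of the bound on the
second moment. -/
theorem integral_abs_drift_le (h : IsElephantWalk μ p q α β X) (hp : 0 < p) (hp' : p ≤ 1) {k : ℕ}
    (hk : 1 ≤ k) :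
    ∫ ω, |(2 * p - 1) * unitPosition X k ω / k| ∂μ ≤ √(erwDriftSq p k) := by
  have hr := erwDriftSq_pos hp hk
  set r := √(erwDriftSq p k) with hrd
  have hr0 : 0 < r := Real.sqrt_pos.2 hr
  have hrr : r ^ 2 = erwDriftSq p k := Real.sq_sqrt hr.le
  have h1 : ∫ ω, |(2 * p - 1) * unitPosition X k ω / k| ∂μ ≤
      ∫ ω, (r / 2 + 1 / (2 * r) * ((2 * p - 1) * unitPosition X k ω / k) ^ 2) ∂μ := by
    refine integral_mono (h.integrable_abs_drift k)
      ((integrable_const _).add ((h.integrable_drift_sq k).const_mul _)) fun ω => ?_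
    simp only
    set x := (2 * p - 1) * unitPosition X k ω / k
    have : r / 2 + 1 / (2 * r) * x ^ 2 - |x| = (|x| - r) ^ 2 / (2 * r) := by
      rw [← sq_abs x]
      field_simp
      ring
    have : 0 ≤ (|x| - r) ^ 2 / (2 * r) := by positivity
    linarith
  rw [integral_add (integrable_const _) ((h.integrable_drift_sq k).const_mul _),
    integral_const_mul] at h1
  have h2 := h.integral_drift_sq_le hp hp' hk
  rw [← hrr] at h2
  have h3 : 1 / (2 * r) * ∫ ω, ((2 * p - 1) * unitPosition X k ω / k) ^ 2 ∂μ ≤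
      1 / (2 * r) * r ^ 2 := by gcongr
  have h4 : 1 / (2 * r) * r ^ 2 = r / 2 := by field_simp
  simp only [integral_const, probReal_univ, one_smul] at h1
  linarith

theorem integral_first_step (h : IsElephantWalk μ p q α β X) : ∫ ω, X 1 ω ∂μ = 2 * q - 1 := by
  have hm := h.first_step.measurable
  have m1 : MeasurableSet {ω | X 1 ω = 1} := hm (measurableSet_singleton 1)
  have e : ∫ ω, X 1 ω ∂μ = ∫ ω, (2 * ({ω | X 1 ω = 1}.indicator 1 ω) - 1) ∂μ := by
    refine integral_congr_ae ?_
    filter_upwards [h.ae_eq 1 le_rfl] with ω hω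
    rcases hω with e | e
    · norm_num [Set.indicator, e]
    · norm_num [Set.indicator, e]
  have i1 : Integrable ({ω | X 1 ω = 1}.indicator (1 : Ω → ℝ)) μ :=
    (integrable_const (1 : ℝ)).indicator m1
  rw [e, integral_sub (i1.const_mul 2) (integrable_const _), integral_const_mul,
    integral_indicator_one m1, h.first_step.prob_one]
  simp

end IsElephantWalk

/-- The tilt of the step is removed first and the remaining symmetric step is then replaced by a
normal one. As for independent summands, the first bound uses nothing about the current law, and the
second exploits a known gap. The gap helps only in the fourth-order term, since the tilt terms are
already small on average. -/
theorem exists_walk_step_bound : ∃ c : ℝ, 1 ≤ c ∧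
    ∀ {Ω : Type*} [MeasurableSpace Ω] (μ : Measure Ω) [IsProbabilityMeasure μ] (p q : ℝ)
      (α : ℕ → Ω → ℝ) (β : ℕ → Ω → ℕ) (X : ℕ → Ω → ℝ), IsElephantWalk μ p q α β X →
      0 < p → p ≤ 1 → ∀ k : ℕ, 1 ≤ k → ∀ s : ℝ, 0 < s →
      (∀ u, |smoothCdf s (μ.map (walkMartingale p q X (k + 1))) u -
          smoothCdf (√(s ^ 2 + erwA p (k + 1) ^ 2)) (μ.map (walkMartingale p q X k)) u|
        ≤ c * (erwDriftSq p k * (erwA p (k + 1) / s) ^ 2 + (erwA p (k + 1) / s) ^ 4)) ∧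
      ∀ w K : ℝ, 0 < w → (∀ u, |cdfGap (μ.map (walkMartingale p q X k)) w u| ≤ K) →
        ∀ u, |smoothCdf s (μ.map (walkMartingale p q X (k + 1))) u -
          smoothCdf (√(s ^ 2 + erwA p (k + 1) ^ 2)) (μ.map (walkMartingale p q X k)) u|
        ≤ c * (√(erwDriftSq p k) * (erwA p (k + 1) / s) ^ 3 +
            erwDriftSq p k * (erwA p (k + 1) / s) ^ 2 +
            (erwA p (k + 1) / √(s ^ 2 + w ^ 2)) ^ 4 + K * (erwA p (k + 1) / s) ^ 4) := by
  obtain ⟨c, hc1, hc⟩ := exists_gaussSmooth_bound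
  obtain ⟨c', hc1', hc'⟩ := exists_symm_step_bound
  refine ⟨8 * c + c' + 8 * c, by linarith,
    fun {Ω} _ μ _ p q α β X h hp hp' k hk s hs => ?_⟩
  have hk0 : (k : ℝ) ≠ 0 := by positivity
  have hMk := h.measurable_walkMartingale k
  have hTm := h.measurable_position k
  have : IsProbabilityMeasure (μ.map (walkMartingale p q X k)) :=
    Measure.isProbabilityMeasure_map hMk.aemeasurable
  have ha := erwA_pos hp (show 1 ≤ k + 1 by omega)
  set a := erwA p (k + 1) with had
  set r := erwDriftSq p k with hr
  have hr0 : 0 < r := erwDriftSq_pos hp hk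
  set m := μ.map (walkMartingale p q X k) with hm
  obtain ⟨R₁, R₂, R₃, R₄, hR⟩ := hc unitStep 1 s measurable_unitStep abs_unitStep_le hs
  have hRe : gaussSmooth s unitStep = fun x => stdCdf (x / s) := funext (gaussSmooth_unitStep hs)
  rw [hRe, mul_one] at hR
  -- removing the drift
  have htilt : ∀ u, |smoothCdf s (μ.map (walkMartingale p q X (k + 1))) u -
      (smoothCdf s m (u - a) + smoothCdf s m (u + a)) / 2| ≤
      8 * c * (√r * (a / s) ^ 3 + r * (a / s) ^ 2) := fun u => by
    -- `D` is the conditional mean of the next step; with the recursion for `a_k`, the martingale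
    -- increment is `a` times the step minus `D`.
    set D : Ω → ℝ := fun ω => (2 * p - 1) * unitPosition X k ω / k with hD
    have hDm : Measurable D := (hTm.const_mul _).div_const _
    have e1 : smoothCdf s (μ.map (walkMartingale p q X (k + 1))) u =
        ∫ ω, ((1 + D ω) / 2 * stdCdf ((u - walkMartingale p q X k ω - a * (1 - D ω)) / s) +
          (1 - D ω) / 2 * stdCdf ((u - walkMartingale p q X k ω + a * (1 + D ω)) / s)) ∂μ := by
      rw [smoothCdf_map (h.measurable_walkMartingale (k + 1))]
      have := h.integral_position_succ hk
        (g := fun x => stdCdf ((u - (a * x - (2 * q - 1))) / s))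
        (measurable_stdCdf.comp (by fun_prop)) (fun x => abs_cdf_le _ _)
      refine this.trans ?_
      congr 1
      ext ω
      have ea : erwA p k * unitPosition X k ω = a * unitPosition X k ω + a * D ω := by
        rw [erwA_eq_succ hp hk, hD]
        ring
      have e3 : u - (a * (unitPosition X k ω + 1) - (2 * q - 1)) =
          u - walkMartingale p q X k ω - a * (1 - D ω) := by
        rw [walkMartingale, ea]; ring
      have e4 : u - (a * (unitPosition X k ω - 1) - (2 * q - 1)) =
          u - walkMartingale p q X k ω + a * (1 + D ω) := by
        rw [walkMartingale, ea]; ring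
      rw [e3, e4]
    have iS : ∀ f : Ω → ℝ, Measurable f → Integrable (fun ω => stdCdf (f ω)) μ := fun f hf =>
      integrable_of_abs_le (measurable_stdCdf.comp hf) fun ω => abs_cdf_le _ _
    have hb : ∀ᵐ ω ∂μ, |D ω| ≤ 1 := h.abs_drift_le hp hp' hk
    have i1 : Integrable (fun ω =>
        (1 + D ω) / 2 * stdCdf ((u - walkMartingale p q X k ω - a * (1 - D ω)) / s) +
          (1 - D ω) / 2 * stdCdf ((u - walkMartingale p q X k ω + a * (1 + D ω)) / s)) μ := by
      refine Integrable.of_bound (Measurable.aestronglyMeasurable ?_) 1 ?_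
      · exact (((hDm.const_add 1).div_const 2).mul (measurable_stdCdf.comp (by fun_prop))).add
          (((hDm.const_sub 1).div_const 2).mul (measurable_stdCdf.comp (by fun_prop)))
      · filter_upwards [hb] with ω hω
        obtain ⟨g1, g2⟩ := abs_le.1 hω
        have b1 := abs_le.1 (abs_cdf_le stdNormal
          ((u - walkMartingale p q X k ω - a * (1 - D ω)) / s))
        have b2 := abs_le.1 (abs_cdf_le stdNormal
          ((u - walkMartingale p q X k ω + a * (1 + D ω)) / s))
        rw [Real.norm_eq_abs, abs_le]
        unfold stdCdf
        constructor <;> nlinarith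
    have i2 : Integrable (fun ω => (stdCdf ((u - walkMartingale p q X k ω - a) / s) +
        stdCdf ((u - walkMartingale p q X k ω + a) / s)) / 2) μ :=
      ((iS _ (by fun_prop)).add (iS _ (by fun_prop))).div_const 2
    have e2 : (smoothCdf s m (u - a) + smoothCdf s m (u + a)) / 2 =
        ∫ ω, (stdCdf ((u - walkMartingale p q X k ω - a) / s) +
        stdCdf ((u - walkMartingale p q X k ω + a) / s)) / 2 ∂μ := by
      rw [integral_div, integral_add (iS _ (by fun_prop)) (iS _ (by fun_prop)), hm,
        smoothCdf_map hMk, smoothCdf_map hMk]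
      congr 3 <;> · ext ω; ring_nf
    rw [e1, e2, ← integral_sub i1 i2, ← Real.norm_eq_abs]
    have i3 : Integrable (fun ω => 8 * c * (|D ω| * (a / s) ^ 3 + D ω ^ 2 * (a / s) ^ 2)) μ :=
      (((h.integrable_abs_drift k).mul_const _).add
        ((h.integrable_drift_sq k).mul_const _)).const_mul _
    refine (norm_integral_le_of_norm_le i3 ?_).trans ?_
    · filter_upwards [hb] with ω hω
      exact hR.tilted_step hs (u - walkMartingale p q X k ω) ha.le hω
    · rw [integral_const_mul, integral_add ((h.integrable_abs_drift k).mul_const _)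
        ((h.integrable_drift_sq k).mul_const _), integral_mul_const, integral_mul_const]
      have g1 := h.integral_abs_drift_le hp hp' hk
      have g2 := h.integral_drift_sq_le hp hp' hk
      gcongr
  have hs' : smoothCdf s m = gaussSmooth s (fun u => cdf m u) :=
    funext fun u => smoothCdf_eq_gaussSmooth hs m u
  have hy : 0 < a / s := by positivity
  have hsr : √r ^ 2 = r := Real.sq_sqrt hr0.le
  refine ⟨fun u => ?_, fun w K hw hK u => ?_⟩
  · have h1 := htilt u
    have h2 := hc' _ 1 s a u (measurable_cdf m) (abs_cdf_le m) hs ha.le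
    rw [← hs', gaussSmooth_smoothCdf hs, mul_one] at h2
    -- The inequality between arithmetic and geometric means absorbs the mixed term.
    have h3 : √r * (a / s) ^ 3 ≤ r * (a / s) ^ 2 + (a / s) ^ 4 := by
      have : 0 ≤ (√r * (a / s) - (a / s) ^ 2) ^ 2 := sq_nonneg _
      have h5 : 0 ≤ √r * (a / s) ^ 3 := by positivity
      nlinarith
    have h4 := (abs_sub_le _ ((smoothCdf s m (u - a) + smoothCdf s m (u + a)) / 2) _).trans
      (add_le_add h1 h2)
    refine h4.trans ?_
    have p1 : 0 ≤ r * (a / s) ^ 2 := by positivity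
    have p2 : 0 ≤ (a / s) ^ 4 := by positivity
    have h5 := mul_le_mul_of_nonneg_left h3 (show 0 ≤ 8 * c by linarith)
    nlinarith [mul_nonneg (show 0 ≤ c' by linarith) p1]
  · have hw' : 0 < √(s ^ 2 + w ^ 2) := by positivity
    have h1 := htilt u
    have hsplit : smoothCdf s m = fun u => gaussSmooth (√(s ^ 2 + w ^ 2)) unitStep u +
        gaussSmooth s (cdfGap m w) u := funext fun u => by
      rw [smoothCdf_eq_add_cdfGap hs hw, gaussSmooth_unitStep hw']
    have m1 := measurable_gaussSmooth hw' measurable_unitStep abs_unitStep_le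
    have m2 := measurable_gaussSmooth hs (measurable_cdfGap m w) hK
    have b1 := abs_gaussSmooth_le (√(s ^ 2 + w ^ 2)) abs_unitStep_le
    have b2 := abs_gaussSmooth_le s hK
    have k1 := hc' unitStep 1 _ a u measurable_unitStep abs_unitStep_le hw' ha.le
    have k2 := hc' (cdfGap m w) K s a u (measurable_cdfGap _ _) hK hs ha.le
    have h2 : |(smoothCdf s m (u - a) + smoothCdf s m (u + a)) / 2 -
        smoothCdf (√(s ^ 2 + a ^ 2)) m u| ≤
        c' * (a / √(s ^ 2 + w ^ 2)) ^ 4 + c' * K * (a / s) ^ 4 := by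
      rw [← gaussSmooth_smoothCdf hs, hsplit, gaussSmooth_add a m1 m2 b1 b2]
      rw [mul_one] at k1
      simp only
      rw [abs_le] at *
      constructor <;> linarith
    have h4 := (abs_sub_le _ ((smoothCdf s m (u - a) + smoothCdf s m (u + a)) / 2) _).trans
      (add_le_add h1 h2)
    refine h4.trans ?_
    have hK0 : 0 ≤ K := (abs_nonneg _).trans (hK 0)
    have p1 : 0 ≤ √r * (a / s) ^ 3 + r * (a / s) ^ 2 := by positivity
    have p2 : 0 ≤ (a / √(s ^ 2 + w ^ 2)) ^ 4 + K * (a / s) ^ 4 := by positivity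
    have q1 := mul_nonneg (show 0 ≤ c' + 8 * c by linarith) p1
    have q2 := mul_nonneg (show 0 ≤ 8 * c + 8 * c by linarith) p2
    nlinarith

/-! ### The Berry-Esseen bound for the walk with unit steps -/

/-- The first increment is centered, but in general it is neither symmetric nor of variance `1`. It
is compared with a normal variable of variance `a_1² = 1` at second order only; later `s²` is of
order `v_n`, so the cost is of order `1 / v_n`. -/
theorem exists_first_step_bound : ∃ c : ℝ, 1 ≤ c ∧
    ∀ {Ω : Type*} [MeasurableSpace Ω] (μ : Measure Ω) [IsProbabilityMeasure μ] (p q : ℝ)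
      (α : ℕ → Ω → ℝ) (β : ℕ → Ω → ℕ) (X : ℕ → Ω → ℝ), IsElephantWalk μ p q α β X →
      0 < p → 0 ≤ q → q ≤ 1 → ∀ s u : ℝ, 0 < s →
      |smoothCdf s (μ.map (walkMartingale p q X 1)) u - stdCdf (u / √(s ^ 2 + 1))| ≤ c / s ^ 2 := by
  obtain ⟨c, hc1, hc⟩ := exists_sq_step_bound
  refine ⟨5 * c, by linarith, fun {Ω} _ μ _ p q α β X h hp hq hq' s u hs => ?_⟩
  have hm := h.measurable_walkMartingale 1
  have he : ∀ ω, walkMartingale p q X 1 ω = X 1 ω - (2 * q - 1) := fun ω => by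
    simp [walkMartingale, erwA_one hp, unitPosition]
  have hb : ∀ᵐ ω ∂μ, walkMartingale p q X 1 ω ^ 2 ≤ 4 := by
    filter_upwards [h.ae_eq 1 le_rfl] with ω hω
    rw [he]
    rcases hω with e | e <;> rw [e] <;> nlinarith
  have hX : Integrable (X 1) μ := by
    refine Integrable.of_bound h.first_step.measurable.aestronglyMeasurable 1 ?_
    filter_upwards [h.ae_eq 1 le_rfl] with ω hω
    rcases hω with e | e <;> simp [e]
  have i2 : Integrable (fun ω => walkMartingale p q X 1 ω ^ 2) μ := by
    refine Integrable.of_bound (hm.pow_const 2).aestronglyMeasurable 4 ?_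
    filter_upwards [hb] with ω hω
    rwa [Real.norm_eq_abs, abs_of_nonneg (sq_nonneg _)]
  have i1 : ∫ ω, walkMartingale p q X 1 ω ∂μ = 0 := by
    simp only [he]
    rw [integral_sub hX (integrable_const _), h.integral_first_step]
    simp
  have h1 := hc μ (walkMartingale p q X 1) s 1 u hm i2 i1 hs
  rw [← smoothCdf_map hm, one_pow] at h1
  refine h1.trans ?_
  have h2 : ∫ ω, walkMartingale p q X 1 ω ^ 2 ∂μ ≤ ∫ _ω, (4 : ℝ) ∂μ :=
    integral_mono_ae i2 (integrable_const _) hb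
  simp only [integral_const, probReal_univ, one_smul] at h2
  refine div_le_div_of_nonneg_right ?_ (sq_nonneg s)
  rw [mul_comm 5 c]
  refine mul_le_mul_of_nonneg_left ?_ (by linarith)
  linarith

/-- The Lindeberg telescoping argument for the walk. -/
theorem exists_walk_gap_le : ∃ c : ℝ, 1 ≤ c ∧
    ∀ {Ω : Type*} [MeasurableSpace Ω] (μ : Measure Ω) [IsProbabilityMeasure μ] (p q : ℝ)
      (α : ℕ → Ω → ℝ) (β : ℕ → Ω → ℕ) (X : ℕ → Ω → ℝ), IsElephantWalk μ p q α β X →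
      0 < p → 0 ≤ q → q ≤ 1 → ∀ n : ℕ, 1 ≤ n → ∀ κ : ℝ, 0 < κ → ∀ τ : ℕ → ℝ,
      (∀ k, 1 ≤ k → k < n → ∀ u,
        |smoothCdf (√(erwV p n - erwV p (k + 1) + κ ^ 2)) (μ.map (walkMartingale p q X (k + 1))) u -
          smoothCdf (√(√(erwV p n - erwV p (k + 1) + κ ^ 2) ^ 2 + erwA p (k + 1) ^ 2))
            (μ.map (walkMartingale p q X k)) u| ≤ τ k) →
      ∀ u, |cdfGap (μ.map (walkMartingale p q X n)) (√(erwV p n)) u| ≤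
        c * (1 / (erwV p n - 1 + κ ^ 2) + (∑ k ∈ Finset.Ico 1 n, τ k) + κ / √(erwV p n)) := by
  obtain ⟨c, hc1, hc⟩ := exists_first_step_bound
  obtain ⟨c', hc1', hc'⟩ := exists_cdfGap_le_of_gaussSmooth_le
  refine ⟨c' * c, one_le_mul_of_one_le_of_one_le hc1' hc1,
    fun {Ω} _ μ _ p q α β X h hp hq hq' n hn κ hκ τ hτ => ?_⟩
  -- The remaining variance plus `κ²`: the smoothing equals `κ` at time `n`, and each step backwards
  -- adds the variance of the replaced increment.
  set s : ℕ → ℝ := fun k => √(erwV p n - erwV p k + κ ^ 2) with hs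
  have hpos : ∀ k ≤ n, 0 < erwV p n - erwV p k + κ ^ 2 := fun k hk => by
    have := erwV_mono p hk
    have : 0 < κ ^ 2 := by positivity
    linarith
  have hs2 : ∀ k ≤ n, s k ^ 2 = erwV p n - erwV p k + κ ^ 2 := fun k hk =>
    Real.sq_sqrt (hpos k hk).le
  have hs0 : ∀ k ≤ n, 0 < s k := fun k hk => Real.sqrt_pos.2 (hpos k hk)
  have hv := one_le_erwV hp hn
  have hw : 0 < √(erwV p n) := Real.sqrt_pos.2 (by linarith)
  have hstep : ∀ u, ∀ i < n - 1,
      |smoothCdf (s (i + 1 + 1)) (μ.map (walkMartingale p q X (i + 1 + 1))) u -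
        smoothCdf (s (i + 1)) (μ.map (walkMartingale p q X (i + 1))) u| ≤ τ (1 + i) :=
    fun u i hi => by
    have h1 := hτ (i + 1) (by omega) (by omega) u
    have e : √(√(erwV p n - erwV p (i + 1 + 1) + κ ^ 2) ^ 2 + erwA p (i + 1 + 1) ^ 2) = s (i + 1) := by
      rw [Real.sq_sqrt (hpos (i + 1 + 1) (by omega)).le, erwV_succ p (i + 1), hs]
      congr 1
      ring
    rw [e, add_comm i 1] at h1
    rwa [add_comm i 1]
  have hδ : ∀ u, |gaussSmooth (s n) (cdfGap (μ.map (walkMartingale p q X n)) (√(erwV p n))) u| ≤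
      c / (erwV p n - 1 + κ ^ 2) + ∑ k ∈ Finset.Ico 1 n, τ k := fun u => by
    have h1 := abs_sub_le_sum_of_steps
      (fun i => smoothCdf (s (i + 1)) (μ.map (walkMartingale p q X (i + 1))) u)
      (fun i => τ (1 + i)) (n - 1) (hstep u)
    rw [← Finset.sum_Ico_eq_sum_range] at h1
    simp only [Nat.sub_add_cancel hn, zero_add] at h1
    have h2 := hc μ p q α β X h hp hq hq' (s 1) u (hs0 1 hn)
    have : IsProbabilityMeasure (μ.map (walkMartingale p q X n)) :=
      Measure.isProbabilityMeasure_map (h.measurable_walkMartingale n).aemeasurable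
    rw [smoothCdf_eq_add_cdfGap (hs0 n le_rfl) hw] at h1
    have e : s n ^ 2 + √(erwV p n) ^ 2 = s 1 ^ 2 + 1 := by
      rw [hs2 n le_rfl, hs2 1 hn, Real.sq_sqrt (by linarith), erwV_one hp]
      ring
    rw [e] at h1
    rw [hs2 1 hn, erwV_one hp] at h2
    rw [hs2 1 hn, erwV_one hp] at h1
    rw [abs_le] at *
    constructor <;> linarith
  intro u
  have h3 := hc' _ _ _ _ hw (hs0 n le_rfl) hδ u
  have e : s n = κ := by simp [hs, Real.sqrt_sq hκ.le]
  rw [e] at h3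
  refine h3.trans ?_
  rw [mul_assoc]
  have hτ0 : 0 ≤ ∑ k ∈ Finset.Ico 1 n, τ k := Finset.sum_nonneg fun k hk => by
    obtain ⟨h1, h2⟩ := Finset.mem_Ico.1 hk
    exact (abs_nonneg _).trans (hτ k h1 h2 0)
  have hκ0 : 0 ≤ κ / √(erwV p n) := by positivity
  have e2 : c / (erwV p n - 1 + κ ^ 2) = c * (1 / (erwV p n - 1 + κ ^ 2)) := by ring
  rw [e2]
  refine mul_le_mul_of_nonneg_left ?_ (by linarith)
  nlinarith

theorem cdfGap_le_of_bound_ge_one (m : Measure ℝ) (w u : ℝ) {b : ℝ} (hb : 1 ≤ b) :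
    |cdfGap m w u| ≤ b := (abs_cdfGap_le_one m w u).trans hb

theorem div_sqrt_sq {a S : ℝ} (hS : 0 < S) : (a / √S) ^ 2 = a ^ 2 / S := by
  rw [div_pow, Real.sq_sqrt hS.le]

theorem div_sqrt_pow_four {a S : ℝ} (hS : 0 < S) : (a / √S) ^ 4 = a ^ 4 / S ^ 2 := by
  rw [show 4 = 2 * 2 by rfl, pow_mul, div_sqrt_sq hS, div_pow, ← pow_mul]

/-! ### Unit steps with critical memory `p = 3/4` -/

theorem exists_critical_step_le : ∃ L : ℝ, 1 ≤ L ∧ ∀ k n : ℕ, 1 ≤ k → k < n →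
    erwDriftSq (3 / 4) k *
        (erwA (3 / 4) (k + 1) /
          √(erwV (3 / 4) n - erwV (3 / 4) (k + 1) + 1 / erwV (3 / 4) n)) ^ 2 +
      (erwA (3 / 4) (k + 1) /
        √(erwV (3 / 4) n - erwV (3 / 4) (k + 1) + 1 / erwV (3 / 4) n)) ^ 4 ≤
      L * ((k + 1 : ℕ) : ℝ) ^ (-(5 / 4) : ℝ) * (1 / erwV (3 / 4) n) := by
  have hp : (0 : ℝ) < 3 / 4 := by norm_num
  obtain ⟨L, hL, hV, hA, hD⟩ := exists_critical_bounds
  have hL3 : 1 ≤ L ^ 3 := one_le_pow₀ hL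
  refine ⟨80 * L ^ 3, by linarith, fun k n hk hkn => ?_⟩
  have hv := one_le_erwV hp (show 1 ≤ n by omega)
  have hvj := erwV_mono (3 / 4) (show k + 1 ≤ n by omega)
  generalize erwV (3 / 4) n = v at *
  have hv0 : 0 < v := by linarith
  have hpos : 0 < v - erwV (3 / 4) (k + 1) + 1 / v := by
    have : 0 < 1 / v := by positivity
    linarith
  set j : ℝ := ((k + 1 : ℕ) : ℝ) with hj
  have hj1 : 1 ≤ j := by rw [hj]; exact_mod_cast (show 1 ≤ k + 1 by omega)
  have hj0 : 0 < j := by linarith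
  have hk0 : (0 : ℝ) < k := by exact_mod_cast hk
  have hr0 := erwDriftSq_pos hp hk
  have hr : erwDriftSq (3 / 4) k ≤ 9 * L * j ^ (-(1 / 2) : ℝ) := by
    refine (hD k hk).trans ?_
    have hk1 : (1 : ℝ) ≤ k := by exact_mod_cast hk
    have hjk : j = k + 1 := by rw [hj]; push_cast; ring
    have := rpow_le_nine_mul_rpow (β := -(1 / 2)) hk0 hj0 (by linarith) (by linarith) (by norm_num)
      (by norm_num)
    nlinarith
  have ha := hA (k + 1) (by omega)
  have ha0 := erwA_pos hp (show 1 ≤ k + 1 by omega)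
  rw [← hj] at ha
  set a := erwA (3 / 4) (k + 1) with had
  set r := erwDriftSq (3 / 4) k with hrd
  have g1 : r * a ^ 2 ≤ 9 * L ^ 2 * j ^ (-(3 / 2) : ℝ) := by
    calc r * a ^ 2 ≤ (9 * L * j ^ (-(1 / 2) : ℝ)) * (L * j ^ (-1 : ℝ)) := by gcongr
      _ = 9 * L ^ 2 * (j ^ (-(1 / 2) : ℝ) * j ^ (-1 : ℝ)) := by ring
      _ = _ := by
        rw [← Real.rpow_add hj0]
        norm_num
  have g2 : a ^ 4 ≤ L ^ 2 * j ^ (-(3 / 2) : ℝ) := by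
    calc a ^ 4 = a ^ 2 * a ^ 2 := by ring
      _ ≤ (L * j ^ (-1 : ℝ)) * (L * j ^ (-1 : ℝ)) := by gcongr
      _ = L ^ 2 * (j ^ (-1 : ℝ) * j ^ (-1 : ℝ)) := by ring
      _ = L ^ 2 * j ^ (-2 : ℝ) := by
        rw [← Real.rpow_add hj0]
        norm_num
      _ ≤ _ := by
        refine mul_le_mul_of_nonneg_left ?_ (by positivity)
        exact Real.rpow_le_rpow_of_exponent_le hj1 (by norm_num)
  rw [div_sqrt_sq hpos, div_sqrt_pow_four hpos, ← mul_div_assoc]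
  have hj54 : j ^ (-(3 / 2) : ℝ) ≤ j ^ (-(5 / 4) : ℝ) :=
    Real.rpow_le_rpow_of_exponent_le hj1 (by norm_num)
  have hjp : 0 < j ^ (-(3 / 2) : ℝ) := by positivity
  have hL2 : 0 ≤ L ^ 2 := by positivity
  -- Either at least half of the variance is still to come, or only the smoothing variance `1 / v`
  -- is guaranteed. In the second case `v` is below `2 v_{k+1}`, so the lost factors of `v` cost at
  -- most `j^(1/4)`, and `j^(-5/4)` remains summable.
  rcases le_or_gt (erwV (3 / 4) (k + 1)) (v / 2) with hlt | hgt
  · have hS : v / 2 ≤ v - erwV (3 / 4) (k + 1) + 1 / v := by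
      have : 0 < 1 / v := by positivity
      linarith
    calc _ ≤ 9 * L ^ 2 * j ^ (-(3 / 2) : ℝ) / (v / 2) + L ^ 2 * j ^ (-(3 / 2) : ℝ) / (v / 2) ^ 2 := by
          gcongr
      _ = L ^ 2 * j ^ (-(3 / 2) : ℝ) * (18 + 4 * (1 / v)) * (1 / v) := by
          field_simp
          ring
      _ ≤ L ^ 2 * j ^ (-(5 / 4) : ℝ) * 80 * (1 / v) := by
          have : 1 / v ≤ 1 := by rw [div_le_one hv0]; exact hv
          gcongr
          linarith
      _ ≤ _ := by
          have : L ^ 2 ≤ L ^ 3 := pow_le_pow_right₀ hL (by norm_num)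
          have := mul_le_mul_of_nonneg_right this
            (show 0 ≤ j ^ (-(5 / 4) : ℝ) * 80 * (1 / v) by positivity)
          nlinarith
  · have hS : 1 / v ≤ v - erwV (3 / 4) (k + 1) + 1 / v := by
      linarith
    have hv3 : v ^ 3 ≤ 8 * (L * j ^ (1 / 4 : ℝ)) := by
      have h1 : v ^ 3 ≤ (2 * erwV (3 / 4) (k + 1)) ^ 3 := by
        gcongr
        linarith
      have h2 := hV (k + 1) (by omega)
      rw [← hj] at h2
      calc v ^ 3 ≤ (2 * erwV (3 / 4) (k + 1)) ^ 3 := h1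
        _ = 8 * erwV (3 / 4) (k + 1) ^ 3 := by ring
        _ ≤ _ := by gcongr
    calc _ ≤ 9 * L ^ 2 * j ^ (-(3 / 2) : ℝ) / (1 / v) + L ^ 2 * j ^ (-(3 / 2) : ℝ) / (1 / v) ^ 2 := by
          gcongr
      _ = L ^ 2 * j ^ (-(3 / 2) : ℝ) * (9 * v ^ 2 + v ^ 3) * (1 / v) := by
          field_simp
      _ ≤ L ^ 2 * j ^ (-(3 / 2) : ℝ) * (10 * v ^ 3) * (1 / v) := by
          gcongr
          nlinarith [sq_nonneg v]
      _ ≤ L ^ 2 * j ^ (-(3 / 2) : ℝ) * (10 * (8 * (L * j ^ (1 / 4 : ℝ)))) * (1 / v) := by gcongr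
      _ = 80 * L ^ 3 * (j ^ (-(3 / 2) : ℝ) * j ^ (1 / 4 : ℝ)) * (1 / v) := by ring
      _ = _ := by
          rw [← Real.rpow_add hj0]
          norm_num

theorem exists_critical_berry_esseen : ∃ C : ℝ, 1 ≤ C ∧
    ∀ {Ω : Type*} [MeasurableSpace Ω] (μ : Measure Ω) [IsProbabilityMeasure μ] (q : ℝ)
      (α : ℕ → Ω → ℝ) (β : ℕ → Ω → ℕ) (X : ℕ → Ω → ℝ), IsElephantWalk μ (3 / 4) q α β X →
      0 ≤ q → q ≤ 1 → ∀ n : ℕ, 1 ≤ n → ∀ u,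
      |cdfGap (μ.map (walkMartingale (3 / 4) q X n)) (√(erwV (3 / 4) n)) u|
        ≤ C * erwRate (3 / 4) n := by
  have hp : (0 : ℝ) < 3 / 4 := by norm_num
  obtain ⟨c, hc1, hc⟩ := exists_walk_step_bound
  obtain ⟨c', hc1', hc'⟩ := exists_walk_gap_le
  obtain ⟨L, hL, hLs⟩ := exists_critical_step_le
  have hsum : Summable fun k : ℕ => (k : ℝ) ^ (-(5 / 4) : ℝ) :=
    Real.summable_nat_rpow.2 (by norm_num)
  set Z := ∑' k : ℕ, (k : ℝ) ^ (-(5 / 4) : ℝ) with hZ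
  have hZ0 : 0 ≤ Z := tsum_nonneg fun k => by positivity
  refine ⟨c' * (3 + c * L * Z), ?_, fun {Ω} _ μ _ q α β X h hq hq' n hn u => ?_⟩
  · have : 0 ≤ c * L * Z := by positivity
    nlinarith
  have hv := one_le_erwV hp hn
  set v := erwV (3 / 4) n with hvd
  have hv0 : 0 < v := by linarith
  have hrate : 1 / v ≤ erwRate (3 / 4) n := by
    rw [erwRate]
    have : 0 ≤ 1 / √(n : ℝ) := by positivity
    linarith
  have hCp : 0 ≤ c' * (3 + c * L * Z) := by positivity
  refine le_trans ?_ (mul_le_mul_of_nonneg_left hrate hCp)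
  -- For `v < 2` the claimed bound exceeds `1`. Otherwise `v - 1 ≥ v / 2`, which controls the error
  -- of the first step.
  rcases lt_or_ge v 2 with hv2 | hv2
  · refine cdfGap_le_of_bound_ge_one _ _ _ ?_
    have h1 : 1 / 2 ≤ 1 / v := one_div_le_one_div_of_le hv0 hv2.le
    have : 0 ≤ c * L * Z := by positivity
    nlinarith
  -- With this choice the cost `κ / √v` of removing the smoothing is exactly `1 / v`.
  set κ := √(1 / v) with hκ
  have hκ0 : 0 < κ := Real.sqrt_pos.2 (by positivity)
  have hκ2 : κ ^ 2 = 1 / v := Real.sq_sqrt (by positivity)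
  have hstep : ∀ k, 1 ≤ k → k < n → ∀ u,
      |smoothCdf (√(v - erwV (3 / 4) (k + 1) + κ ^ 2)) (μ.map (walkMartingale (3 / 4) q X (k + 1))) u -
          smoothCdf (√(√(v - erwV (3 / 4) (k + 1) + κ ^ 2) ^ 2 + erwA (3 / 4) (k + 1) ^ 2))
            (μ.map (walkMartingale (3 / 4) q X k)) u| ≤
      c * L * (((k + 1 : ℕ) : ℝ) ^ (-(5 / 4) : ℝ)) * (1 / v) := fun k hk hkn u => by
    have hvj := erwV_mono (3 / 4) (show k + 1 ≤ n by omega)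
    rw [← hvd] at hvj
    have hpos : 0 < v - erwV (3 / 4) (k + 1) + κ ^ 2 := by
      have : 0 < κ ^ 2 := by positivity
      linarith
    refine ((hc μ (3 / 4) q α β X h hp (by norm_num) k hk _ (Real.sqrt_pos.2 hpos)).1 u).trans ?_
    rw [mul_assoc c, mul_assoc c]
    refine mul_le_mul_of_nonneg_left ?_ (by linarith)
    rw [hκ2]
    exact hLs k n hk hkn
  refine (hc' μ (3 / 4) q α β X h hp hq hq' n hn κ hκ0 _ hstep u).trans ?_
  rw [mul_assoc c']
  refine mul_le_mul_of_nonneg_left ?_ (by linarith)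
  have b1 : 1 / (v - 1 + κ ^ 2) ≤ 2 * (1 / v) := by
    rw [mul_one_div, div_le_div_iff₀ (by positivity) hv0]
    have : 0 < κ ^ 2 := by positivity
    linarith
  have b2 : κ / √v = 1 / v := by
    rw [hκ, Real.sqrt_div zero_le_one, Real.sqrt_one, div_div, Real.mul_self_sqrt hv0.le]
  have b3 : ∑ k ∈ Finset.Ico 1 n, c * L * (((k + 1 : ℕ) : ℝ) ^ (-(5 / 4) : ℝ)) * (1 / v) ≤
      c * L * Z * (1 / v) := by
    rw [← Finset.sum_mul, ← Finset.mul_sum]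
    have : ∑ k ∈ Finset.Ico 1 n, ((k + 1 : ℕ) : ℝ) ^ (-(5 / 4) : ℝ) ≤ Z := by
      have h1 := Finset.sum_Ico_add' (fun k : ℕ => (k : ℝ) ^ (-(5 / 4) : ℝ)) 1 n 1
      rw [h1]
      exact hsum.sum_le_tsum _ fun i _ => by positivity
    gcongr
  rw [b2]
  linarith

/-! ### Unit steps with subcritical memory `p < 3/4` -/

/-- The comparison bounds of the subcritical regime, with one constant. -/
theorem exists_subcritical_comparison {p : ℝ} (hp : 0 < p) (hp' : p < 3 / 4) : ∃ L : ℝ, 1 ≤ L ∧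
    (∀ n : ℕ, 1 ≤ n → erwV p n ≤ L * (n * erwA p n ^ 2)) ∧
    (∀ n : ℕ, 1 ≤ n → n * erwA p n ^ 2 ≤ L * erwV p n) ∧
    (∀ n : ℕ, 1 ≤ n → erwDriftSq p n ≤ L / n) ∧
    (∀ k n : ℕ, 1 ≤ k → k ≤ n → n ≤ 3 * k → erwRate p k ≤ L * erwRate p n) ∧
    (∀ j n : ℕ, 1 ≤ j → j ≤ n → n ≤ 3 * j →
      ((n : ℝ) - j) * erwA p n ^ 2 ≤ L * (erwV p n - erwV p j)) ∧
    (∀ j n : ℕ, 1 ≤ j → 2 * j ≤ n → n * erwA p n ^ 2 ≤ L * (erwV p n - erwV p j)) ∧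
    ∀ i j : ℕ, 1 ≤ i → 1 ≤ j → i ≤ 3 * j → j ≤ 3 * i → erwA p i ^ 2 ≤ L * erwA p j ^ 2 := by
  obtain ⟨l₁, hl₁, h1, h2, h3⟩ := exists_subcritical_bounds hp hp'
  obtain ⟨l₂, hl₂, h4, h5, h6⟩ := exists_erwV_sub_ge hp hp'.le
  obtain ⟨l₃, hl₃, h7⟩ := exists_erwA_sq_le hp hp'.le
  have m1 : l₁ ≤ max l₁ (max l₂ l₃) := le_max_left _ _
  have m2 : l₂ ≤ max l₁ (max l₂ l₃) := (le_max_left _ _).trans (le_max_right _ _)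
  have m3 : l₃ ≤ max l₁ (max l₂ l₃) := (le_max_right _ _).trans (le_max_right _ _)
  refine ⟨max l₁ (max l₂ l₃), hl₁.trans m1, fun n hn => (h1 n hn).trans ?_,
    fun n hn => (h6 n hn).trans ?_, fun n hn => (h2 n hn).trans ?_,
    fun k n hk hkn hn => (h3 k n hk hkn hn).trans ?_,
    fun j n hj hjn hn => (h4 j n hj hjn hn).trans ?_,
    fun j n hj hn => (h5 j n hj hn).trans ?_,
    fun i j hi hj hij hji => (h7 i j hi hj hij hji).trans ?_⟩
  · exact mul_le_mul_of_nonneg_right m1 (by positivity)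
  · exact mul_le_mul_of_nonneg_right m2 (by linarith [one_le_erwV hp hn])
  · exact div_le_div_of_nonneg_right m1 (by positivity)
  · have := one_le_erwV hp (hk.trans hkn)
    exact mul_le_mul_of_nonneg_right m1 (by rw [erwRate]; positivity)
  · exact mul_le_mul_of_nonneg_right m2 (by linarith [erwV_mono p hjn])
  · exact mul_le_mul_of_nonneg_right m2 (by linarith [erwV_mono p (show j ≤ n by omega)])
  · exact mul_le_mul_of_nonneg_right m3 (by positivity)

/-- The scalar core of the late steps: `N = n`, `m = n - k`, `y = 1/(n - k - 1 + A)`, `r` bounds the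
squared drift, and `S`, `V` are the squared smoothing scales of the gap and of the normal part. The
drift terms are of order at most `N^(-1/2) m^(-3/2)`, because `m ≤ N`. -/
theorem late_step_estimate {l r a S V v y m N K : ℝ} (hl : 1 ≤ l) (ha : 0 < a)
    (hS : 0 < S) (hV : S ≤ V) (hv : 0 < v) (hvV : v ≤ 3 * l ^ 3 * V) (hm : 0 < m) (hmN : m ≤ N)
    (hy : 0 < y) (hym : y ≤ 1 / m) (hrN : r ≤ 3 * l / N) (hx : a ^ 2 / S ≤ l ^ 2 * y) (hK : 0 ≤ K) :
    √r * (a / √S) ^ 3 + r * (a / √S) ^ 2 + (a / √V) ^ 4 + K * (a / √S) ^ 4 ≤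
      9 * l ^ 6 * (a ^ 4 / v ^ 2 + 1 / √N * (1 / (m * √m)) + K * y ^ 2) := by
  have hl0 : 0 < l := by linarith
  have hN : 0 < N := by linarith
  have hV0 : 0 < V := by linarith
  have hsm : 0 < √m := Real.sqrt_pos.2 hm
  have hsN : 0 < √N := Real.sqrt_pos.2 hN
  set x := a / √S with hxd
  have hx0 : 0 < x := div_pos ha (Real.sqrt_pos.2 hS)
  have hx2 : x ^ 2 ≤ l ^ 2 * y := by rwa [hxd, div_sqrt_sq hS]
  have hx1 : x ≤ l * (1 / √m) := by
    refine abs_le_of_sq_le_sq' ?_ (by positivity) |>.2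
    refine hx2.trans ?_
    rw [mul_pow, div_pow, one_pow, Real.sq_sqrt hm.le]
    gcongr
  have hr1 : √r ≤ 3 * l * (1 / √N) := by
    rw [Real.sqrt_le_left (by positivity), mul_pow, div_pow, one_pow, Real.sq_sqrt hN.le]
    refine hrN.trans ?_
    rw [div_eq_mul_one_div]
    gcongr
    nlinarith
  have t1 : √r * x ^ 3 ≤ 3 * l ^ 4 * (1 / √N * (1 / (m * √m))) := by
    calc √r * x ^ 3 = √r * (x ^ 2 * x) := by ring
      _ ≤ (3 * l * (1 / √N)) * ((l ^ 2 * (1 / m)) * (l * (1 / √m))) := by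
        gcongr
        exact hx2.trans (by gcongr)
      _ = _ := by
        field_simp
  have t2 : r * x ^ 2 ≤ 3 * l ^ 3 * (1 / √N * (1 / (m * √m))) := by
    calc r * x ^ 2 ≤ (3 * l / N) * (l ^ 2 * (1 / m)) := by
          gcongr
          exact hx2.trans (by gcongr)
      _ = 3 * l ^ 3 * (1 / √N * (1 / (m * √N))) := by
        have : N = √N * √N := (Real.mul_self_sqrt hN.le).symm
        rw [div_eq_mul_one_div, this, ← one_div_mul_one_div, Real.sqrt_mul_self hsN.le,
          ← one_div_mul_one_div m]
        ring
      _ ≤ _ := by gcongr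
  have t3 : (a / √V) ^ 4 ≤ 9 * l ^ 6 * (a ^ 4 / v ^ 2) := by
    rw [div_sqrt_pow_four hV0, ← mul_div_assoc, div_le_div_iff₀ (by positivity) (by positivity)]
    have : v ^ 2 ≤ (3 * l ^ 3 * V) ^ 2 := by gcongr
    calc a ^ 4 * v ^ 2 ≤ a ^ 4 * (3 * l ^ 3 * V) ^ 2 := by gcongr
      _ = _ := by ring
  have t4 : K * x ^ 4 ≤ l ^ 4 * (K * y ^ 2) := by
    calc K * x ^ 4 = K * (x ^ 2) ^ 2 := by ring
      _ ≤ K * (l ^ 2 * y) ^ 2 := by gcongr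
      _ = _ := by ring
  have p1 : l ^ 4 ≤ l ^ 6 := pow_le_pow_right₀ hl (by norm_num)
  have p2 : l ^ 3 ≤ l ^ 6 := pow_le_pow_right₀ hl (by norm_num)
  have q1 : 0 < 1 / √N * (1 / (m * √m)) := by positivity
  have q2 : 0 ≤ K * y ^ 2 := by positivity
  have q3 : 0 < l ^ 6 := by positivity
  have u1 := mul_le_mul_of_nonneg_right p1 q1.le
  have u2 := mul_le_mul_of_nonneg_right p2 q1.le
  have u3 := mul_le_mul_of_nonneg_right p1 q2
  have u4 : 0 ≤ l ^ 6 * (K * y ^ 2) := by positivity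
  have u5 : 0 ≤ l ^ 6 * (1 / √N * (1 / (m * √m))) := by positivity
  linarith

/-- In the early half the remaining variance is comparable with `v_n`. In the late half it is only
of order `a_n²` times the number of steps left, but `v_k`, `a_k` and the rate at time `k` are
comparable with their values at `n`, so a bound at time `k` can be fed back. -/
theorem exists_subcritical_step_le {p : ℝ} (hp : 0 < p) (hp' : p < 3 / 4) : ∃ L : ℝ, 1 ≤ L ∧
    ∀ A : ℝ, 1 ≤ A → ∀ k n : ℕ, 1 ≤ k → k < n →
      (2 * (k + 1) ≤ n →
        erwDriftSq p k *
            (erwA p (k + 1) / √(erwV p n - erwV p (k + 1) + A * erwA p n ^ 2)) ^ 2 +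
          (erwA p (k + 1) / √(erwV p n - erwV p (k + 1) + A * erwA p n ^ 2)) ^ 4 ≤
        L * (erwA p (k + 1) ^ 2 * erwDriftSq p k / erwV p n +
          erwA p (k + 1) ^ 4 / erwV p n ^ 2)) ∧
      (n < 2 * (k + 1) → erwRate p k ≤ L * erwRate p n ∧ ∀ K : ℝ, 0 ≤ K →
        √(erwDriftSq p k) *
            (erwA p (k + 1) / √(erwV p n - erwV p (k + 1) + A * erwA p n ^ 2)) ^ 3 +
          erwDriftSq p k *
            (erwA p (k + 1) / √(erwV p n - erwV p (k + 1) + A * erwA p n ^ 2)) ^ 2 +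
          (erwA p (k + 1) /
            √(erwV p n - erwV p (k + 1) + A * erwA p n ^ 2 + erwV p k)) ^ 4 +
          K * (erwA p (k + 1) / √(erwV p n - erwV p (k + 1) + A * erwA p n ^ 2)) ^ 4 ≤
        L * (erwA p (k + 1) ^ 4 / erwV p n ^ 2 +
          1 / √(n : ℝ) * (1 / (((n : ℝ) - k) * √((n : ℝ) - k))) +
          K * (1 / ((n : ℝ) - (k + 1) + A)) ^ 2)) := by
  obtain ⟨l, hl, hVA, hAV, hD, hR, hs1, hs2, hA⟩ := exists_subcritical_comparison hp hp'
  refine ⟨9 * l ^ 6, by linarith [one_le_pow₀ hl (n := 6)], fun A hA1 k n hk hkn => ⟨fun hn => ?_,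
    fun hn => ⟨(hR k n hk hkn.le (by omega)).trans ?_, fun K hK => ?_⟩⟩⟩
  · have hl0 : 0 < l := by linarith
    have hv := one_le_erwV hp (show 1 ≤ n by omega)
    have hr := erwDriftSq_pos hp hk
    have ha := erwA_pos hp (show 1 ≤ k + 1 by omega)
    have hSv : erwV p n ≤ l ^ 2 * (erwV p n - erwV p (k + 1) + A * erwA p n ^ 2) := by
      have h1 := hVA n (by omega)
      have h2 := hs2 (k + 1) n (by omega) hn
      have h3 : 0 ≤ A * erwA p n ^ 2 := by positivity
      calc _ ≤ l * (n * erwA p n ^ 2) := h1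
        _ ≤ l * (l * (erwV p n - erwV p (k + 1))) := by gcongr
        _ = l ^ 2 * (erwV p n - erwV p (k + 1)) := by ring
        _ ≤ _ := by gcongr; linarith
    generalize erwV p n - erwV p (k + 1) + A * erwA p n ^ 2 = S at *
    have hS : 0 < S := by
      by_contra hS
      have : l ^ 2 * S ≤ 0 := mul_nonpos_of_nonneg_of_nonpos (by positivity) (by linarith)
      linarith
    have hv0 : 0 < erwV p n := by linarith
    have hi : 1 / S ≤ l ^ 2 / erwV p n := by
      rw [div_le_div_iff₀ hS hv0]
      linarith
    rw [div_sqrt_sq hS, div_sqrt_pow_four hS]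
    have t1 : erwDriftSq p k * (erwA p (k + 1) ^ 2 / S) ≤
        l ^ 2 * (erwA p (k + 1) ^ 2 * erwDriftSq p k / erwV p n) := by
      calc _ = erwDriftSq p k * erwA p (k + 1) ^ 2 * (1 / S) := by ring
        _ ≤ erwDriftSq p k * erwA p (k + 1) ^ 2 * (l ^ 2 / erwV p n) := by gcongr
        _ = _ := by ring
    have t2 : erwA p (k + 1) ^ 4 / S ^ 2 ≤ l ^ 4 * (erwA p (k + 1) ^ 4 / erwV p n ^ 2) := by
      calc _ = erwA p (k + 1) ^ 4 * (1 / S) ^ 2 := by ring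
        _ ≤ erwA p (k + 1) ^ 4 * (l ^ 2 / erwV p n) ^ 2 := by gcongr
        _ = _ := by ring
    have p1 : l ^ 4 ≤ l ^ 6 := pow_le_pow_right₀ hl (by norm_num)
    have p2 : l ^ 2 ≤ l ^ 6 := pow_le_pow_right₀ hl (by norm_num)
    have q1 : 0 ≤ erwA p (k + 1) ^ 2 * erwDriftSq p k / erwV p n := by positivity
    have q2 : 0 ≤ erwA p (k + 1) ^ 4 / erwV p n ^ 2 := by positivity
    have u1 := mul_le_mul_of_nonneg_right p2 q1
    have u2 := mul_le_mul_of_nonneg_right p1 q2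
    have u3 : 0 ≤ l ^ 6 * (erwA p (k + 1) ^ 2 * erwDriftSq p k / erwV p n) := by positivity
    have u4 : 0 ≤ l ^ 6 * (erwA p (k + 1) ^ 4 / erwV p n ^ 2) := by positivity
    linarith
  · have hv := one_le_erwV hp (show 1 ≤ n by omega)
    have : l ≤ l ^ 6 := le_self_pow₀ hl (by norm_num)
    have : 0 ≤ l ^ 6 := by positivity
    refine mul_le_mul_of_nonneg_right (by linarith) ?_
    rw [erwRate]
    positivity
  · have hl0 : 0 < l := by linarith
    have hv := one_le_erwV hp (show 1 ≤ n by omega)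
    have hvk := one_le_erwV hp hk
    have hk0 : (0 : ℝ) < k := by exact_mod_cast hk
    have hkn1 : (k : ℝ) + 1 ≤ n := by exact_mod_cast hkn
    have hn3 : (n : ℝ) ≤ 3 * k := by exact_mod_cast (show n ≤ 3 * k by omega)
    have han := erwA_pos hp (show 1 ≤ n by omega)
    have hS : erwA p n ^ 2 / l * ((n : ℝ) - (k + 1) + A) ≤
        erwV p n - erwV p (k + 1) + A * erwA p n ^ 2 := by
      have h1 := hs1 (k + 1) n (by omega) (by omega) (by omega)
      push_cast at h1
      rw [div_mul_eq_mul_div, div_le_iff₀ hl0]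
      have : A * erwA p n ^ 2 ≤ A * erwA p n ^ 2 * l := le_mul_of_one_le_right (by positivity) hl
      linarith
    have hy : 0 < (n : ℝ) - (k + 1) + A := by linarith
    have hS0 : 0 < erwV p n - erwV p (k + 1) + A * erwA p n ^ 2 := lt_of_lt_of_le (by positivity) hS
    refine late_step_estimate hl (erwA_pos hp (by omega)) hS0 (by linarith)
      (by linarith) ?_ (by linarith) (by linarith) (by positivity) ?_ ?_ ?_ hK
    · calc erwV p n ≤ l * (n * erwA p n ^ 2) := hVA n (by omega)
        _ ≤ l * ((3 * k) * (l * erwA p k ^ 2)) := by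
          gcongr
          exact hA n k (by omega) hk (by omega) (by omega)
        _ = 3 * l ^ 2 * (k * erwA p k ^ 2) := by ring
        _ ≤ 3 * l ^ 2 * (l * erwV p k) := mul_le_mul_of_nonneg_left (hAV k hk) (by positivity)
        _ = 3 * l ^ 3 * erwV p k := by ring
        _ ≤ _ := by gcongr; linarith
    · exact one_div_le_one_div_of_le (by linarith) (by linarith)
    · refine (hD k hk).trans ?_
      rw [div_le_div_iff₀ hk0 (by linarith)]
      nlinarith
    · have h1 := hA (k + 1) n (by omega) (by omega) (by omega) (by omega)
      calc _ ≤ (l * erwA p n ^ 2) / (erwA p n ^ 2 / l * ((n : ℝ) - (k + 1) + A)) := by gcongr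
        _ = _ := by field_simp

theorem sum_Ico_inv_sub_le (n : ℕ) :
    ∑ k ∈ Finset.Ico 1 n, 1 / (((n : ℝ) - k) * √((n : ℝ) - k)) ≤
      ∑' k : ℕ, (k : ℝ) ^ (-(3 / 2) : ℝ) := by
  have hsum : Summable fun k : ℕ => (k : ℝ) ^ (-(3 / 2) : ℝ) :=
    Real.summable_nat_rpow.2 (by norm_num)
  have h1 : ∀ k ∈ Finset.Ico 1 n, 1 / (((n : ℝ) - k) * √((n : ℝ) - k)) =
      (fun j : ℕ => (j : ℝ) ^ (-(3 / 2) : ℝ)) (n - k) := fun k hk => by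
    obtain ⟨hk1, hk2⟩ := Finset.mem_Ico.1 hk
    have h0 : (0 : ℝ) < ((n - k : ℕ) : ℝ) := by exact_mod_cast (by omega : 0 < n - k)
    rw [← Nat.cast_sub hk2.le]
    simp only
    rw [Real.rpow_neg h0.le, show (3 / 2 : ℝ) = 1 + 1 / 2 by norm_num, Real.rpow_add h0,
      Real.rpow_one, ← Real.sqrt_eq_rpow, one_div]
  rw [Finset.sum_congr rfl h1, Finset.sum_Ico_reflect (fun j : ℕ => (j : ℝ) ^ (-(3 / 2) : ℝ)) 1
    (by omega : n ≤ n + 1)]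
  exact hsum.sum_le_tsum _ fun i _ => by positivity

/-- These are the coefficients of the induction hypothesis in the late steps. Without a large `A`
their sum is merely bounded, which would not close the induction. -/
theorem exists_sum_Ico_inv_sq_le {ε : ℝ} (hε : 0 < ε) : ∃ A : ℕ, 1 ≤ A ∧ ∀ n : ℕ,
    ∑ k ∈ Finset.Ico 1 n, (1 / ((n : ℝ) - (k + 1) + A)) ^ 2 ≤ ε := by
  obtain ⟨A, hA, h⟩ := exists_tail_sum_rpow_le (r := 2) (by norm_num) hε
  refine ⟨A, hA, fun n => ?_⟩
  have h1 : ∀ k ∈ Finset.Ico 1 n, (1 / ((n : ℝ) - (k + 1) + A)) ^ 2 =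
      (fun j : ℕ => (((j - 1 : ℕ) : ℝ) + A) ^ (-2 : ℝ)) (n - k) := fun k hk => by
    obtain ⟨hk1, hk2⟩ := Finset.mem_Ico.1 hk
    have e : ((n - k - 1 : ℕ) : ℝ) = (n : ℝ) - (k + 1) := by
      rw [Nat.sub_sub, Nat.cast_sub (by omega)]
      push_cast
      ring
    simp only
    rw [e]
    have h0 : (0 : ℝ) ≤ (n : ℝ) - (k + 1) + A := by
      rw [← e]
      positivity
    rw [Real.rpow_neg h0, one_div, inv_pow]
    norm_num
  rw [Finset.sum_congr rfl h1, Finset.sum_Ico_reflect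
    (fun j : ℕ => (((j - 1 : ℕ) : ℝ) + A) ^ (-2 : ℝ)) 1 (by omega : n ≤ n + 1),
    Finset.sum_Ico_eq_sum_range]
  simpa using h (n + 1 - 1 - (n + 1 - n))

theorem exists_sum_subcritical_le {p : ℝ} (hp : 0 < p) (hp' : p < 3 / 4) : ∃ L : ℝ, 1 ≤ L ∧
    ∀ n : ℕ, 1 ≤ n → ∑ k ∈ Finset.Ico 1 n, (erwA p (k + 1) ^ 2 * erwDriftSq p k / erwV p n +
      erwA p (k + 1) ^ 4 / erwV p n ^ 2 +
      1 / √(n : ℝ) * (1 / (((n : ℝ) - k) * √((n : ℝ) - k)))) ≤ L * erwRate p n := by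
  obtain ⟨l₁, hl₁, h1⟩ := exists_sum_drift_le hp hp'
  obtain ⟨l₂, hl₂, h2⟩ := exists_sum_erwA_pow_four_le hp hp'.le
  have hZ : 0 ≤ ∑' k : ℕ, (k : ℝ) ^ (-(3 / 2) : ℝ) := tsum_nonneg fun k => by positivity
  refine ⟨l₁ + l₂ + ∑' k : ℕ, (k : ℝ) ^ (-(3 / 2) : ℝ), by linarith, fun n hn => ?_⟩
  have hv := one_le_erwV hp hn
  have hv0 : 0 < erwV p n := by linarith
  have hε : 1 / √(n : ℝ) ≤ erwRate p n := by
    rw [erwRate]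
    have : 0 < 1 / erwV p n := by positivity
    linarith
  have hn0 : 0 ≤ 1 / √(n : ℝ) := by positivity
  rw [Finset.sum_add_distrib, Finset.sum_add_distrib, ← Finset.sum_div, ← Finset.sum_div,
    ← Finset.mul_sum]
  have t1 : (∑ k ∈ Finset.Ico 1 n, erwA p (k + 1) ^ 2 * erwDriftSq p k) / erwV p n ≤
      l₁ * erwRate p n := by
    rw [div_le_iff₀ hv0]
    refine (Finset.sum_le_sum_of_subset_of_nonneg (fun k hk => ?_) fun k hk _ => ?_).trans
      ((h1 n hn).trans_eq (by ring))
    · have := Finset.mem_Ico.1 hk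
      exact Finset.mem_Icc.2 ⟨this.1, this.2.le⟩
    · have := erwDriftSq_pos hp (Finset.mem_Icc.1 hk).1
      positivity
  have t2 : (∑ k ∈ Finset.Ico 1 n, erwA p (k + 1) ^ 4) / erwV p n ^ 2 ≤ l₂ * erwRate p n := by
    rw [div_le_iff₀ (by positivity), Finset.sum_Ico_add' (fun k => erwA p k ^ 4) 1 n 1]
    refine (Finset.sum_le_sum_of_subset_of_nonneg (fun k hk => ?_) fun k hk _ => ?_).trans
      ((h2 n hn).trans_eq (by ring))
    · have := Finset.mem_Ico.1 hk
      exact Finset.mem_Icc.2 ⟨by omega, by omega⟩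
    · positivity
  have t3 : 1 / √(n : ℝ) * ∑ k ∈ Finset.Ico 1 n, 1 / (((n : ℝ) - k) * √((n : ℝ) - k)) ≤
      (∑' k : ℕ, (k : ℝ) ^ (-(3 / 2) : ℝ)) * erwRate p n := by
    rw [mul_comm]
    exact mul_le_mul (sum_Ico_inv_sub_le n) hε hn0 hZ
  linarith

theorem exists_subcritical_berry_esseen {p : ℝ} (hp : 0 < p) (hp' : p < 3 / 4) : ∃ C : ℝ, 1 ≤ C ∧
    ∀ {Ω : Type*} [MeasurableSpace Ω] (μ : Measure Ω) [IsProbabilityMeasure μ] (q : ℝ)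
      (α : ℕ → Ω → ℝ) (β : ℕ → Ω → ℕ) (X : ℕ → Ω → ℝ), IsElephantWalk μ p q α β X →
      0 ≤ q → q ≤ 1 → ∀ n : ℕ, 1 ≤ n → ∀ u,
      |cdfGap (μ.map (walkMartingale p q X n)) (√(erwV p n)) u| ≤ C * erwRate p n := by
  obtain ⟨c, hc1, hc⟩ := exists_walk_step_bound
  obtain ⟨c', hc1', hc'⟩ := exists_walk_gap_le
  obtain ⟨L, hL, hstep⟩ := exists_subcritical_step_le hp hp'
  obtain ⟨L', hL', hsum⟩ := exists_sum_subcritical_le hp hp'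
  obtain ⟨l, hl, hVA, hAV, -, -, -, hs2, -⟩ := exists_subcritical_comparison hp hp'
  -- One factor `L` comes from the step estimate and one from comparing the rates at `k` and `n`;
  -- after multiplication by `c'` the fed-back errors amount to `D / 2` times the rate. The choice
  -- of `A` precedes that of `D`.
  obtain ⟨A, hA1, hA⟩ := exists_sum_Ico_inv_sq_le (ε := 1 / (2 * c' * c * L ^ 2)) (by positivity)
  have hA1' : (1 : ℝ) ≤ A := by exact_mod_cast hA1
  set D := 2 * c' * (l ^ 2 + c * L * L' + A * l) with hD
  have hl2 : 1 ≤ l ^ 2 := one_le_pow₀ hl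
  have hcLL : 0 < c * L * L' := by positivity
  have hAl : 0 < A * l := by positivity
  have hD1 : 1 ≤ D := by
    refine one_le_mul_of_one_le_of_one_le (by linarith) (by linarith)
  refine ⟨D, hD1, fun {Ω} _ μ _ q α β X h hq hq' n => ?_⟩
  induction n using Nat.strong_induction_on with
  | _ n ih =>
  intro hn u
  have hv := one_le_erwV hp hn
  have hv0 : 0 < erwV p n := by linarith
  have hε0 : 0 < erwRate p n := by rw [erwRate]; positivity
  rcases Nat.lt_or_ge n 2 with hn2 | hn2
  · obtain rfl : n = 1 := by omega
    refine cdfGap_le_of_bound_ge_one _ _ _ ?_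
    rw [erwRate, erwV_one hp]
    norm_num
    linarith
  have han := erwA_pos hp hn
  -- The smoothing amounts to `A` further steps of the last size. Since `n a_n²` is at most of order
  -- `v_n`, removing it costs `O(1 / √n)`.
  set κ := √(A : ℝ) * erwA p n with hκ
  have hκ0 : 0 < κ := by positivity
  have hκ2 : κ ^ 2 = A * erwA p n ^ 2 := by rw [hκ, mul_pow, Real.sq_sqrt (by linarith)]
  set f : ℕ → ℝ := fun k => erwA p (k + 1) ^ 2 * erwDriftSq p k / erwV p n +
      erwA p (k + 1) ^ 4 / erwV p n ^ 2 +
      1 / √(n : ℝ) * (1 / (((n : ℝ) - k) * √((n : ℝ) - k))) with hf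
  set g : ℕ → ℝ := fun k => (1 / ((n : ℝ) - (k + 1) + A)) ^ 2 with hg
  have hτ : ∀ k, 1 ≤ k → k < n → ∀ u,
      |smoothCdf (√(erwV p n - erwV p (k + 1) + κ ^ 2)) (μ.map (walkMartingale p q X (k + 1))) u -
          smoothCdf (√(√(erwV p n - erwV p (k + 1) + κ ^ 2) ^ 2 + erwA p (k + 1) ^ 2))
            (μ.map (walkMartingale p q X k)) u| ≤
      c * L * (f k + D * (L * erwRate p n) * g k) := fun k hk hkn u => by
    have hpos : 0 < erwV p n - erwV p (k + 1) + κ ^ 2 := by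
      have := erwV_mono p (show k + 1 ≤ n by omega)
      have : 0 < κ ^ 2 := by positivity
      linarith
    have hvk := one_le_erwV hp hk
    have hr := erwDriftSq_pos hp hk
    have hm : (0 : ℝ) < (n : ℝ) - k := by
      have : (k : ℝ) < n := by exact_mod_cast hkn
      linarith
    obtain ⟨h1, h2⟩ := hc μ p q α β X h hp (by linarith) k hk _ (Real.sqrt_pos.2 hpos)
    obtain ⟨h3, h4⟩ := hstep A hA1' k n hk hkn
    have f1 : 0 ≤ erwA p (k + 1) ^ 2 * erwDriftSq p k / erwV p n := by positivity
    have f2 : 0 ≤ 1 / √(n : ℝ) * (1 / (((n : ℝ) - k) * √((n : ℝ) - k))) := by positivity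
    have f3 : 0 ≤ D * (L * erwRate p n) * g k := by positivity
    rw [mul_assoc c]
    rcases le_or_gt (2 * (k + 1)) n with hlt | hgt
    · refine (h1 u).trans (mul_le_mul_of_nonneg_left ?_ (by linarith))
      rw [hκ2]
      refine (h3 hlt).trans (mul_le_mul_of_nonneg_left ?_ (by linarith))
      simp only [hf]
      linarith
    · obtain ⟨h5, h6⟩ := h4 hgt
      have hK : ∀ u, |cdfGap (μ.map (walkMartingale p q X k)) (√(erwV p k)) u| ≤
          D * (L * erwRate p n) := fun u =>
        (ih k hkn hk u).trans (mul_le_mul_of_nonneg_left h5 (by linarith))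
      refine (h2 _ _ (Real.sqrt_pos.2 (by linarith)) hK u).trans
        (mul_le_mul_of_nonneg_left ?_ (by linarith))
      rw [Real.sq_sqrt hpos.le, Real.sq_sqrt (by linarith : 0 ≤ erwV p k), hκ2]
      refine (h6 _ (by positivity)).trans (mul_le_mul_of_nonneg_left ?_ (by linarith))
      simp only [hf, hg]
      linarith
  refine (hc' μ p q α β X h hp hq hq' n hn κ hκ0 _ hτ u).trans ?_
  have b1 : 1 / (erwV p n - 1 + κ ^ 2) ≤ l ^ 2 * erwRate p n := by
    have h1 := hs2 1 n le_rfl (by omega)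
    rw [erwV_one hp] at h1
    have h2 : erwV p n ≤ l ^ 2 * (erwV p n - 1 + κ ^ 2) := by
      calc _ ≤ l * (n * erwA p n ^ 2) := hVA n hn
        _ ≤ l * (l * (erwV p n - 1)) := by gcongr
        _ = l ^ 2 * (erwV p n - 1) := by ring
        _ ≤ _ := by
          gcongr
          have : 0 < κ ^ 2 := by positivity
          linarith
    have h3 : 0 < erwV p n - 1 + κ ^ 2 := by
      have : 0 < κ ^ 2 := by positivity
      linarith
    calc 1 / (erwV p n - 1 + κ ^ 2) ≤ l ^ 2 * (1 / erwV p n) := by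
          rw [mul_one_div, div_le_div_iff₀ h3 hv0]
          linarith
      _ ≤ _ := by
          gcongr
          rw [erwRate]
          have : 0 ≤ 1 / √(n : ℝ) := by positivity
          linarith
  have b2 : κ / √(erwV p n) ≤ A * l * erwRate p n := by
    have hn0 : (0 : ℝ) < n := by exact_mod_cast hn
    have h1 : erwA p n / √(erwV p n) ≤ l * (1 / √(n : ℝ)) := by
      rw [mul_one_div, div_le_div_iff₀ (by positivity) (by positivity)]
      refine abs_le_of_sq_le_sq' ?_ (by positivity) |>.2
      rw [mul_pow, mul_pow, Real.sq_sqrt hn0.le, Real.sq_sqrt hv0.le]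
      have : l * erwV p n ≤ l ^ 2 * erwV p n := by
        gcongr
        exact le_self_pow₀ hl (by norm_num)
      linarith [hAV n hn]
    have h2 : √(A : ℝ) ≤ A := Real.sqrt_le_left (by linarith) |>.2 (le_self_pow₀ hA1' (by norm_num))
    calc κ / √(erwV p n) = √(A : ℝ) * (erwA p n / √(erwV p n)) := by rw [hκ, mul_div_assoc]
      _ ≤ A * (l * (1 / √(n : ℝ))) := by gcongr
      _ = A * l * (1 / √(n : ℝ)) := by ring
      _ ≤ _ := by
          gcongr
          rw [erwRate]
          have : 0 ≤ 1 / erwV p n := by positivity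
          linarith
  have b3 : ∑ k ∈ Finset.Ico 1 n, c * L * (f k + D * (L * erwRate p n) * g k) ≤
      c * L * L' * erwRate p n + D / (2 * c') * erwRate p n := by
    rw [← Finset.mul_sum, Finset.sum_add_distrib, ← Finset.mul_sum]
    calc _ ≤ c * L * (L' * erwRate p n + D * (L * erwRate p n) * (1 / (2 * c' * c * L ^ 2))) := by
          have h1 := hsum n hn
          have h2 := hA n
          gcongr
      _ = _ := by field_simp
  calc _ ≤ c' * (l ^ 2 * erwRate p n + (c * L * L' * erwRate p n + D / (2 * c') * erwRate p n) +
        A * l * erwRate p n) := by gcongr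
    _ = c' * (l ^ 2 + c * L * L' + A * l) * erwRate p n + D / 2 * erwRate p n := by
        field_simp
        ring
    _ = _ := by
        rw [hD]
        ring

/-- The Berry-Esseen bound for the elephant random walk with unit steps. -/
theorem exists_walk_berry_esseen {p : ℝ} (hp : 0 < p) (hp' : p ≤ 3 / 4) : ∃ C : ℝ, 1 ≤ C ∧
    ∀ {Ω : Type*} [MeasurableSpace Ω] (μ : Measure Ω) [IsProbabilityMeasure μ] (q : ℝ)
      (α : ℕ → Ω → ℝ) (β : ℕ → Ω → ℕ) (X : ℕ → Ω → ℝ), IsElephantWalk μ p q α β X →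
      0 ≤ q → q ≤ 1 → ∀ n : ℕ, 1 ≤ n → ∀ u,
      |cdfGap (μ.map (walkMartingale p q X n)) (√(erwV p n)) u| ≤ C * erwRate p n := by
  rcases hp'.lt_or_eq with h | rfl
  · exact exists_subcritical_berry_esseen hp h
  · exact exists_critical_berry_esseen

/-! ### Random step sizes -/

theorem measurable_measureReal_section {Ω E F : Type*} [MeasurableSpace Ω] [MeasurableSpace E]
    [MeasurableSpace F] {μ : Measure Ω} [IsProbabilityMeasure μ] {X : Ω → E} {Z : Ω → F}
    (hX : Measurable X) (hZ : Measurable Z) {s : Set (E × F)} (hs : MeasurableSet s) :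
    Measurable fun ω => μ.real {ω' | (X ω, Z ω') ∈ s} := by
  have h1 := ((measurable_measure_prodMk_left (ν := μ.map Z) hs).comp hX).ennreal_toReal
  convert h1 using 2 with ω
  simp only [Function.comp]
  rw [Measure.map_apply hZ (measurable_prodMk_left hs)]
  rfl

/-- Fubini's theorem for the probability of an event that depends on two independent variables. -/
theorem IndepFun.measureReal_eq_integral {Ω E F : Type*} [MeasurableSpace Ω] [MeasurableSpace E]
    [MeasurableSpace F] {μ : Measure Ω} [IsProbabilityMeasure μ] {X : Ω → E} {Z : Ω → F}
    (h : IndepFun X Z μ) (hX : Measurable X) (hZ : Measurable Z) {s : Set (E × F)}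
    (hs : MeasurableSet s) :
    μ.real {ω | (X ω, Z ω) ∈ s} = ∫ ω, μ.real {ω' | (X ω, Z ω') ∈ s} ∂μ := by
  have hm := (indepFun_iff_map_prod_eq_prod_map_map hX.aemeasurable hZ.aemeasurable).1 h
  have h1 : μ {ω | (X ω, Z ω) ∈ s} = ∫⁻ ω, μ {ω' | (X ω, Z ω') ∈ s} ∂μ := by
    have h2 := Measure.map_apply (μ := μ) (hX.prodMk hZ) hs
    have : IsProbabilityMeasure (μ.map Z) := Measure.isProbabilityMeasure_map hZ.aemeasurable
    rw [hm, Measure.prod_apply hs, lintegral_map (measurable_measure_prodMk_left hs) hX] at h2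
    refine h2.symm.trans (lintegral_congr fun ω => ?_)
    rw [Measure.map_apply hZ (measurable_prodMk_left hs)]
    rfl
  have h3 : Measurable fun ω => μ {ω' | (X ω, Z ω') ∈ s} := by
    convert (measurable_measure_prodMk_left (ν := μ.map Z) hs).comp hX using 2 with ω
    simp only [Function.comp]
    rw [Measure.map_apply hZ (measurable_prodMk_left hs)]
    rfl
  simp only [Measure.real]
  rw [integral_toReal h3.aemeasurable (Filter.Eventually.of_forall fun ω => measure_lt_top _ _), h1]

theorem IsElephantWalk.ae_forall_eq {Ω : Type*} [MeasurableSpace Ω] {μ : Measure Ω}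
    [IsProbabilityMeasure μ] {p q : ℝ} {α : ℕ → Ω → ℝ} {β : ℕ → Ω → ℕ} {X : ℕ → Ω → ℝ}
    (h : IsElephantWalk μ p q α β X) :
    ∀ᵐ ω ∂μ, ∀ i : ℕ, X (i + 1) ω = 1 ∨ X (i + 1) ω = -1 :=
  ae_all_iff.2 fun i => h.ae_eq (i + 1) (by omega)

theorem abs_sub_one_rpow_le {z r : ℝ} (hz : 0 < z) (hr : 0 < r) : |z - 1| ^ r ≤ z ^ r + 1 := by
  have h1 : 0 < z ^ r := by positivity
  rcases le_or_gt z 1 with h | h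
  · have : |z - 1| ^ r ≤ 1 := Real.rpow_le_one (abs_nonneg _)
      (by rw [abs_le]; constructor <;> linarith) hr.le
    linarith
  · have : |z - 1| ^ r ≤ z ^ r := Real.rpow_le_rpow (abs_nonneg _)
      (by rw [abs_le]; constructor <;> linarith) hr.le
    linarith

/-- The signed centred step sizes satisfy the Berry-Esseen bound, uniformly in the signs. -/
theorem exists_signed_berry_esseen {ρ σ : ℝ} (hρ : 0 < ρ) (hρ' : ρ ≤ 1) (hσ : 0 < σ) (M : ℝ) :
    ∃ C : ℝ, 1 ≤ C ∧ ∀ {Ω : Type*} [MeasurableSpace Ω] (μ : Measure Ω) [IsProbabilityMeasure μ]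
      (Z : ℕ → Ω → ℝ), IsStepSizes μ σ Z → Integrable (fun ω => Z 1 ω ^ (2 + ρ)) μ →
      ∫ ω, Z 1 ω ^ (2 + ρ) ∂μ = M → ∀ x : ℕ → ℝ, (∀ i, x i = 1 ∨ x i = -1) →
      ∀ n : ℕ, 1 ≤ n → ∀ u,
        |cdfGap (μ.map fun ω => ∑ i ∈ Finset.range n, x i * (Z (i + 1) ω - 1)) (σ * √n) u|
          ≤ C * (n : ℝ) ^ (-(ρ / 2)) := by
  obtain ⟨C, hC1, hC⟩ := exists_berry_esseen hρ hρ' hσ (M + 1)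
  refine ⟨C, hC1, fun {Ω} _ μ _ Z h hi hM x hx n hn u => ?_⟩
  have hZm : ∀ i, Measurable (Z (i + 1)) := fun i => h.measurable (i + 1) (by omega)
  have hid : ∀ i, IdentDistrib (Z (i + 1)) (Z 1) μ μ := fun i => h.identDistrib (i + 1) (by omega)
  have hx2 : ∀ i, x i ^ 2 = 1 := fun i => by rcases hx i with e | e <;> simp [e]
  have hxa : ∀ i, |x i| = 1 := fun i => by rcases hx i with e | e <;> simp [e]
  have hL2 : ∀ i, MemLp (Z (i + 1)) 2 μ := fun i => (hid i).symm.memLp_iff.1 h.memLp_two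
  have hmean : ∀ i, ∫ ω, Z (i + 1) ω ∂μ = 1 := fun i => (hid i).integral_eq.trans h.mean_eq
  have hint : ∀ i, Integrable (Z (i + 1)) μ := fun i => (hL2 i).integrable (by norm_num)
  have hpow : ∀ i, Integrable (fun ω => Z (i + 1) ω ^ (2 + ρ)) μ ∧
      ∫ ω, Z (i + 1) ω ^ (2 + ρ) ∂μ = M := fun i => by
    have h1 := (hid i).comp (u := fun z : ℝ => z ^ (2 + ρ)) (by fun_prop)
    exact ⟨h1.integrable_iff.2 hi, h1.integral_eq.trans hM⟩
  have hdom : ∀ i, ∀ᵐ ω ∂μ, |x i * (Z (i + 1) ω - 1)| ^ (2 + ρ) ≤ Z (i + 1) ω ^ (2 + ρ) + 1 :=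
    fun i => by
    filter_upwards [h.pos (i + 1) (by omega)] with ω hω
    rw [abs_mul, hxa, one_mul]
    exact abs_sub_one_rpow_le hω (by linarith)
  have hdi : ∀ i, Integrable (fun ω => |x i * (Z (i + 1) ω - 1)| ^ (2 + ρ)) μ := fun i => by
    have hm := hZm i
    have hm' : Measurable fun ω => |x i * (Z (i + 1) ω - 1)| := by fun_prop
    refine ((hpow i).1.add (integrable_const 1)).mono' (hm'.pow_const _).aestronglyMeasurable ?_
    filter_upwards [hdom i] with ω hω
    rwa [Real.norm_eq_abs, abs_of_nonneg (by positivity)]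
  refine hC μ (fun i ω => x i * (Z (i + 1) ω - 1)) (fun i => ((hZm i).sub_const 1).const_mul _)
    (h.indep.comp (fun i z => x i * (z - 1)) fun i => by fun_prop) (fun i => ?_) (fun i => ?_)
    (fun i => ?_) hdi (fun i => ?_) n hn u
  · simp only [mul_pow]
    exact ((hL2 i).sub (memLp_const 1)).integrable_sq.const_mul _
  · rw [integral_const_mul, integral_sub (hint i) (integrable_const _), hmean]
    simp
  · simp only [mul_pow, hx2, one_mul]
    have h1 := (hid i).variance_eq
    rw [h.variance_eq, variance_eq_integral (hZm i).aemeasurable, hmean] at h1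
    exact h1
  · refine (integral_mono_ae (hdi i) ((hpow i).1.add (integrable_const 1)) (hdom i)).trans_eq ?_
    have := integral_add (hpow i).1 (integrable_const (1 : ℝ))
    simp only [Pi.add_apply]
    rw [this, (hpow i).2]
    simp

theorem walkPosition_eq {Ω : Type*} (p q : ℝ) (X Z : ℕ → Ω → ℝ) (n : ℕ) (ω : Ω) :
    erwA p n * walkPosition X Z n ω - (2 * q - 1) = walkMartingale p q X n ω +
      erwA p n * ∑ i ∈ Finset.range n, X (i + 1) ω * (Z (i + 1) ω - 1) := by
  have h1 : walkPosition X Z n ω = ∑ i ∈ Finset.range n, X (i + 1) ω * Z (i + 1) ω := by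
    rw [walkPosition, Finset.range_eq_Ico,
      Finset.sum_Ico_add' (fun i => X i ω * Z i ω) 0 n 1]
    rfl
  simp only [mul_sub, Finset.sum_sub_distrib, mul_one]
  rw [h1, walkMartingale, unitPosition]
  ring

/-- Conditioning on the signs. -/
theorem abs_measureReal_sub_smoothCdf_le {Ω : Type*} [MeasurableSpace Ω] {μ : Measure Ω}
    [IsProbabilityMeasure μ] {p q σ δ : ℝ} {α : ℕ → Ω → ℝ} {β : ℕ → Ω → ℕ} {X Z : ℕ → Ω → ℝ}
    (h : IsElephantWalk μ p q α β X) (hZ : IsStepSizes μ σ Z)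
    (hXZ : IndepFun (fun ω => fun i : ℕ => X (i + 1) ω) (fun ω => fun i : ℕ => Z (i + 1) ω) μ)
    (hp : 0 < p) {n : ℕ} (hn : 1 ≤ n)
    (hδ : ∀ x : ℕ → ℝ, (∀ i, x i = 1 ∨ x i = -1) → ∀ u,
      |cdfGap (μ.map fun ω => ∑ i ∈ Finset.range n, x i * (Z (i + 1) ω - 1)) (σ * √n) u| ≤ δ)
    (u : ℝ) :
    |μ.real {ω | erwA p n * walkPosition X Z n ω - (2 * q - 1) ≤ u} -
      smoothCdf (erwA p n * (σ * √n)) (μ.map (walkMartingale p q X n)) u| ≤ δ := by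
  have ha := erwA_pos hp hn
  have hXm : Measurable fun ω => fun i : ℕ => X (i + 1) ω :=
    measurable_pi_iff.2 fun i => h.measurable (i + 1) (by omega)
  have hZm : Measurable fun ω => fun i : ℕ => Z (i + 1) ω :=
    measurable_pi_iff.2 fun i => hZ.measurable (i + 1) (by omega)
  set s : Set ((ℕ → ℝ) × (ℕ → ℝ)) := {y | erwA p n * ∑ i ∈ Finset.range n, y.1 i - (2 * q - 1) +
    erwA p n * ∑ i ∈ Finset.range n, y.1 i * (y.2 i - 1) ≤ u} with hs
  have hsm : MeasurableSet s := measurableSet_le (by fun_prop) measurable_const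
  have e1 : {ω | erwA p n * walkPosition X Z n ω - (2 * q - 1) ≤ u} =
      {ω | ((fun i : ℕ => X (i + 1) ω), (fun i : ℕ => Z (i + 1) ω)) ∈ s} := by
    ext ω
    simp only [Set.mem_ofPred_eq, hs]
    rw [walkPosition_eq]
    rfl
  have hMm := h.measurable_walkMartingale n
  have hm1 := measurable_measureReal_section (μ := μ) hXm hZm hsm
  have hi1 : Integrable (fun ω => μ.real {ω' | ((fun i : ℕ => X (i + 1) ω),
      (fun i : ℕ => Z (i + 1) ω')) ∈ s}) μ :=
    Integrable.of_bound hm1.aestronglyMeasurable 1 (Filter.Eventually.of_forall fun ω => by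
      rw [Real.norm_eq_abs, abs_of_nonneg measureReal_nonneg]
      exact measureReal_le_one)
  have hi2 : Integrable (fun ω =>
      stdCdf ((u - walkMartingale p q X n ω) / (erwA p n * (σ * √n)))) μ := by
    refine Integrable.of_bound (measurable_stdCdf.comp
      (f := fun ω => (u - walkMartingale p q X n ω) / (erwA p n * (σ * √n)))
      ((hMm.const_sub u).div_const _)).aestronglyMeasurable 1 ?_
    exact Filter.Eventually.of_forall fun ω => abs_cdf_le _ _
  rw [e1, IndepFun.measureReal_eq_integral hXZ hXm hZm hsm, smoothCdf_map hMm,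
    ← integral_sub hi1 hi2]
  have hb : ∀ᵐ ω ∂μ, ‖μ.real {ω' | ((fun i : ℕ => X (i + 1) ω), (fun i : ℕ => Z (i + 1) ω')) ∈ s} -
      stdCdf ((u - walkMartingale p q X n ω) / (erwA p n * (σ * √n)))‖ ≤ δ := by
    filter_upwards [h.ae_forall_eq] with ω hω
    -- With the signs frozen at `ω`, the martingale is a constant and the event becomes a bound on
    -- the signed sum of the centered step sizes.
    have h1 := hδ (fun i => X (i + 1) ω) hω ((u - walkMartingale p q X n ω) / erwA p n)
    have hBm : Measurable fun ω' => ∑ i ∈ Finset.range n, X (i + 1) ω * (Z (i + 1) ω' - 1) :=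
      Finset.measurable_sum _ fun i _ => ((hZ.measurable (i + 1) (by omega)).sub_const 1).const_mul _
    have : IsProbabilityMeasure (μ.map fun ω' =>
        ∑ i ∈ Finset.range n, X (i + 1) ω * (Z (i + 1) ω' - 1)) :=
      Measure.isProbabilityMeasure_map hBm.aemeasurable
    rw [cdfGap, cdf_eq_real, map_measureReal_apply hBm measurableSet_Iic, div_div] at h1
    rw [Real.norm_eq_abs]
    convert h1 using 4
    ext ω'
    simp only [Set.mem_ofPred_eq, hs, Set.mem_preimage, Set.mem_Iic]
    rw [le_div_iff₀ ha, walkMartingale, unitPosition]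
    constructor <;> intro hh <;> linarith
  simpa using norm_integral_le_of_norm_le_const hb

theorem kolmogorovDist_le_of_forall {Ω : Type*} [MeasurableSpace Ω] {μ : Measure Ω} {V : Ω → ℝ}
    {w b : ℝ} (hw : 0 < w) (h : ∀ u, |μ.real {ω | V ω ≤ u} - stdCdf (u / w)| ≤ b) :
    kolmogorovDist μ (fun ω => V ω / w) ≤ b := by
  refine ciSup_le fun u => ?_
  have h1 := h (u * w)
  rw [mul_div_cancel_right₀ _ hw.ne'] at h1
  simpa only [div_le_iff₀ hw] using h1

theorem erwRate_le {p ρ : ℝ} (hρ' : ρ ≤ 1) {n : ℕ} (hn : 1 ≤ n) :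
    erwRate p n ≤ 1 / (n : ℝ) ^ (ρ / 2) + 1 / erwV p n := by
  have hn1 : (1 : ℝ) ≤ n := by exact_mod_cast hn
  rw [erwRate, Real.sqrt_eq_rpow]
  gcongr

theorem cdfGap_map_eq {Ω : Type*} [MeasurableSpace Ω] {μ : Measure Ω} [IsProbabilityMeasure μ]
    {V : Ω → ℝ} (hV : Measurable V) (w u : ℝ) :
    cdfGap (μ.map V) w u = μ.real {ω | V ω ≤ u} - stdCdf (u / w) := by
  have : IsProbabilityMeasure (μ.map V) := Measure.isProbabilityMeasure_map hV.aemeasurable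
  rw [cdfGap, cdf_eq_real, map_measureReal_apply hV measurableSet_Iic]
  rfl

theorem theorem4 (p q ρ σ M : ℝ) (hp : 0 < p) (hp' : p ≤ 3 / 4) (hq : 0 < q) (hq' : q ≤ 1)
    (hρ : 0 < ρ) (hρ' : ρ ≤ 1) (hσ : 0 ≤ σ) :
    ∃ C : ℝ, 0 < C ∧
      ∀ (Ω : Type*) [MeasurableSpace Ω] (μ : Measure Ω) [IsProbabilityMeasure μ]
        (α : ℕ → Ω → ℝ) (β : ℕ → Ω → ℕ) (X Z : ℕ → Ω → ℝ),
        IsElephantWalk μ p q α β X →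
        IsStepSizes μ σ Z →
        IndepFun (fun ω => fun i : ℕ => X (i + 1) ω) (fun ω => fun i : ℕ => Z (i + 1) ω) μ →
        Integrable (fun ω => Z 1 ω ^ (2 + ρ)) μ →
        ∫ ω, Z 1 ω ^ (2 + ρ) ∂μ = M →
        ∀ n : ℕ, 1 ≤ n →
          kolmogorovDist μ (fun ω =>
              (erwA p n * walkPosition X Z n ω - (2 * q - 1)) /
                √(erwV p n + n * erwA p n ^ 2 * σ ^ 2))
            ≤ C * (1 / (n : ℝ) ^ (ρ / 2) + 1 / erwV p n) := by
  obtain ⟨C, hC1, hC⟩ := exists_walk_berry_esseen hp hp'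
  -- For `σ = 0` the step sizes are almost surely `1`, there is nothing to smooth by, and the bound
  -- for unit steps applies directly.
  rcases hσ.eq_or_lt with rfl | hσ
  · refine ⟨C, by linarith, fun Ω _ μ _ α β X Z h hZ hXZ hi hM n hn => ?_⟩
    have hv := one_le_erwV hp hn
    have hZ1 : ∀ᵐ ω ∂μ, ∀ i : ℕ, Z (i + 1) ω = 1 := ae_all_iff.2 fun i => by
      have hid := hZ.identDistrib (i + 1) (by omega)
      have h1 := ae_eq_integral_of_variance_eq_zero (hid.symm.memLp_iff.1 hZ.memLp_two)
        (by rw [hid.variance_eq, hZ.variance_eq]; norm_num)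
      rwa [hid.integral_eq, hZ.mean_eq] at h1
    refine (kolmogorovDist_le_of_forall (Real.sqrt_pos.2 (by nlinarith)) fun u => ?_).trans
      (mul_le_mul_of_nonneg_left (erwRate_le hρ' hn) (by linarith))
    have h1 := hC μ q α β X h hq.le hq' n hn u
    rw [cdfGap_map_eq (h.measurable_walkMartingale n)] at h1
    have e : μ.real {ω | erwA p n * walkPosition X Z n ω - (2 * q - 1) ≤ u} =
        μ.real {ω | walkMartingale p q X n ω ≤ u} := by
      refine measureReal_congr ?_
      filter_upwards [hZ1] with ω hω
      refine propext ?_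
      change erwA p n * walkPosition X Z n ω - (2 * q - 1) ≤ u ↔ walkMartingale p q X n ω ≤ u
      rw [walkPosition_eq]
      simp [hω]
    rw [e]
    simpa using h1
  · obtain ⟨C', hC1', hC'⟩ := exists_signed_berry_esseen hρ hρ' hσ M
    refine ⟨C' + C, by linarith, fun Ω _ μ _ α β X Z h hZ hXZ hi hM n hn => ?_⟩
    have hv := one_le_erwV hp hn
    have ha := erwA_pos hp hn
    have hn0 : (0 : ℝ) < n := by exact_mod_cast hn
    refine kolmogorovDist_le_of_forall (Real.sqrt_pos.2 (by positivity)) fun u => ?_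
    have h1 := abs_measureReal_sub_smoothCdf_le h hZ hXZ hp hn
      (fun x hx => hC' μ Z hZ hi hM x hx n hn) u
    have : IsProbabilityMeasure (μ.map (walkMartingale p q X n)) :=
      Measure.isProbabilityMeasure_map (h.measurable_walkMartingale n).aemeasurable
    rw [smoothCdf_eq_add_cdfGap (by positivity) (Real.sqrt_pos.2 (show 0 < erwV p n by linarith))]
      at h1
    -- Averaging over the normal contribution of the step sizes cannot enlarge the gap of the walk
    -- with unit steps, so its bound carries over with the same constant.
    have h2 := abs_gaussSmooth_le (erwA p n * (σ * √(n : ℝ))) (hC μ q α β X h hq.le hq' n hn) u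
    have e : (erwA p n * (σ * √(n : ℝ))) ^ 2 + √(erwV p n) ^ 2 =
        erwV p n + n * erwA p n ^ 2 * σ ^ 2 := by
      rw [mul_pow, mul_pow, Real.sq_sqrt hn0.le, Real.sq_sqrt (by linarith)]
      ring
    rw [e, Real.rpow_neg hn0.le, ← one_div] at h1
    have h3 := mul_le_mul_of_nonneg_left (erwRate_le (p := p) hρ' hn) (show 0 ≤ C by linarith)
    have h4 : 0 ≤ C' * (1 / erwV p n) := by positivity
    rw [abs_le] at *
    constructor <;> linarith
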